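/- Let $n\ge 1$, let $\Omega\subset\mathbb R^n$ be a bounded Lipschitz domain, $s>0$ a non-integer, and $T>0$. Write $\Omega_T=\Omega\times(0,T)$ and $(\Omega_e)_T=(\mathbb R^n\setminus\overline\Omega)\times(0,T)$. All functions are real-valued. Let $\widetilde H^s(\Omega)$ and $\widetilde L^2(\Omega)$ be the closures of $C_c^\infty(\Omega)$ in $H^s(\mathbb R^n)$ and $L^2(\mathbb R^n)$, let $H^{-s}(\Omega)=(\widetilde H^s(\Omega))^*$ with duality pairing $\langle\cdot,\cdot\rangle$, and regard $\widetilde L^2(\Omega)\subset H^{-s}(\Omega)$ through the $L^2$ inner product. Let $1\le p\le\infty$ satisfy $$n/s\le p\le\infty\ \text{ if } 2s<n,\qquad 2<p\le\infty\ \text{ if } 2s=n,\qquad 2\le p\le\infty\ \text{ if } 2s>n .$$ **Theorem.** Let $q\in L^p(\Omega)$, $F\in L^2(0,T;H^{-s}(\Omega))$, $u_0\in\widetilde L^2(\Omega)$ and $u_1\in H^{-s}(\Omega)$. Then the problem $$\begin{cases}\partial_t^2u+(-\Delta)^su+qu=F&\text{in }\Omega_T,\\ u=0&\text{in }(\Omega_e)_T,\\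 u(0)=u_0,\quad\partial_tu(0)=u_1&\text{in }\Omega\end{cases}$$ has a unique very weak solution $u\in C([0,T];\widetilde L^2(\Omega))\cap C^1([0,T];H^{-s}(\Omega))$. Here $u\in C([0,T];\widetilde L^2(\Omega))\cap C^1([0,T];H^{-s}(\Omega))$ is called a *very weak solution* if $$\int_0^T\langle u(t),G(t)\rangle_{L^2(\Omega)}\,dt=\int_0^T\langle F(t),v(t)\rangle\,dt+\langle u_1,v(0)\rangle-\langle u_0,\partial_tv(0)\rangle_{L^2(\Omega)}$$ for every $G\in L^2(0,T;\widetilde L^2(\Omega))$, where $v\in C([0,T];\widetilde H^s(\Omega))\cap C^1([0,T];\widetilde L^2(\Omega))$ is the weak solution of the backward problem $\partial_t^2v+(-\Delta)^sv+qv=G$ in $\Omega_T$, $v=0$ in $(\Omega_e)_T$, $v(T)=\partial_tv(T)=0$ in $\Omega$; that is, $v(T)=\partial_tv(T)=0$ and, for all $w\in\widetilde H^s(\Omega)$, $$\frac{d}{dt}\langle\partial_tv,w\rangle_{L^2(\Omega)}+\langle(-\Delta)^{s/2}v,(-\Delta)^{s/2}w\rangle_{L^2(\mathbb R^n)}+\langle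 qv,w\rangle_{L^2(\Omega)}=\langle G,w\rangle_{L^2(\Omega)}\quad\text{in }\mathscr D'((0,T)).$$ -/

import Mathlib

open MeasureTheory Set
open scoped NNReal ENNReal FourierTransform ContDiff

noncomputable section

namespace NonlocalWave

/-- Real Lebesgue space `L²(ℝⁿ; ℝ)`. -/
abbrev L2R (n : ℕ) : Type := Lp ℝ 2 (volume : Measure (EuclideanSpace ℝ (Fin n)))

/-- Complex Lebesgue space `L²(ℝⁿ; ℂ)`. -/
abbrev L2C (n : ℕ) : Type := Lp ℂ 2 (volume : Measure (EuclideanSpace ℝ (Fin n)))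

/-! ### Bounded Lipschitz domains -/

/-- A bounded Lipschitz domain: a bounded open set which near each of its boundary points is,
after a rotation taking `e` to the vertical direction, the strict epigraph of a Lipschitz function
of the horizontal variable `y - ⟪e, y⟫ e`. Connectedness is not required. -/
structure IsBoundedLipschitzDomain {n : ℕ} (Ω : Set (EuclideanSpace ℝ (Fin n))) : Prop where
  isOpen : IsOpen Ω
  isBounded : Bornology.IsBounded Ω
  boundary : ∀ x ∈ frontier Ω, ∃ r : ℝ, 0 < r ∧ ∃ e : EuclideanSpace ℝ (Fin n), ‖e‖ = 1 ∧
    ∃ (K : ℝ≥0) (γ : EuclideanSpace ℝ (Fin n) → ℝ), LipschitzWith K γ ∧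
      ∀ y ∈ Metric.ball x r, y ∈ Ω ↔ γ (y - inner ℝ e y • e) < inner ℝ e y

/-! ### The Fourier transform and the spaces `Hˢ(ℝⁿ)`, `s ≥ 0`

Mathlib's Fourier transform has kernel `exp (-2πi x·ξ)`. It is unitary on `L²`, and the Fourier
multiplier with symbol `m(ξ)` in the convention with kernel `exp (-i x·ξ)` is multiplication by
`m(2πξ)` on the Fourier side in Mathlib's convention. -/

/-- The Fourier transform of a real square integrable function. -/
def fourierL2 (n : ℕ) : L2R n →L[ℝ] L2C n :=
  ((Lp.fourierTransformₗᵢ (EuclideanSpace ℝ (Fin n)) ℂ).toContinuousLinearEquiv.toContinuousLinearMap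
    ).restrictScalars ℝ ∘L Complex.ofRealCLM.compLpL 2 volume

/-- The symbol `⟨ξ⟩ˢ = (1 + |ξ|²)^(s/2)` of the Bessel potential of order `s`, at `2πξ`. -/
def besselSymbol {n : ℕ} (s : ℝ≥0) (ξ : EuclideanSpace ℝ (Fin n)) : ℝ :=
  (1 + ‖(2 * Real.pi) • ξ‖ ^ 2) ^ ((s : ℝ) / 2)

/-- The symbol `|ξ|ˢ` of `(-Δ)^(s/2)`, at `2πξ`. -/
def fracSymbol {n : ℕ} (s : ℝ≥0) (ξ : EuclideanSpace ℝ (Fin n)) : ℝ :=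
  ‖(2 * Real.pi) • ξ‖ ^ (s : ℝ)

/-- The functions in `L²(ℝⁿ; ℝ)` with `⟨D⟩ˢ u ∈ L²(ℝⁿ)`. -/
def sobolevSubmodule (n : ℕ) (s : ℝ≥0) : Submodule ℝ (L2R n) where
  carrier := {u | MemLp (fun ξ ↦ besselSymbol s ξ • fourierL2 n u ξ) 2 volume}
  add_mem' {u v} hu hv := by
    refine (MemLp.add hu hv).ae_eq ?_
    rw [map_add]
    filter_upwards [Lp.coeFn_add (fourierL2 n u) (fourierL2 n v)] with ξ h
    rw [h, Pi.add_apply, Pi.add_apply, smul_add]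
  zero_mem' := by
    refine (MemLp.zero (ε := ℂ)).ae_eq ?_
    rw [map_zero]
    filter_upwards [Lp.coeFn_zero ℂ 2 (volume : Measure (EuclideanSpace ℝ (Fin n)))] with ξ h
    rw [h, Pi.zero_apply, smul_zero]
  smul_mem' c u hu := by
    refine (MemLp.const_smul hu c).ae_eq ?_
    rw [map_smul]
    filter_upwards [Lp.coeFn_smul c (fourierL2 n u)] with ξ h
    rw [h, Pi.smul_apply, Pi.smul_apply, smul_comm]

/-- The Sobolev space `Hˢ(ℝⁿ)` (real valued, `s ≥ 0`), with its own norm `‖⟨D⟩ˢ u‖_{L²}`. -/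
def Sobolev (n : ℕ) (s : ℝ≥0) : Type := sobolevSubmodule n s

instance (n : ℕ) (s : ℝ≥0) : AddCommGroup (Sobolev n s) :=
  inferInstanceAs (AddCommGroup (sobolevSubmodule n s))

instance (n : ℕ) (s : ℝ≥0) : Module ℝ (Sobolev n s) :=
  inferInstanceAs (Module ℝ (sobolevSubmodule n s))

/-- The inclusion `Hˢ(ℝⁿ) → L²(ℝⁿ)`. -/
def Sobolev.toL2Lin (n : ℕ) (s : ℝ≥0) : Sobolev n s →ₗ[ℝ] L2R n := (sobolevSubmodule n s).subtype

theorem Sobolev.memLp_bessel {n : ℕ} {s : ℝ≥0} (u : Sobolev n s) :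
    MemLp (fun ξ ↦ besselSymbol s ξ • fourierL2 n (Sobolev.toL2Lin n s u) ξ) 2 volume := u.2

/-- The Fourier transform `⟨ξ⟩ˢ û` of `⟨D⟩ˢ u`. -/
def Sobolev.besselLin (n : ℕ) (s : ℝ≥0) : Sobolev n s →ₗ[ℝ] L2C n where
  toFun u := (Sobolev.memLp_bessel u).toLp _
  map_add' u v := by
    rw [← MemLp.toLp_add]
    refine MemLp.toLp_congr _ _ ?_
    rw [map_add, map_add]
    filter_upwards [Lp.coeFn_add (fourierL2 n (Sobolev.toL2Lin n s u))
      (fourierL2 n (Sobolev.toL2Lin n s v))] with ξ h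
    rw [h, Pi.add_apply, Pi.add_apply, smul_add]
  map_smul' c u := by
    rw [RingHom.id_apply, ← MemLp.toLp_const_smul]
    refine MemLp.toLp_congr _ _ ?_
    rw [map_smul, map_smul]
    filter_upwards [Lp.coeFn_smul c (fourierL2 n (Sobolev.toL2Lin n s u))] with ξ h
    rw [h, Pi.smul_apply, Pi.smul_apply, smul_comm]

theorem one_le_besselSymbol {n : ℕ} (s : ℝ≥0) (ξ : EuclideanSpace ℝ (Fin n)) :
    1 ≤ besselSymbol s ξ :=
  Real.one_le_rpow (by nlinarith [sq_nonneg ‖(2 * Real.pi) • ξ‖]) (by positivity)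

theorem fracSymbol_le_besselSymbol {n : ℕ} (s : ℝ≥0) (ξ : EuclideanSpace ℝ (Fin n)) :
    fracSymbol s ξ ≤ besselSymbol s ξ := by
  unfold fracSymbol besselSymbol
  have h : ‖(2 * Real.pi) • ξ‖ ^ (s : ℝ) = (‖(2 * Real.pi) • ξ‖ ^ 2) ^ ((s : ℝ) / 2) := by
    rw [← Real.rpow_natCast, ← Real.rpow_mul (norm_nonneg _)]
    congr 1
    push_cast
    ring
  rw [h]
  exact Real.rpow_le_rpow (by positivity) (by linarith) (by positivity)

theorem norm_fourierL2 {n : ℕ} (u : L2R n) : ‖fourierL2 n u‖ = ‖u‖ := by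
  have h1 : ‖fourierL2 n u‖ = ‖Complex.ofRealCLM.compLpL 2 volume u‖ :=
    (Lp.fourierTransformₗᵢ (EuclideanSpace ℝ (Fin n)) ℂ).norm_map _
  rw [h1]
  refine le_antisymm ?_ ?_ <;> refine Lp.norm_le_norm_of_ae_le ?_ <;>
  · filter_upwards [Complex.ofRealCLM.coeFn_compLpL (p := 2) (μ := volume) u] with x h
    simp [h]

theorem Sobolev.norm_toL2Lin_le {n : ℕ} {s : ℝ≥0} (u : Sobolev n s) :
    ‖Sobolev.toL2Lin n s u‖ ≤ ‖Sobolev.besselLin n s u‖ := by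
  rw [← norm_fourierL2]
  refine Lp.norm_le_norm_of_ae_le ?_
  filter_upwards [(Sobolev.memLp_bessel u).coeFn_toLp] with ξ h
  have h' : Sobolev.besselLin n s u ξ
      = besselSymbol s ξ • fourierL2 n (Sobolev.toL2Lin n s u) ξ := h
  have h1 := one_le_besselSymbol s ξ
  rw [h', norm_smul, Real.norm_of_nonneg (by linarith)]
  exact le_mul_of_one_le_left (norm_nonneg _) h1

theorem Sobolev.besselLin_injective (n : ℕ) (s : ℝ≥0) :
    Function.Injective (Sobolev.besselLin n s) := by
  rw [injective_iff_map_eq_zero]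
  intro u hu
  have h := Sobolev.norm_toL2Lin_le u
  rw [hu, norm_zero] at h
  exact Subtype.ext (norm_le_zero_iff.1 h)

instance (n : ℕ) (s : ℝ≥0) : NormedAddCommGroup (Sobolev n s) :=
  NormedAddCommGroup.induced (Sobolev n s) (L2C n) (Sobolev.besselLin n s)
    (Sobolev.besselLin_injective n s)

instance (n : ℕ) (s : ℝ≥0) : NormedSpace ℝ (Sobolev n s) :=
  NormedSpace.induced ℝ (Sobolev n s) (L2C n) (Sobolev.besselLin n s)

/-- The continuous inclusion `Hˢ(ℝⁿ) → L²(ℝⁿ)`. -/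
def Sobolev.toL2 (n : ℕ) (s : ℝ≥0) : Sobolev n s →L[ℝ] L2R n :=
  (Sobolev.toL2Lin n s).mkContinuous 1 fun u ↦ by
    rw [one_mul]
    exact Sobolev.norm_toL2Lin_le u

theorem Sobolev.memLp_frac {n : ℕ} {s : ℝ≥0} (u : Sobolev n s) :
    MemLp (fun ξ ↦ fracSymbol s ξ • fourierL2 n (Sobolev.toL2 n s u) ξ) 2 volume := by
  refine (Sobolev.memLp_bessel u).mono ?_ (Filter.Eventually.of_forall fun ξ ↦ ?_)
  · have hm : Measurable (fracSymbol s : EuclideanSpace ℝ (Fin n) → ℝ) := by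
      unfold fracSymbol
      fun_prop
    exact hm.aestronglyMeasurable.smul (Lp.aestronglyMeasurable (fourierL2 n (Sobolev.toL2 n s u)))
  · have h0 : 0 ≤ fracSymbol s ξ := by unfold fracSymbol; positivity
    have h1 := fracSymbol_le_besselSymbol s ξ
    rw [norm_smul, norm_smul, Real.norm_of_nonneg h0, Real.norm_of_nonneg (h0.trans h1)]
    exact mul_le_mul_of_nonneg_right h1 (norm_nonneg _)

/-- The fractional Laplacian `(-Δ)^(s/2) u = 𝓕⁻¹(|ξ|ˢ û)` as a map `Hˢ(ℝⁿ) → L²(ℝⁿ)`. -/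
def Sobolev.fracLaplacianHalf {n : ℕ} {s : ℝ≥0} (u : Sobolev n s) : L2C n :=
  𝓕⁻ ((Sobolev.memLp_frac u).toLp _)

/-! ### The spaces `H̃ˢ(Ω)`, `L̃²(Ω)` and `H⁻ˢ(Ω)` -/

/-- The classes in `L²(ℝⁿ)` of the functions in `C_c^∞(Ω)`. -/
def testFunctions {n : ℕ} (Ω : Set (EuclideanSpace ℝ (Fin n))) : Submodule ℝ (L2R n) where
  carrier := {u | ∃ φ : EuclideanSpace ℝ (Fin n) → ℝ, ContDiff ℝ ∞ φ ∧ HasCompactSupport φ ∧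
    tsupport φ ⊆ Ω ∧ u =ᵐ[volume] φ}
  add_mem' := by
    rintro u v ⟨φ, hφ, hφc, hφs, hu⟩ ⟨ψ, hψ, hψc, hψs, hv⟩
    refine ⟨φ + ψ, hφ.add hψ, hφc.add hψc,
      (tsupport_add φ ψ).trans (union_subset hφs hψs), ?_⟩
    exact (Lp.coeFn_add u v).trans (hu.add hv)
  zero_mem' := ⟨0, contDiff_const, HasCompactSupport.zero, by simp [tsupport],
    Lp.coeFn_zero ℝ 2 volume⟩
  smul_mem' := by
    rintro c u ⟨φ, hφ, hφc, hφs, hu⟩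
    refine ⟨c • φ, hφ.const_smul c, HasCompactSupport.smul_left (f := fun _ ↦ c) hφc,
      (closure_mono (Function.support_const_smul_subset c φ)).trans hφs, ?_⟩
    exact (Lp.coeFn_smul c u).trans (hu.const_smul c)

/-- `L̃²(Ω)`: the closure of `C_c^∞(Ω)` in `L²(ℝⁿ)`. -/
abbrev LTilde {n : ℕ} (Ω : Set (EuclideanSpace ℝ (Fin n))) : Submodule ℝ (L2R n) :=
  (testFunctions Ω).topologicalClosure

/-- `H̃ˢ(Ω)`: the closure of `C_c^∞(Ω)` in `Hˢ(ℝⁿ)`. -/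
abbrev HTilde {n : ℕ} (s : ℝ≥0) (Ω : Set (EuclideanSpace ℝ (Fin n))) : Submodule ℝ (Sobolev n s) :=
  ((testFunctions Ω).comap (Sobolev.toL2 n s).toLinearMap).topologicalClosure

/-- `H⁻ˢ(Ω)`: the dual of `H̃ˢ(Ω)`; the duality pairing is evaluation. -/
abbrev HNeg {n : ℕ} (s : ℝ≥0) (Ω : Set (EuclideanSpace ℝ (Fin n))) : Type :=
  StrongDual ℝ (HTilde s Ω)

theorem toL2_mem_LTilde {n : ℕ} {s : ℝ≥0} {Ω : Set (EuclideanSpace ℝ (Fin n))} (v : HTilde s Ω) :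
    Sobolev.toL2 n s v ∈ LTilde Ω :=
  map_mem_closure (Sobolev.toL2 n s).continuous v.2 fun _ h ↦ h

/-- The inclusion `H̃ˢ(Ω) → L̃²(Ω)`. -/
def HTilde.incl {n : ℕ} (s : ℝ≥0) (Ω : Set (EuclideanSpace ℝ (Fin n))) : HTilde s Ω →L[ℝ] LTilde Ω :=
  (Sobolev.toL2 n s ∘L (HTilde s Ω).subtypeL).codRestrict (LTilde Ω) fun v ↦ toL2_mem_LTilde v

/-- The inclusion `L̃²(Ω) → H⁻ˢ(Ω)`, `u ↦ (v ↦ ⟨u, v⟩_{L²})`. -/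
def LTilde.toHNeg {n : ℕ} (s : ℝ≥0) (Ω : Set (EuclideanSpace ℝ (Fin n))) (u : LTilde Ω) : HNeg s Ω :=
  innerSL ℝ u ∘L HTilde.incl s Ω

/-! ### Weak and very weak solutions -/

/-- The condition on the integrability exponent of the potential. -/
def AdmissibleExponent (n : ℕ) (s : ℝ≥0) (p : ℝ≥0∞) : Prop :=
  (2 * (s : ℝ) < n → ENNReal.ofReal (n / s) ≤ p) ∧
  (2 * (s : ℝ) = n → 2 < p) ∧
  ((n : ℝ) < 2 * s → 2 ≤ p)

/-- `v ∈ C([0,T]; H̃ˢ(Ω)) ∩ C¹([0,T]; L̃²(Ω))` is a weak solution of the backward problem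
`∂ₜ²v + (-Δ)ˢv + qv = G` in `Ω × (0,T)`, `v = 0` in `(ℝⁿ ∖ closure Ω) × (0,T)`,
`v(T) = ∂ₜv(T) = 0` in `Ω`; the equation is
`d/dt ⟨∂ₜv, w⟩ + ⟨(-Δ)^(s/2) v, (-Δ)^(s/2) w⟩ + ⟨qv, w⟩ = ⟨G, w⟩` in the sense of distributions on
`(0,T)`, for all `w ∈ H̃ˢ(Ω)`. Values of `v` outside `[0,T]` play no role. -/
structure IsBackwardWeakSolution {n : ℕ} (s : ℝ≥0) (Ω : Set (EuclideanSpace ℝ (Fin n))) (T : ℝ)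
    (q : EuclideanSpace ℝ (Fin n) → ℝ) (G : ℝ → LTilde Ω) (v : ℝ → HTilde s Ω) : Prop where
  continuousOn : ContinuousOn v (Icc 0 T)
  contDiffOn : ContDiffOn ℝ 1 (fun t ↦ HTilde.incl s Ω (v t)) (Icc 0 T)
  equation : ∀ (w : HTilde s Ω) (η : ℝ → ℝ), ContDiff ℝ ∞ η → HasCompactSupport η →
    tsupport η ⊆ Ioo 0 T →
    -(∫ t in Ioo 0 T, inner ℝ (derivWithin (fun τ ↦ HTilde.incl s Ω (v τ)) (Icc 0 T) t)
        (HTilde.incl s Ω w) * deriv η t)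
      + ∫ t in Ioo 0 T,
          ((inner ℂ (Sobolev.fracLaplacianHalf (v t : Sobolev n s))
              (Sobolev.fracLaplacianHalf (w : Sobolev n s))).re
            + ∫ x in Ω, q x * (HTilde.incl s Ω (v t) : L2R n) x * (HTilde.incl s Ω w : L2R n) x)
          * η t
      = ∫ t in Ioo 0 T, inner ℝ (G t) (HTilde.incl s Ω w) * η t
  final_value : v T = 0
  final_deriv : derivWithin (fun t ↦ HTilde.incl s Ω (v t)) (Icc 0 T) T = 0

/-- `u ∈ C([0,T]; L̃²(Ω)) ∩ C¹([0,T]; H⁻ˢ(Ω))` is a very weak solution of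
`∂ₜ²u + (-Δ)ˢu + qu = F` in `Ω × (0,T)`, `u = 0` in `(ℝⁿ ∖ closure Ω) × (0,T)`,
`u(0) = u₀`, `∂ₜu(0) = u₁` in `Ω`. Values of `u` outside `[0,T]` play no role. -/
structure IsVeryWeakSolution {n : ℕ} (s : ℝ≥0) (Ω : Set (EuclideanSpace ℝ (Fin n))) (T : ℝ)
    (q : EuclideanSpace ℝ (Fin n) → ℝ) (F : ℝ → HNeg s Ω) (u₀ : LTilde Ω) (u₁ : HNeg s Ω)
    (u : ℝ → LTilde Ω) : Prop where
  continuousOn : ContinuousOn u (Icc 0 T)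
  contDiffOn : ContDiffOn ℝ 1 (fun t ↦ LTilde.toHNeg s Ω (u t)) (Icc 0 T)
  identity : ∀ G : ℝ → LTilde Ω, MemLp G 2 (volume.restrict (Ioo 0 T)) →
    ∀ v : ℝ → HTilde s Ω, IsBackwardWeakSolution s Ω T q G v →
      ∫ t in Ioo 0 T, inner ℝ (u t) (G t)
        = (∫ t in Ioo 0 T, F t (v t)) + u₁ (v 0)
          - inner ℝ u₀ (derivWithin (fun t ↦ HTilde.incl s Ω (v t)) (Icc 0 T) 0)

end NonlocalWave

end

/-! The solution is obtained by transposition. Let `V` be H̃ˢ(Ω) with the energy inner product ⟨v,w⟩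
+ ⟨(-Δ)^(s/2)v,(-Δ)^(s/2)w⟩, `H` = L̃²(Ω) and `i : V → H` the inclusion, which is injective with
dense range. On `V × H` the bounded operator R(v,y) = (-i*y, iv) is skew-adjoint and injective, and
R⁻¹ generates the wave group. Working with R instead of its unbounded inverse avoids operator
domains: an equation U' = R⁻¹U + g is read either as Duhamel's formula for the group or, after
applying R and integrating in time, as an identity between bounded operators. The two readings agree
(`IsInverseGroup.integrated_of_mild`, `IsInverseGroup.mild_of_integrated`).

An admissible potential maps H̃ˢ(Ω) boundedly to L̃²(Ω) (`exists_potential`), by Hölder's inequality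
and Sobolev embeddings proved on the Fourier side. So the backward problem is V' = R⁻¹V + (0,G) - BV
with `B` bounded. Let U = (z,-u) solve U' = R⁻¹U + (F,0) + B*U with U(0) = (u₁,-u₀), where `F` and
u₁ are represented in `V` by Riesz. Since R is skew, d/dt ⟨U,V⟩ = ⟨(F,0),V⟩ + ⟨U,(0,G)⟩; integrating
up to T, where V vanishes, gives exactly the identity defining very weak solutions
(`IsInverseGroup.duality`, `exists_transposition_waveSolution`). The first component of the equation
says that the derivative of u in H⁻ˢ(Ω) is represented by z, whence u is C¹ with values in H⁻ˢ(Ω).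

For uniqueness, the difference of two very weak solutions is orthogonal to every `G` for which the
backward problem is solvable. That problem is always solvable (`exists_backward_waveSolution`), so
`G` may be the difference itself. -/

noncomputable section

namespace NonlocalWave

open Filter Topology

/-! ### Integration by parts for Hilbert-space-valued primitives. -/

section Primitive

/-- A function whose oscillation is controlled by that of an absolutely continuous function is
absolutely continuous. -/
theorem absolutelyContinuousOnInterval_of_dist_le {X : Type*} [PseudoMetricSpace X] {f : ℝ → X}
    {g : ℝ → ℝ} {a b : ℝ} (hg : AbsolutelyContinuousOnInterval g a b)
    (h : ∀ x ∈ uIcc a b, ∀ y ∈ uIcc a b, dist (f x) (f y) ≤ dist (g x) (g y)) :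
    AbsolutelyContinuousOnInterval f a b := by
  rw [absolutelyContinuousOnInterval_iff] at hg ⊢
  intro ε hε
  obtain ⟨δ, hδ, H⟩ := hg ε hε
  refine ⟨δ, hδ, fun E hE hlt ↦ (Finset.sum_le_sum fun i hi ↦ ?_).trans_lt (H E hE hlt)⟩
  exact h _ (hE.1 i hi).1 _ (hE.1 i hi).2

variable {X : Type*} [NormedAddCommGroup X] [InnerProductSpace ℝ X] [CompleteSpace X]

/-- Integration by parts for primitives of integrable functions with values in a Hilbert space. -/
theorem integral_inner_primitive {h k : ℝ → X} {a b : ℝ} (hh : IntervalIntegrable h volume a b)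
    (hk : IntervalIntegrable k volume a b) {Y P : ℝ → X}
    (hY : ∀ t ∈ uIcc a b, Y t = Y a + ∫ τ in a..t, h τ)
    (hP : ∀ t ∈ uIcc a b, P t = P a + ∫ τ in a..t, k τ) :
    ∫ τ in a..b, (inner ℝ (h τ) (P τ) + inner ℝ (Y τ) (k τ))
      = inner ℝ (Y b) (P b) - inner ℝ (Y a) (P a) := by
  have hsub : ∀ {h : ℝ → X}, IntervalIntegrable h volume a b → ∀ {Y : ℝ → X},
      (∀ t ∈ uIcc a b, Y t = Y a + ∫ τ in a..t, h τ) → ∀ x ∈ uIcc a b, ∀ y ∈ uIcc a b,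
      ‖Y x - Y y‖ ≤ |∫ τ in y..x, ‖h τ‖| := by
    intro h hh Y hY x hx y hy
    rw [hY x hx, hY y hy, add_sub_add_left_eq_sub, intervalIntegral.integral_interval_sub_left
      (hh.mono_set (uIcc_subset_uIcc left_mem_uIcc hx))
      (hh.mono_set (uIcc_subset_uIcc left_mem_uIcc hy))]
    exact intervalIntegral.norm_integral_le_abs_integral_norm
  have hcont : ∀ {h : ℝ → X}, IntervalIntegrable h volume a b → ∀ {Y : ℝ → X},
      (∀ t ∈ uIcc a b, Y t = Y a + ∫ τ in a..t, h τ) → ContinuousOn Y (uIcc a b) := by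
    intro h hh Y hY
    refine ContinuousOn.congr (continuousOn_const.add ?_) hY
    exact intervalIntegral.continuousOn_primitive_interval' hh left_mem_uIcc
  obtain ⟨C, hC⟩ := isCompact_uIcc.exists_bound_of_continuousOn (hcont hh hY)
  obtain ⟨D, hD⟩ := isCompact_uIcc.exists_bound_of_continuousOn (hcont hk hP)
  have hC0 : 0 ≤ C := (norm_nonneg _).trans (hC a left_mem_uIcc)
  have hD0 : 0 ≤ D := (norm_nonneg _).trans (hD a left_mem_uIcc)
  have hi : IntervalIntegrable (fun τ ↦ D * ‖h τ‖ + C * ‖k τ‖) volume a b :=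
    (hh.norm.const_mul D).add (hk.norm.const_mul C)
  -- The scalar function ⟨Y,P⟩ oscillates no more than the primitive of D‖h‖ + C‖k‖, where `D`
  -- bounds P and `C` bounds Y. Being real and absolutely continuous, it is the integral of its
  -- derivative, and only the almost everywhere value of that derivative is needed.
  have hac : AbsolutelyContinuousOnInterval (fun t ↦ (inner ℝ (Y t) (P t) : ℝ)) a b := by
    refine absolutelyContinuousOnInterval_of_dist_le
      (hi.absolutelyContinuousOnInterval_intervalIntegral left_mem_uIcc) fun x hx y hy ↦ ?_
    have hx' := uIcc_subset_uIcc left_mem_uIcc hx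
    have hy' := uIcc_subset_uIcc left_mem_uIcc hy
    have hyx := uIcc_subset_uIcc hy hx
    rw [Real.dist_eq, Real.dist_eq, intervalIntegral.integral_interval_sub_left
      (hi.mono_set hx') (hi.mono_set hy'), intervalIntegral.integral_add
      ((hh.norm.const_mul D).mono_set hyx) ((hk.norm.const_mul C).mono_set hyx),
      intervalIntegral.integral_const_mul, intervalIntegral.integral_const_mul]
    have e1 : (inner ℝ (Y x) (P x) : ℝ) - inner ℝ (Y y) (P y)
        = inner ℝ (Y x - Y y) (P x) + inner ℝ (Y y) (P x - P y) := by
      rw [inner_sub_left, inner_sub_right]; ring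
    have e2 : |D * (∫ τ in y..x, ‖h τ‖) + C * ∫ τ in y..x, ‖k τ‖|
        = D * |∫ τ in y..x, ‖h τ‖| + C * |∫ τ in y..x, ‖k τ‖| := by
      rcases le_total y x with hle | hle
      · have p1 : 0 ≤ ∫ τ in y..x, ‖h τ‖ :=
          intervalIntegral.integral_nonneg hle fun _ _ ↦ norm_nonneg _
        have p2 : 0 ≤ ∫ τ in y..x, ‖k τ‖ :=
          intervalIntegral.integral_nonneg hle fun _ _ ↦ norm_nonneg _
        rw [abs_of_nonneg p1, abs_of_nonneg p2, abs_of_nonneg (by positivity)]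
      · have p1 : 0 ≤ ∫ τ in x..y, ‖h τ‖ :=
          intervalIntegral.integral_nonneg hle fun _ _ ↦ norm_nonneg _
        have p2 : 0 ≤ ∫ τ in x..y, ‖k τ‖ :=
          intervalIntegral.integral_nonneg hle fun _ _ ↦ norm_nonneg _
        rw [intervalIntegral.integral_symm x y, intervalIntegral.integral_symm x y, mul_neg,
          mul_neg, ← neg_add, abs_neg, abs_neg, abs_neg, abs_of_nonneg p1, abs_of_nonneg p2,
          abs_of_nonneg (by positivity)]
    rw [e1, e2]
    refine (abs_add_le _ _).trans (add_le_add ?_ ?_)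
    · refine (abs_real_inner_le_norm _ _).trans ?_
      rw [mul_comm]
      exact mul_le_mul (hD x hx) (hsub hh hY x hx y hy) (norm_nonneg _) hD0
    · refine (abs_real_inner_le_norm _ _).trans ?_
      exact mul_le_mul (hC y hy) (hsub hk hP x hx y hy) (norm_nonneg _) hC0
  rw [← hac.integral_deriv_eq_sub]
  refine intervalIntegral.integral_congr_ae ?_
  -- The endpoints are discarded so that `hY` and `hP` hold in a full neighbourhood of x.
  have ha : ∀ᵐ x : ℝ, x ≠ a := by simp [ae_iff, measure_singleton]
  have hb : ∀ᵐ x : ℝ, x ≠ b := by simp [ae_iff, measure_singleton]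
  filter_upwards [hh.ae_hasDerivAt_integral, hk.ae_hasDerivAt_integral, ha, hb]
    with x hx1 hx2 hxa hxb hx
  have hx' : x ∈ uIcc a b := uIoc_subset_uIcc hx
  have hnhds : uIcc a b ∈ 𝓝 x := by
    rw [uIcc, Icc_mem_nhds_iff]
    rw [uIcc, mem_Icc] at hx'
    refine ⟨lt_of_le_of_ne hx'.1 ?_, lt_of_le_of_ne hx'.2 ?_⟩
    · rcases min_choice a b with h | h <;> rw [h] <;> [exact hxa.symm; exact hxb.symm]
    · rcases max_choice a b with h | h <;> rw [h] <;> [exact hxa; exact hxb]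
  have d1 : HasDerivAt Y (h x) x :=
    ((hx1 hx' a left_mem_uIcc).const_add (Y a)).congr_of_eventuallyEq
      (eventually_of_mem hnhds hY)
  have d2 : HasDerivAt P (k x) x :=
    ((hx2 hx' a left_mem_uIcc).const_add (P a)).congr_of_eventuallyEq
      (eventually_of_mem hnhds hP)
  rw [(d1.inner ℝ d2).deriv, add_comm]

end Primitive

/-! ### Weak derivatives on an interval. -/

section DuBoisReymond

/-- A smooth function with integral zero and compact support in `(a, b)` is the derivative of such
a function. -/
theorem exists_test_primitive {a b : ℝ} {ψ : ℝ → ℝ} (hψ : ContDiff ℝ ∞ ψ)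
    (hc : HasCompactSupport ψ) (hs : tsupport ψ ⊆ Ioo a b) (h0 : ∫ t, ψ t = 0) :
    ∃ η : ℝ → ℝ, ContDiff ℝ ∞ η ∧ HasCompactSupport η ∧ tsupport η ⊆ Ioo a b ∧ deriv η = ψ := by
  obtain ⟨m, M, hm, hM, hsub⟩ : ∃ m M, a < m ∧ M < b ∧ tsupport ψ ⊆ Icc m M := by
    rcases (tsupport ψ).eq_empty_or_nonempty with he | hne
    · exact ⟨a + 1, b - 1, by linarith, by linarith, by rw [he]; exact empty_subset _⟩
    · obtain ⟨x, hx, hxl⟩ := hc.isCompact.exists_isLeast hne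
      obtain ⟨y, hy, hyl⟩ := hc.isCompact.exists_isGreatest hne
      exact ⟨x, y, (hs hx).1, (hs hy).2, fun t ht ↦ ⟨hxl ht, hyl ht⟩⟩
  have hz : ∀ t, t ∉ Icc m M → ψ t = 0 := fun t ht ↦ image_eq_zero_of_notMem_tsupport
    fun h ↦ ht (hsub h)
  have hcont : Continuous ψ := hψ.continuous
  have hd : ∀ t, HasDerivAt (fun t ↦ ∫ τ in a..t, ψ τ) (ψ t) t := fun t ↦
    intervalIntegral.integral_hasDerivAt_right (hcont.intervalIntegrable _ _)
      (hcont.stronglyMeasurableAtFilter _ _) hcont.continuousAt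
  have hder : deriv (fun t ↦ ∫ τ in a..t, ψ τ) = ψ := funext fun t ↦ (hd t).deriv
  -- To the left of the support the integrand vanishes; to the right the primitive has reached the
  -- total integral, which is zero.
  have hsupp : ∀ t, t ∉ Icc m M → ∫ τ in a..t, ψ τ = 0 := by
    intro t ht
    rw [mem_Icc, not_and_or, not_le, not_le] at ht
    rcases ht with ht | ht
    · refine intervalIntegral.integral_zero_ae (Eventually.of_forall fun x hx ↦ hz x fun h ↦ ?_)
      have := (uIoc_subset_uIcc hx).2
      have h1 : max a t < m := max_lt hm ht
      exact absurd h.1 (not_le.2 (this.trans_lt h1))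
    · by_cases hta : a ≤ t
      · rw [intervalIntegral.integral_of_le hta, setIntegral_eq_integral_of_forall_compl_eq_zero,
          h0]
        intro x hx
        refine hz x fun h ↦ hx ⟨hm.trans_le h.1, h.2.trans ht.le⟩
      -- Here M < t < a < m, so `Icc m M` is empty and ψ vanishes identically.
      · refine intervalIntegral.integral_zero_ae (Eventually.of_forall fun x hx ↦ hz x fun h ↦ ?_)
        have := (uIoc_subset_uIcc hx).2
        have h1 : max a t < m := max_lt hm (by linarith)
        exact absurd h.1 (not_le.2 (this.trans_lt h1))
  have hts : tsupport (fun t ↦ ∫ τ in a..t, ψ τ) ⊆ Icc m M :=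
    closure_minimal (fun t ht ↦ by_contra fun h ↦ ht (hsupp t h)) isClosed_Icc
  refine ⟨_, ?_, HasCompactSupport.of_support_subset_isCompact isCompact_Icc
    (subset_closure.trans hts), hts.trans fun t ht ↦ ⟨hm.trans_le ht.1, ht.2.trans_lt hM⟩, hder⟩
  rw [contDiff_infty_iff_deriv, hder]
  exact ⟨fun t ↦ (hd t).differentiableAt, hψ⟩

/-- The lemma of du Bois-Reymond: a continuous function with vanishing weak derivative is
constant. -/
theorem eqOn_const_of_integral_mul_deriv_eq_zero {a b : ℝ} (hab : a < b) {h : ℝ → ℝ}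
    (hh : ContinuousOn h (Icc a b))
    (H : ∀ η : ℝ → ℝ, ContDiff ℝ ∞ η → HasCompactSupport η → tsupport η ⊆ Ioo a b →
      ∫ t in Ioo a b, h t * deriv η t = 0) :
    ∃ c, ∀ t ∈ Icc a b, h t = c := by
  let B : ContDiffBump ((a + b) / 2) :=
    ⟨(b - a) / 8, (b - a) / 4, by linarith, by linarith⟩
  let ρ : ℝ → ℝ := B.normed volume
  have hρ : ContDiff ℝ ∞ ρ := B.contDiff_normed
  have hρc : HasCompactSupport ρ := B.hasCompactSupport_normed
  have hρs : tsupport ρ ⊆ Ioo a b := by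
    rw [B.tsupport_normed_eq, Real.closedBall_eq_Icc]
    intro x hx
    have h1 : (a + b) / 2 - (b - a) / 4 ≤ x := hx.1
    have h2 : x ≤ (a + b) / 2 + (b - a) / 4 := hx.2
    exact ⟨by linarith, by linarith⟩
  have hρi : ∫ t, ρ t = 1 := B.integral_normed
  set c := ∫ t in Ioo a b, h t * ρ t with hcdef
  have hint : ∀ φ : ℝ → ℝ, Continuous φ → IntegrableOn (fun t ↦ h t * φ t) (Ioo a b) :=
    fun φ hφ ↦ ((hh.mul hφ.continuousOn).integrableOn_compact isCompact_Icc).mono_set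
      Ioo_subset_Icc_self
  have hset : ∀ φ : ℝ → ℝ, tsupport φ ⊆ Ioo a b → ∫ t in Ioo a b, φ t = ∫ t, φ t :=
    fun φ hφ ↦ setIntegral_eq_integral_of_forall_compl_eq_zero fun x hx ↦
      image_eq_zero_of_notMem_tsupport fun h ↦ hx (hφ h)
  -- Subtracting (∫φ)ρ from φ leaves mean zero, hence the derivative of a test function; the
  -- hypothesis then yields ∫hφ = c∫φ with c = ∫hρ.
  have key : ∀ φ : ℝ → ℝ, ContDiff ℝ ∞ φ → HasCompactSupport φ → tsupport φ ⊆ Ioo a b →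
      ∫ t, φ t • (h t - c) = 0 := by
    intro φ hφ hφc hφs
    have hφi : Integrable φ := hφ.continuous.integrable_of_hasCompactSupport hφc
    have hρint : Integrable ρ := hρ.continuous.integrable_of_hasCompactSupport hρc
    set I := ∫ t, φ t
    have hsub : tsupport (fun t ↦ φ t - I * ρ t) ⊆ Ioo a b := by
      refine (tsupport_sub φ (fun t ↦ I * ρ t)).trans (union_subset hφs ?_)
      exact (closure_mono (Function.support_const_smul_subset I ρ)).trans hρs
    obtain ⟨η, h1, h2, h3, h4⟩ := exists_test_primitive
      (hφ.sub (contDiff_const.mul hρ) : ContDiff ℝ ∞ fun t ↦ φ t - I * ρ t)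
      (hφc.sub (HasCompactSupport.smul_left (f := fun _ ↦ I) hρc))
      hsub (by rw [integral_sub hφi (hρint.const_mul I), integral_const_mul, hρi]; ring)
    have h5 := H η h1 h2 h3
    rw [h4] at h5
    have h6 : ∫ t in Ioo a b, h t * (φ t - I * ρ t)
        = (∫ t in Ioo a b, h t * φ t) - I * c := by
      rw [hcdef, ← integral_const_mul, ← integral_sub (hint φ hφ.continuous)
        ((hint ρ hρ.continuous).const_mul I)]
      refine integral_congr_ae (Eventually.of_forall fun t ↦ ?_)
      simp only
      ring
    have h7 : ∫ t, φ t • (h t - c) = ∫ t in Ioo a b, φ t • (h t - c) := by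
      refine (setIntegral_eq_integral_of_forall_compl_eq_zero fun x hx ↦ ?_).symm
      rw [image_eq_zero_of_notMem_tsupport fun h ↦ hx (hφs h), zero_smul]
    have h8 : ∫ t in Ioo a b, φ t • (h t - c)
        = (∫ t in Ioo a b, h t * φ t) - ∫ t in Ioo a b, c * φ t := by
      rw [← integral_sub (hint φ hφ.continuous) (hφi.integrableOn.const_mul c)]
      refine integral_congr_ae (Eventually.of_forall fun t ↦ ?_)
      simp only [smul_eq_mul]
      ring
    rw [h7, h8, integral_const_mul, hset φ hφs]
    rw [h6] at h5
    linarith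
  have hae := isOpen_Ioo.ae_eq_zero_of_integral_contDiff_smul_eq_zero (μ := volume)
    (f := fun t ↦ h t - c)
    (((hh.sub continuousOn_const).mono Ioo_subset_Icc_self).locallyIntegrableOn
      measurableSet_Ioo) key
  refine ⟨c, ?_⟩
  refine Measure.eqOn_Icc_of_ae_eq volume hab.ne ?_ hh continuousOn_const
  rw [EventuallyEq, restrict_Ioo_eq_restrict_Icc.symm, ae_restrict_iff' measurableSet_Ioo]
  filter_upwards [hae] with t ht hmem
  exact sub_eq_zero.1 (ht hmem)

/-- A continuous function on `[a, b]` with integrable weak derivative is its primitive. -/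
theorem eq_add_integral_of_weak_deriv {a b : ℝ} (hab : a < b) {f g : ℝ → ℝ}
    (hf : ContinuousOn f (Icc a b)) (hg : IntervalIntegrable g volume a b)
    (H : ∀ η : ℝ → ℝ, ContDiff ℝ ∞ η → HasCompactSupport η → tsupport η ⊆ Ioo a b →
      ∫ t in Ioo a b, f t * deriv η t = -∫ t in Ioo a b, g t * η t) :
    ∀ t ∈ Icc a b, f t = f a + ∫ τ in a..t, g τ := by
  have hG : ContinuousOn (fun t ↦ ∫ τ in a..t, g τ) (Icc a b) := by
    have := intervalIntegral.continuousOn_primitive_interval' hg left_mem_uIcc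
    rwa [uIcc_of_le hab.le] at this
  -- The function `f` minus the primitive of `g` has vanishing weak derivative: the primitive is
  -- integrated by parts against η, whose boundary values are zero.
  obtain ⟨c, hc⟩ := eqOn_const_of_integral_mul_deriv_eq_zero hab (hf.sub hG) (by
    intro η h1 h2 h3
    have hη' : Continuous (deriv η) := h1.continuous_deriv (by simp)
    have ibp := integral_inner_primitive (X := ℝ) (a := a) (b := b) hg
      (hη'.intervalIntegrable _ _) (Y := fun t ↦ ∫ τ in a..t, g τ) (P := η) (by simp)
      (fun t _ ↦ by
        rw [intervalIntegral.integral_deriv_eq_sub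
          (fun x _ ↦ (h1.differentiable (by simp)).differentiableAt)
          (hη'.intervalIntegrable _ _)]; ring)
    have ha0 : η a = 0 := image_eq_zero_of_notMem_tsupport fun h ↦ lt_irrefl _ (h3 h).1
    have hb0 : η b = 0 := image_eq_zero_of_notMem_tsupport fun h ↦ lt_irrefl _ (h3 h).2
    have i1 : IntegrableOn (fun t ↦ g t * η t) (Ioo a b) := by
      have := (hg.mul_continuousOn h1.continuous.continuousOn)
      rw [intervalIntegrable_iff_integrableOn_Ioo_of_le hab.le] at this
      exact this
    have i2 : ∀ {F : ℝ → ℝ}, ContinuousOn F (Icc a b) →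
        IntegrableOn (fun t ↦ F t * deriv η t) (Ioo a b) := fun hF ↦
      ((hF.mul hη'.continuousOn).integrableOn_compact isCompact_Icc).mono_set
        Ioo_subset_Icc_self
    simp only [RCLike.inner_apply, conj_trivial, ha0, hb0, zero_mul, sub_zero] at ibp
    rw [intervalIntegral.integral_of_le hab.le, integral_Ioc_eq_integral_Ioo] at ibp
    have e : ∫ t in Ioo a b, (η t * g t + deriv η t * ∫ τ in a..t, g τ)
        = (∫ t in Ioo a b, g t * η t) + ∫ t in Ioo a b, (∫ τ in a..t, g τ) * deriv η t := by
      rw [← integral_add i1 (i2 hG)]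
      simp only [mul_comm]
    rw [e] at ibp
    have e' : ∀ t, (f t - ∫ τ in a..t, g τ) * deriv η t
        = f t * deriv η t - (∫ τ in a..t, g τ) * deriv η t := fun t ↦ sub_mul _ _ _
    simp only [Pi.sub_apply, e']
    rw [integral_sub (i2 hf) (i2 hG), H η h1 h2 h3]
    linarith)
  intro t ht
  have h1 := hc t ht
  have h2 := hc a (left_mem_Icc.2 hab.le)
  simp only [Pi.sub_apply, intervalIntegral.integral_same] at h1 h2
  linarith

end DuBoisReymond

/-! ### Volterra equations. -/

section Volterra

variable {X : Type*} [NormedAddCommGroup X] [NormedSpace ℝ X]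

/-- A strongly continuous, uniformly bounded family of operators is jointly continuous. -/
theorem continuous_uncurry_of_bounded {P : ℝ → X →L[ℝ] X} {M : ℝ} (hM : ∀ t x, ‖P t x‖ ≤ M * ‖x‖)
    (hP : ∀ x, Continuous fun t ↦ P t x) : Continuous fun z : ℝ × X ↦ P z.1 z.2 := by
  rw [continuous_iff_continuousAt]
  rintro ⟨t, x⟩
  have h1 : Tendsto (fun z : ℝ × X ↦ P z.1 x) (𝓝 (t, x)) (𝓝 (P t x)) :=
    ((hP x).comp continuous_fst).tendsto _
  have h2 : Tendsto (fun z : ℝ × X ↦ P z.1 (z.2 - x)) (𝓝 (t, x)) (𝓝 0) := by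
    refine squeeze_zero_norm (fun z ↦ hM z.1 (z.2 - x)) ?_
    have : Continuous fun z : ℝ × X ↦ M * ‖z.2 - x‖ := by fun_prop
    simpa using this.tendsto (t, x)
  have h3 := h1.add h2
  rw [add_zero] at h3
  refine h3.congr fun z ↦ ?_
  rw [map_sub, add_sub_cancel]

/-- Linear Volterra equations of the second kind are solvable. -/
theorem exists_volterra [CompleteSpace X] {P : ℝ → X →L[ℝ] X} {M : ℝ}
    (hM : ∀ t x, ‖P t x‖ ≤ M * ‖x‖) (hP : ∀ x, Continuous fun t ↦ P t x) {T : ℝ} (hT : 0 ≤ T)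
    {c : ℝ → X} (hc : ContinuousOn c (Icc 0 T)) :
    ∃ Y : ℝ → X, Continuous Y ∧ ∀ t ∈ Icc 0 T, Y t = c t + ∫ τ in (0 : ℝ)..t, P τ (Y τ) := by
  have hPc := continuous_uncurry_of_bounded hM hP
  obtain ⟨L, hL0, hLM⟩ : ∃ L : ℝ, 0 < L ∧ M ≤ L := ⟨max M 1, by simp, le_max_left _ _⟩
  have hPL : ∀ t x, ‖P t x‖ ≤ L * ‖x‖ := fun t x ↦
    (hM t x).trans (mul_le_mul_of_nonneg_right hLM (norm_nonneg _))
  -- The fixed point is sought for f(t) = e^(-μt) Y(t). The exponential weight reduces the Lipschitz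
  -- constant of the integral operator to L/μ = 1/2, whatever the length of the interval.
  let μ := 2 * L
  have hμ : 0 < μ := by positivity
  have hF : ∀ f : C(Icc 0 T, X), Continuous fun τ : ℝ ↦
      Real.exp (μ * τ) • P τ (IccExtend hT f τ) := fun f ↦ by
    have h1 : Continuous (IccExtend hT f) := f.continuous.Icc_extend'
    have h2 : Continuous fun τ ↦ P τ (IccExtend hT f τ) := hPc.comp (continuous_id.prodMk h1)
    fun_prop
  let Φ : C(Icc 0 T, X) → C(Icc 0 T, X) := fun f ↦
    ⟨fun t ↦ Real.exp (-(μ * t)) • (c t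
      + ∫ τ in (0 : ℝ)..t, Real.exp (μ * τ) • P τ (IccExtend hT f τ)), by
      have h1 : Continuous fun t : Icc 0 T ↦ c t := hc.domRestrict
      have h2 : Continuous fun t : ℝ ↦
          ∫ τ in (0 : ℝ)..t, Real.exp (μ * τ) • P τ (IccExtend hT f τ) :=
        intervalIntegral.continuous_primitive (fun a b ↦ (hF f).intervalIntegrable a b) 0
      exact (by fun_prop : Continuous fun t : Icc (0 : ℝ) T ↦ Real.exp (-(μ * (t : ℝ)))).smul
        (h1.add (h2.comp continuous_subtype_val))⟩
  have hcontr : ContractingWith (1 / 2 : ℝ≥0) Φ := by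
    refine ⟨by rw [← NNReal.coe_lt_coe]; norm_num, LipschitzWith.of_dist_le_mul fun f g ↦ ?_⟩
    rw [ContinuousMap.dist_le (by positivity)]
    intro t
    have ht0 : (0 : ℝ) ≤ t := t.2.1
    have e1 : Φ f t - Φ g t = Real.exp (-(μ * t)) • ∫ τ in (0 : ℝ)..t,
        Real.exp (μ * τ) • P τ (IccExtend hT f τ - IccExtend hT g τ) := by
      have : Φ f t - Φ g t = Real.exp (-(μ * t)) • ((c t
          + ∫ τ in (0 : ℝ)..t, Real.exp (μ * τ) • P τ (IccExtend hT f τ))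
          - (c t + ∫ τ in (0 : ℝ)..t, Real.exp (μ * τ) • P τ (IccExtend hT g τ))) := by
        rw [smul_sub]; rfl
      rw [this, add_sub_add_left_eq_sub, ← intervalIntegral.integral_sub
        ((hF f).intervalIntegrable _ _) ((hF g).intervalIntegrable _ _)]
      simp only [map_sub, smul_sub]
    have e2 : ‖∫ τ in (0 : ℝ)..t, Real.exp (μ * τ) • P τ (IccExtend hT f τ - IccExtend hT g τ)‖
        ≤ ∫ τ in (0 : ℝ)..t, Real.exp (μ * τ) * (L * dist f g) := by
      refine intervalIntegral.norm_integral_le_of_norm_le ht0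
        (Eventually.of_forall fun τ _ ↦ ?_) (Continuous.intervalIntegrable (by fun_prop) _ _)
      rw [norm_smul, Real.norm_of_nonneg (Real.exp_pos _).le]
      refine mul_le_mul_of_nonneg_left ((hPL _ _).trans ?_) (Real.exp_pos _).le
      refine mul_le_mul_of_nonneg_left ?_ hL0.le
      rw [← dist_eq_norm]
      exact ContinuousMap.dist_apply_le_dist _
    have e3 : ∫ τ in (0 : ℝ)..t, Real.exp (μ * τ) = (Real.exp (μ * t) - 1) / μ := by
      have := intervalIntegral.integral_comp_mul_left (fun x ↦ Real.exp x) (a := 0) (b := t) hμ.ne'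
      simp only [mul_zero, integral_exp, Real.exp_zero] at this
      rw [this, smul_eq_mul]; ring
    rw [intervalIntegral.integral_mul_const, e3] at e2
    rw [dist_eq_norm, e1, norm_smul, Real.norm_of_nonneg (Real.exp_pos _).le]
    refine (mul_le_mul_of_nonneg_left e2 (Real.exp_pos _).le).trans ?_
    have e4 : Real.exp (-(μ * t)) * Real.exp (μ * t) = 1 := by
      rw [← Real.exp_add]; simp
    have e5 : Real.exp (-(μ * t)) * ((Real.exp (μ * t) - 1) / μ * (L * dist f g))
        = (1 - Real.exp (-(μ * t))) * (L / μ) * dist f g := by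
      linear_combination (L / μ * dist f g) * e4
    have e6 : L / μ = 1 / 2 := by
      simp only [μ]; field_simp
    rw [e5, e6]
    push_cast
    refine mul_le_mul_of_nonneg_right ?_ dist_nonneg
    linarith [Real.exp_pos (-(μ * t))]
  have hfix := hcontr.fixedPoint_isFixedPt
  set f := ContractingWith.fixedPoint Φ hcontr
  refine ⟨fun t ↦ Real.exp (μ * t) • IccExtend hT f t, ?_, fun t ht ↦ ?_⟩
  · have h1 : Continuous (IccExtend hT f) := f.continuous.Icc_extend'
    fun_prop
  · have h1 : Φ f ⟨t, ht⟩ = f ⟨t, ht⟩ := congrArg (fun g : C(Icc 0 T, X) ↦ g ⟨t, ht⟩) hfix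
    have h2 : Φ f ⟨t, ht⟩ = Real.exp (-(μ * t)) • (c t
      + ∫ τ in (0 : ℝ)..t, Real.exp (μ * τ) • P τ (IccExtend hT f τ)) := rfl
    simp only [map_smul]
    rw [IccExtend_of_mem hT f ht, ← h1, h2, smul_smul, ← Real.exp_add, add_neg_cancel,
      Real.exp_zero, one_smul]

end Volterra

/-! ### The isometry group generated by the inverse of a skew-adjoint operator. -/

section Group

variable {X : Type*} [NormedAddCommGroup X] [InnerProductSpace ℝ X]

/-- Skew-adjointness of a bounded operator on a real Hilbert space. -/
def IsSkew (R : X →L[ℝ] X) : Prop := ∀ x y, inner ℝ (R x) y = -inner ℝ x (R y)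

theorem IsSkew.inner_self {R : X →L[ℝ] X} (hR : IsSkew R) (x : X) : inner ℝ (R x) x = 0 := by
  have h := hR x x
  rw [real_inner_comm] at h
  rw [real_inner_comm]
  linarith

theorem IsSkew.inner_self' {R : X →L[ℝ] X} (hR : IsSkew R) (x : X) : inner ℝ x (R x) = 0 := by
  rw [real_inner_comm, hR.inner_self]

/-- `W` is the strongly continuous group of isometries generated by the (unbounded) inverse
of `R`. -/
structure IsInverseGroup (R : X →L[ℝ] X) (W : ℝ → X →L[ℝ] X) : Prop where
  norm_map : ∀ t x, ‖W t x‖ = ‖x‖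
  zero : ∀ x, W 0 x = x
  add : ∀ s t x, W (s + t) x = W s (W t x)
  comm : ∀ t x, W t (R x) = R (W t x)
  cont : ∀ x, Continuous fun t ↦ W t x
  hasDerivAt : ∀ x t, HasDerivAt (fun t ↦ W t (R x)) (W t x) t

variable [CompleteSpace X]

/-- The derivative of ‖y‖² along y' = Dy is 2⟨y,Dy⟩ = 0. -/
theorem norm_exp_skew {D : X →L[ℝ] X} (hD : ∀ x, inner ℝ x (D x) = 0) (t : ℝ) (x : X) :
    ‖NormedSpace.exp (t • D) x‖ = ‖x‖ := by
  have hd : ∀ t : ℝ, HasDerivAt (fun t : ℝ ↦ NormedSpace.exp (t • D) x)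
      (D (NormedSpace.exp (t • D) x)) t := fun t ↦ by
    have := (ContinuousLinearMap.apply ℝ X x).hasFDerivAt.comp_hasDerivAt t
      (hasDerivAt_exp_smul_const' D t)
    exact this
  have hd2 : ∀ t : ℝ, HasDerivAt (fun t : ℝ ↦ ‖NormedSpace.exp (t • D) x‖ ^ 2) 0 t := fun t ↦ by
    have := (hd t).norm_sq
    rwa [hD, mul_zero] at this
  have h := is_const_of_deriv_eq_zero (fun t ↦ (hd2 t).differentiableAt)
    (fun t ↦ (hd2 t).deriv) t 0
  simp only [zero_smul, NormedSpace.exp_zero, one_apply_eq_self] at h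
  exact (sq_eq_sq₀ (norm_nonneg _) (norm_nonneg _)).1 h

/-- The orbit has velocity exp(tD)(Dx), of constant norm ‖Dx‖, so the mean value inequality applies.
-/
theorem norm_exp_skew_sub_le {D : X →L[ℝ] X} (hD : ∀ x, inner ℝ x (D x) = 0) (t s : ℝ) (x : X) :
    ‖NormedSpace.exp (t • D) x - NormedSpace.exp (s • D) x‖ ≤ ‖D x‖ * |t - s| := by
  have hd : ∀ t : ℝ, HasDerivAt (fun t : ℝ ↦ NormedSpace.exp (t • D) x)
      (NormedSpace.exp (t • D) (D x)) t := fun t ↦ by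
    have := (ContinuousLinearMap.apply ℝ X x).hasFDerivAt.comp_hasDerivAt t
      (hasDerivAt_exp_smul_const D t)
    exact this
  exact convex_univ.norm_image_sub_le_of_norm_hasDerivWithin_le
    (fun t _ ↦ (hd t).hasDerivWithinAt) (fun t _ ↦ (norm_exp_skew hD t (D x)).le)
    (mem_univ s) (mem_univ t)

/-- By commutation exp(tA) = exp(tB) exp(t(A-B)). The isometry exp(tB) factors out, leaving the
displacement of x under the flow of A-B. -/
theorem norm_exp_sub_exp_le {A B : X →L[ℝ] X} (hA : ∀ x, inner ℝ x (A x) = 0)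
    (hB : ∀ x, inner ℝ x (B x) = 0) (hAB : Commute A B) (t : ℝ) (x : X) :
    ‖NormedSpace.exp (t • A) x - NormedSpace.exp (t • B) x‖ ≤ |t| * ‖A x - B x‖ := by
  let _ : NormedAlgebra ℚ (X →L[ℝ] X) := NormedAlgebra.restrictScalars ℚ ℝ (X →L[ℝ] X)
  have hD : ∀ x, inner ℝ x ((A - B) x) = 0 := fun x ↦ by
    rw [sub_apply, inner_sub_right, hA, hB, sub_zero]
  have hc : Commute (t • B) (t • (A - B)) :=
    ((hAB.symm.sub_right (Commute.refl B)).smul_left t).smul_right t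
  have h1 : NormedSpace.exp (t • A) = NormedSpace.exp (t • B) * NormedSpace.exp (t • (A - B)) := by
    rw [← NormedSpace.exp_add_of_commute hc, ← smul_add, add_sub_cancel]
  have h2 := norm_exp_skew_sub_le hD t 0 x
  rw [zero_smul, NormedSpace.exp_zero, sub_zero, mul_comm] at h2
  rw [h1, mul_apply_eq_comp, ← map_sub, norm_exp_skew hB]
  exact h2

/-- Since ⟨-R²u,u⟩ = ‖Ru‖² ≥ 0, the operator ε² - R² is coercive and the Lax–Milgram theorem inverts
it. -/
theorem IsSkew.exists_resolvent {R : X →L[ℝ] X} (hR : IsSkew R) {ε : ℝ} (hε : 0 < ε) :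
    ∃ J : X →L[ℝ] X, (∀ x, ε ^ 2 • J x - R (R (J x)) = x) ∧
      ∀ x, J (ε ^ 2 • x - R (R x)) = x := by
  let K : X →L[ℝ] X := ε ^ 2 • ContinuousLinearMap.id ℝ X - R ∘L R
  have hK : ∀ x, K x = ε ^ 2 • x - R (R x) := fun x ↦ rfl
  have hco : IsCoercive (innerSL ℝ ∘L K) := by
    refine ⟨ε ^ 2, by positivity, fun u ↦ ?_⟩
    have e : (innerSL ℝ ∘L K) u u = inner ℝ (K u) u := rfl
    rw [e, hK, inner_sub_left, inner_smul_left, hR (R u) u, real_inner_self_eq_norm_sq,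
      real_inner_self_eq_norm_sq]
    simp only [conj_trivial]
    nlinarith [sq_nonneg ‖R u‖]
  let L := hco.continuousLinearEquivOfBilin
  have hL : ∀ x, L x = K x := fun x ↦ ext_inner_right ℝ fun w ↦
    hco.continuousLinearEquivOfBilin_apply x w
  refine ⟨L.symm, fun x ↦ ?_, fun x ↦ ?_⟩
  · rw [← hK, ContinuousLinearEquiv.coe_coe, ← hL, L.apply_symm_apply]
  · rw [← hK, ← hL, ContinuousLinearEquiv.coe_coe, L.symm_apply_apply]

/-- A vector x orthogonal to the range satisfies 0 = ⟨R(Rx),x⟩ = -‖Rx‖². -/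
theorem IsSkew.denseRange {R : X →L[ℝ] X} (hR : IsSkew R) (hinj : Function.Injective R) :
    DenseRange R := by
  have h : (LinearMap.range (R : X →ₗ[ℝ] X)).topologicalClosure = ⊤ := by
    rw [Submodule.topologicalClosure_eq_top_iff, Submodule.eq_bot_iff]
    intro x hx
    rw [Submodule.mem_orthogonal] at hx
    have h1 := hx (R (R x)) ⟨R x, rfl⟩
    rw [hR, real_inner_self_eq_norm_sq, neg_eq_zero, sq_eq_zero_iff, norm_eq_zero] at h1
    exact hinj (h1.trans (map_zero R).symm)
  exact (Submodule.dense_iff_topologicalClosure_eq_top (s := R.range)).2 h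

/-- A Yosida-type approximation of R⁻¹ by bounded commuting skew operators: A_k = -R J_k with J_k =
(ε_k² - R²)⁻¹ and ε_k → 0. Then A_k R x = x - ε_k² J_k x, and the task is to show that the last term
tends to zero. -/
theorem IsSkew.exists_approx {R : X →L[ℝ] X} (hR : IsSkew R) (hinj : Function.Injective R) :
    ∃ A : ℕ → X →L[ℝ] X, (∀ k x, inner ℝ x (A k x) = 0) ∧ (∀ k l, Commute (A k) (A l)) ∧
      (∀ k x, A k (R x) = R (A k x)) ∧
      ∀ x, Tendsto (fun k ↦ A k (R x)) atTop (𝓝 x) := by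
  let ε : ℕ → ℝ := fun k ↦ 1 / ((k : ℝ) + 1)
  have hε : ∀ k, 0 < ε k := fun k ↦ Nat.one_div_pos_of_nat
  have hε0 : Tendsto ε atTop (𝓝 0) := tendsto_one_div_add_atTop_nhds_zero_nat
  choose J hJ1 hJ2 using fun k ↦ hR.exists_resolvent (hε k)
  have hJR : ∀ k x, J k (R x) = R (J k x) := fun k x ↦ by
    conv_lhs => rw [← hJ1 k x]
    rw [map_sub, map_smul, hJ2]
  have hJJ : ∀ k l x, J k (J l x) = J l (J k x) := fun k l x ↦ by
    conv_lhs => rw [← hJ1 k x]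
    rw [map_sub, map_smul, hJR, hJR, hJ2]
  have hRJ : ∀ k x, ‖R (J k x)‖ ^ 2 + ε k ^ 2 * ‖J k x‖ ^ 2 = inner ℝ x (J k x) := fun k x ↦ by
    have h : inner ℝ (ε k ^ 2 • J k x - R (R (J k x))) (J k x) = inner ℝ x (J k x) := by
      rw [hJ1]
    rw [inner_sub_left, inner_smul_left, hR (R _), real_inner_self_eq_norm_sq,
      real_inner_self_eq_norm_sq] at h
    simp only [conj_trivial] at h
    linarith
  have hJn : ∀ k x, ε k ^ 2 * ‖J k x‖ ≤ ‖x‖ := fun k x ↦ by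
    have h1 := hRJ k x
    have h2 := real_inner_le_norm x (J k x)
    rcases (norm_nonneg (J k x)).eq_or_lt with h3 | h3
    · rw [← h3, mul_zero]; positivity
    · refine le_of_mul_le_mul_right ?_ h3
      nlinarith [sq_nonneg ‖R (J k x)‖]
  have hRJn : ∀ k x, ε k * ‖R (J k x)‖ ≤ ‖x‖ := fun k x ↦ by
    refine abs_le_of_sq_le_sq' ?_ (norm_nonneg _) |>.2
    have h1 := hRJ k x
    have h2 := real_inner_le_norm x (J k x)
    have h3 := hJn k x
    have h4 : ε k ^ 2 * ‖R (J k x)‖ ^ 2 ≤ ε k ^ 2 * (‖x‖ * ‖J k x‖) := by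
      refine mul_le_mul_of_nonneg_left ?_ (sq_nonneg _)
      nlinarith [mul_nonneg (sq_nonneg (ε k)) (sq_nonneg ‖J k x‖)]
    nlinarith [norm_nonneg x]
  have hA : ∀ k x, -(R (J k (R x))) = x - ε k ^ 2 • J k x := fun k x ↦ by
    rw [hJR, sub_eq_add_neg, ← sub_eq_iff_eq_add'.2 (sub_eq_iff_eq_add.1 (hJ1 k x))]
    abel
  refine ⟨fun k ↦ -(R ∘L J k), fun k x ↦ ?_, fun k l ↦ ?_, fun k x ↦ ?_, fun x ↦ ?_⟩
  · have e : (-(R ∘L J k)) x = -(R (J k x)) := rfl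
    have h : inner ℝ (ε k ^ 2 • J k x - R (R (J k x))) (R (J k x)) = 0 := by
      rw [inner_sub_left, inner_smul_left, hR.inner_self', hR.inner_self, mul_zero, sub_zero]
    rw [hJ1] at h
    rw [e, inner_neg_right, h, neg_zero]
  · ext x
    change -(R (J k (-(R (J l x))))) = -(R (J l (-(R (J k x)))))
    simp only [map_neg, hJR, hJJ k l]
  · change -(R (J k (R x))) = R (-(R (J k x)))
    rw [hJR, map_neg]
  -- For x = Ry one has ε²JRy = ε(εRJy), of norm at most ε‖y‖ by `hRJn`. The uniform bound `hJn` and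
  -- density of the range extend the limit to all x.
  · have hz : ∀ x, Tendsto (fun k ↦ ε k ^ 2 • J k x) atTop (𝓝 0) := by
      intro x
      rw [Metric.tendsto_atTop]
      intro η hη
      obtain ⟨y, hy⟩ := (hR.denseRange hinj).exists_dist_lt x (half_pos hη)
      have hlim : Tendsto (fun k ↦ ε k * ‖y‖) atTop (𝓝 0) := by
        simpa using hε0.mul_const ‖y‖
      obtain ⟨N, hN⟩ := (Metric.tendsto_atTop.1 hlim) (η / 2) (half_pos hη)
      refine ⟨N, fun k hk ↦ ?_⟩
      have h1 := hN k hk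
      rw [dist_zero_right, Real.norm_of_nonneg (mul_nonneg (hε k).le (norm_nonneg _))] at h1
      rw [dist_zero_right]
      have e : ε k ^ 2 • J k x = ε k ^ 2 • J k (x - R y) + ε k ^ 2 • R (J k y) := by
        rw [← hJR, ← smul_add, ← map_add, sub_add_cancel]
      rw [e]
      refine (norm_add_le _ _).trans_lt ?_
      rw [norm_smul, norm_smul, Real.norm_of_nonneg (sq_nonneg _)]
      have h2 := hJn k (x - R y)
      rw [dist_eq_norm] at hy
      have h3 : ε k ^ 2 * ‖R (J k y)‖ ≤ ε k * ‖y‖ := by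
        rw [pow_two, mul_assoc]
        exact mul_le_mul_of_nonneg_left (hRJn k y) (hε k).le
      linarith
    have h := (tendsto_const_nhds (x := x)).sub (hz x)
    rw [sub_zero] at h
    exact h.congr fun k ↦ (hA k x).symm

/-- The inverse of an injective skew-adjoint operator generates a group of isometries. -/
theorem IsSkew.exists_group {R : X →L[ℝ] X} (hR : IsSkew R) (hinj : Function.Injective R) :
    ∃ W : ℝ → X →L[ℝ] X, IsInverseGroup R W := by
  obtain ⟨A, hA, hcomm, hAR, hlim⟩ := hR.exists_approx hinj
  let _ : NormedAlgebra ℚ (X →L[ℝ] X) := NormedAlgebra.restrictScalars ℚ ℝ (X →L[ℝ] X)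
  let E : ℕ → ℝ → X →L[ℝ] X := fun k t ↦ NormedSpace.exp (t • A k)
  have hEn : ∀ k t x, ‖E k t x‖ = ‖x‖ := fun k t x ↦ norm_exp_skew (hA k) t x
  have hdense := hR.denseRange hinj
  -- On the range of R, `norm_exp_sub_exp_le` bounds the differences by those of A_k(Ry), which
  -- converge to y. The rest is a density argument for isometries.
  have hcau : ∀ t x, CauchySeq fun k ↦ E k t x := by
    intro t x
    rw [Metric.cauchySeq_iff]
    intro η hη
    obtain ⟨y, hy⟩ := hdense.exists_dist_lt x (div_pos hη (by norm_num : (0 : ℝ) < 4))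
    have h1 : CauchySeq fun k ↦ |t| • A k (R y) := ((hlim y).const_smul |t|).cauchySeq
    obtain ⟨N, hN⟩ := Metric.cauchySeq_iff.1 h1 (η / 4) (by positivity)
    refine ⟨N, fun k hk l hl ↦ ?_⟩
    have h2 := hN k hk l hl
    rw [dist_eq_norm, ← smul_sub, norm_smul, Real.norm_eq_abs, abs_abs] at h2
    have h3 := norm_exp_sub_exp_le (hA k) (hA l) (hcomm k l) t (R y)
    rw [dist_eq_norm] at hy ⊢
    have e : E k t x - E l t x = E k t (x - R y) - E l t (x - R y)
        + (E k t (R y) - E l t (R y)) := by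
      simp only [map_sub]; abel
    rw [e]
    refine (norm_add_le _ _).trans_lt ?_
    have h4 := norm_sub_le (E k t (x - R y)) (E l t (x - R y))
    rw [hEn, hEn] at h4
    have h5 : ‖E k t (R y) - E l t (R y)‖ ≤ |t| * ‖A k (R y) - A l (R y)‖ := h3
    linarith
  choose f hf using fun t x ↦ cauchySeq_tendsto_of_complete (hcau t x)
  let W : ℝ → X →L[ℝ] X := fun t ↦ continuousLinearMapOfTendsto (fun k ↦ E k t)
    (tendsto_pi_nhds.2 (hf t))
  have hW : ∀ t x, Tendsto (fun k ↦ E k t x) atTop (𝓝 (W t x)) := hf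
  have hWn : ∀ t x, ‖W t x‖ = ‖x‖ := fun t x ↦
    tendsto_nhds_unique (hW t x).norm (by simp only [hEn]; exact tendsto_const_nhds)
  have hlip : ∀ y t s, ‖W t (R y) - W s (R y)‖ ≤ ‖y‖ * |t - s| := fun y t s ↦
    le_of_tendsto_of_tendsto' ((hW t (R y)).sub (hW s (R y))).norm ((hlim y).norm.mul_const _)
      fun k ↦ norm_exp_skew_sub_le (hA k) t s (R y)
  have hcont : ∀ x, Continuous fun t ↦ W t x := by
    intro x
    rw [Metric.continuous_iff]
    intro s η hη
    obtain ⟨y, hy⟩ := hdense.exists_dist_lt x (div_pos hη (by norm_num : (0 : ℝ) < 4))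
    rw [dist_eq_norm] at hy
    refine ⟨η / (4 * (‖y‖ + 1)), by positivity, fun t ht ↦ ?_⟩
    rw [Real.dist_eq, lt_div_iff₀ (by positivity)] at ht
    rw [dist_eq_norm]
    have e : W t x - W s x = W t (x - R y) - W s (x - R y) + (W t (R y) - W s (R y)) := by
      simp only [map_sub]; abel
    rw [e]
    refine (norm_add_le _ _).trans_lt ?_
    have h4 := norm_sub_le (W t (x - R y)) (W s (x - R y))
    rw [hWn, hWn] at h4
    have h5 := hlip y t s
    nlinarith [abs_nonneg (t - s), norm_nonneg y]
  have hER : ∀ k t x, E k t (R x) = R (E k t x) := fun k t x ↦ by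
    have h : Commute (t • A k) R :=
      Commute.smul_left (ContinuousLinearMap.ext fun x ↦ hAR k x : Commute (A k) R) t
    exact DFunLike.congr_fun h.exp_left.eq x
  -- This integrated form passes to the limit by dominated convergence, because A_k(Rx) → x while
  -- exp(τA_k) is isometric. Differentiating it gives the generator relation.
  have hint : ∀ x t, W t (R x) = R x + ∫ τ in (0 : ℝ)..t, W τ x := by
    intro x t
    have hd : ∀ k (t : ℝ), HasDerivAt (fun t : ℝ ↦ E k t (R x)) (E k t (A k (R x))) t :=
      fun k t ↦ (ContinuousLinearMap.apply ℝ X (R x)).hasFDerivAt.comp_hasDerivAt t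
        (hasDerivAt_exp_smul_const (A k) t)
    have hc : ∀ k y, Continuous fun t ↦ E k t y := fun k y ↦ by
      have : Differentiable ℝ fun t : ℝ ↦ NormedSpace.exp (t • A k) :=
        fun t ↦ (hasDerivAt_exp_smul_const (A k) t).differentiableAt
      exact (ContinuousLinearMap.apply ℝ X y).continuous.comp this.continuous
    have h1 : ∀ k, ∫ τ in (0 : ℝ)..t, E k τ (A k (R x)) = E k t (R x) - R x := fun k ↦ by
      rw [intervalIntegral.integral_eq_sub_of_hasDerivAt (fun s _ ↦ hd k s)
        ((hc k _).intervalIntegrable _ _)]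
      simp only [E, zero_smul, NormedSpace.exp_zero, one_apply_eq_self]
    have hb : ∃ C, ∀ k, ‖A k (R x)‖ ≤ C := by
      obtain ⟨C, hC⟩ := (hlim x).norm.bddAbove_range
      exact ⟨C, fun k ↦ hC ⟨k, rfl⟩⟩
    obtain ⟨C, hC⟩ := hb
    have h2 : Tendsto (fun k ↦ ∫ τ in (0 : ℝ)..t, E k τ (A k (R x))) atTop
        (𝓝 (∫ τ in (0 : ℝ)..t, W τ x)) := by
      refine intervalIntegral.tendsto_integral_filter_of_dominated_convergence (fun _ ↦ C)
        (Eventually.of_forall fun k ↦ (hc k _).aestronglyMeasurable)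
        (Eventually.of_forall fun k ↦ Eventually.of_forall fun τ _ ↦ ?_)
        intervalIntegrable_const (Eventually.of_forall fun τ _ ↦ ?_)
      · rw [hEn]; exact hC k
      · have h3 : Tendsto (fun k ↦ E k τ (A k (R x) - x)) atTop (𝓝 0) := by
          rw [tendsto_zero_iff_norm_tendsto_zero]
          simp only [hEn]
          rw [← tendsto_zero_iff_norm_tendsto_zero]
          simpa using (hlim x).sub_const x
        have h4 := h3.add (hW τ x)
        rw [zero_add] at h4
        refine h4.congr fun k ↦ ?_
        rw [map_sub, sub_add_cancel]
    have h5 := tendsto_nhds_unique (h2.congr h1) ((hW t (R x)).sub_const (R x))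
    rw [h5, add_sub_cancel]
  refine ⟨W, hWn, fun x ↦ ?_, fun s t x ↦ ?_, fun t x ↦ ?_, hcont, fun x t ↦ ?_⟩
  · refine tendsto_nhds_unique (hW 0 x) ?_
    simp only [E, zero_smul, NormedSpace.exp_zero, one_apply_eq_self]
    exact tendsto_const_nhds
  · have h1 : ∀ k, E k (s + t) x = E k s (E k t x) := fun k ↦ by
      have : E k (s + t) = E k s * E k t := by
        simp only [E]
        rw [add_smul, NormedSpace.exp_add_of_commute
          (((Commute.refl (A k)).smul_left s).smul_right t)]
      rw [this]; rfl
    have h3 : Tendsto (fun k ↦ E k s (E k t x - W t x)) atTop (𝓝 0) := by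
      rw [tendsto_zero_iff_norm_tendsto_zero]
      simp only [hEn]
      rw [← tendsto_zero_iff_norm_tendsto_zero]
      simpa using (hW t x).sub_const (W t x)
    have h4 := h3.add (hW s (W t x))
    rw [zero_add] at h4
    refine tendsto_nhds_unique (hW (s + t) x) (h4.congr fun k ↦ ?_)
    rw [map_sub, sub_add_cancel, h1]
  · refine tendsto_nhds_unique (hW t (R x)) ?_
    simp only [hER]
    exact (R.continuous.tendsto _).comp (hW t x)
  · simp only [hint x]
    exact (intervalIntegral.integral_hasDerivAt_right ((hcont x).intervalIntegrable _ _)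
      ((hcont x).stronglyMeasurableAtFilter _ _) (hcont x).continuousAt).const_add _

end Group

/-! ### Mild and time-integrated solutions, and their duality. -/

section Evolution

variable {X : Type*} [NormedAddCommGroup X] [InnerProductSpace ℝ X]
  {R : X →L[ℝ] X} {W : ℝ → X →L[ℝ] X}

theorem IsSkew.neg (hR : IsSkew R) : IsSkew (-R) := fun x y ↦ by
  rw [neg_apply, neg_apply, inner_neg_left, inner_neg_right, hR]

theorem IsInverseGroup.apply_neg (hW : IsInverseGroup R W) (t : ℝ) (x : X) :
    W t (W (-t) x) = x := by
  rw [← hW.add, add_neg_cancel, hW.zero]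

theorem IsInverseGroup.inner_map_map (hW : IsInverseGroup R W) (t : ℝ) (x y : X) :
    inner ℝ (W t x) (W t y) = inner ℝ x y :=
  (⟨(W t : X →ₗ[ℝ] X), hW.norm_map t⟩ : X →ₗᵢ[ℝ] X).inner_map_map x y

theorem IsInverseGroup.inner_left (hW : IsInverseGroup R W) (t : ℝ) (x y : X) :
    inner ℝ (W t x) y = inner ℝ x (W (-t) y) := by
  conv_lhs => rw [← hW.apply_neg t y]
  exact hW.inner_map_map t _ _

theorem IsInverseGroup.continuous_uncurry (hW : IsInverseGroup R W) :
    Continuous fun z : ℝ × X ↦ W z.1 z.2 :=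
  continuous_uncurry_of_bounded (M := 1) (fun t x ↦ by rw [hW.norm_map, one_mul]) hW.cont

/-- Time reversal serves twice: to differentiate W(-t) on the range of R, and to solve equations
from the final time. -/
theorem IsInverseGroup.reverse (hW : IsInverseGroup R W) :
    IsInverseGroup (-R) fun t ↦ W (-t) where
  norm_map t x := hW.norm_map (-t) x
  zero x := by rw [neg_zero, hW.zero]
  add s t x := by rw [neg_add, hW.add]
  comm t x := by rw [neg_apply, neg_apply, map_neg, hW.comm]
  cont x := (hW.cont x).comp continuous_neg
  hasDerivAt x t := by
    have h := ((hW.hasDerivAt x (-t)).scomp t (hasDerivAt_neg t)).neg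
    simp only [neg_smul, one_smul, neg_neg] at h
    refine h.congr_of_eventuallyEq (Eventually.of_forall fun s ↦ ?_)
    simp [Function.comp_def]

theorem IsInverseGroup.intervalIntegrable (hW : IsInverseGroup R W) {g : ℝ → X} {a b : ℝ}
    (hg : IntervalIntegrable g volume a b) :
    IntervalIntegrable (fun τ ↦ W (-τ) (g τ)) volume a b := by
  refine hg.mono_fun ?_ (Eventually.of_forall fun τ ↦ (hW.norm_map _ _).le)
  have h1 : AEStronglyMeasurable (fun τ : ℝ ↦ -τ) (volume.restrict (uIoc a b)) :=
    continuous_neg.aestronglyMeasurable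
  exact hW.continuous_uncurry.comp_aestronglyMeasurable
    (h1.prodMk hg.aestronglyMeasurable_restrict_uIoc)

variable [CompleteSpace X]

/-- Mild solutions of `U' = R⁻¹ U + g` satisfy the equation integrated in time, after application
of `R`. -/
theorem IsInverseGroup.integrated_of_mild (hR : IsSkew R) (hW : IsInverseGroup R W) {g : ℝ → X}
    {T : ℝ} (hg : IntervalIntegrable g volume 0 T) {U : ℝ → X} (c : X)
    (hU : ∀ t ∈ Icc 0 T, U t = W t (c + ∫ τ in (0 : ℝ)..t, W (-τ) (g τ))) :
    ∀ t ∈ Icc 0 T, R (U t) = R c + ∫ τ in (0 : ℝ)..t, (U τ + R (g τ)) := by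
  intro t ht
  have hsub : uIcc 0 t ⊆ uIcc 0 T := by
    rw [uIcc_of_le ht.1, uIcc_of_le (ht.1.trans ht.2)]
    exact Icc_subset_Icc_right ht.2
  have hgt : IntervalIntegrable g volume 0 t := hg.mono_set hsub
  have hUc : ContinuousOn U (uIcc 0 t) := by
    have h1 := intervalIntegral.continuousOn_primitive_interval' (hW.intervalIntegrable hgt)
      (left_mem_uIcc : (0 : ℝ) ∈ uIcc 0 t)
    refine ContinuousOn.congr (f := fun t ↦ W t (c + ∫ τ in (0 : ℝ)..t, W (-τ) (g τ))) ?_ ?_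
    · exact hW.continuous_uncurry.comp_continuousOn (continuousOn_id.prodMk
        (continuousOn_const.add h1))
    · intro s hs
      rw [uIcc_of_le ht.1] at hs
      exact hU s ⟨hs.1, hs.2.trans ht.2⟩
  have hRg : IntervalIntegrable (fun τ ↦ R (g τ)) volume 0 t :=
    ⟨R.integrable_comp hgt.1, R.integrable_comp hgt.2⟩
  have hUR : IntervalIntegrable (fun τ ↦ U τ + R (g τ)) volume 0 t :=
    hUc.intervalIntegrable.add hRg
  -- Paired with x, the claim is an integration by parts of c + ∫W(-τ)g against W(-τ)(-Rx), whose
  -- derivative is W(-τ)x. The derivative falls on the fixed vector, so U itself is never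
  -- differentiated.
  refine ext_inner_left ℝ fun x ↦ ?_
  have hc1 : Continuous fun τ ↦ W (-τ) x := (hW.cont x).comp continuous_neg
  have ibp := integral_inner_primitive (a := 0) (b := t)
    (hW.intervalIntegrable hgt) (hc1.intervalIntegrable 0 t)
    (Y := fun t ↦ c + ∫ τ in (0 : ℝ)..t, W (-τ) (g τ)) (P := fun τ ↦ W (-τ) ((-R) x))
    (by simp) (by
      intro s _
      rw [intervalIntegral.integral_eq_sub_of_hasDerivAt
        (fun s _ ↦ hW.reverse.hasDerivAt x s) (hc1.intervalIntegrable 0 s)]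
      simp)
  have e1 : ∫ τ in (0 : ℝ)..t, (inner ℝ (W (-τ) (g τ)) (W (-τ) ((-R) x))
      + inner ℝ (c + ∫ σ in (0 : ℝ)..τ, W (-σ) (g σ)) (W (-τ) x))
      = ∫ τ in (0 : ℝ)..t, inner ℝ x (U τ + R (g τ)) := by
    refine intervalIntegral.integral_congr fun s hs ↦ ?_
    rw [uIcc_of_le ht.1] at hs
    rw [hW.inner_map_map, ← hW.inner_left, ← hU s ⟨hs.1, hs.2.trans ht.2⟩, inner_add_right,
      neg_apply, inner_neg_right, ← hR, real_inner_comm, add_comm, real_inner_comm]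
  have e2 : ∫ τ in (0 : ℝ)..t, inner ℝ x (U τ + R (g τ))
      = inner ℝ x (∫ τ in (0 : ℝ)..t, (U τ + R (g τ))) :=
    (innerSL ℝ x).intervalIntegral_comp_comm hUR
  rw [e1, e2, ← hW.inner_left, ← hU t ht] at ibp
  simp only [intervalIntegral.integral_same, add_zero, neg_zero, hW.zero, neg_apply,
    inner_neg_right] at ibp
  rw [inner_add_right, ibp, ← hR, ← hR, real_inner_comm, real_inner_comm x (R c)]
  ring

/-- Energy conservation: d/dt ‖RD‖² = 2⟨D,RD⟩ = 0 and RD vanishes at time zero; injectivity of R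
concludes. -/
theorem IsSkew.eq_zero_of_integrated (hR : IsSkew R) (hinj : Function.Injective R) {T : ℝ}
    {D : ℝ → X} (hD : ContinuousOn D (Icc 0 T))
    (h : ∀ t ∈ Icc 0 T, R (D t) = ∫ τ in (0 : ℝ)..t, D τ) : ∀ t ∈ Icc 0 T, D t = 0 := by
  intro t ht
  have hsub : uIcc 0 t ⊆ Icc 0 T := by
    rw [uIcc_of_le ht.1]
    exact Icc_subset_Icc_right ht.2
  have h0 : R (D 0) = 0 := by
    rw [h 0 ⟨le_rfl, ht.1.trans ht.2⟩, intervalIntegral.integral_same]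
  have hi := (hD.mono hsub).intervalIntegrable (μ := volume)
  have hY : ∀ s ∈ uIcc 0 t, R (D s) = R (D 0) + ∫ τ in (0 : ℝ)..s, D τ := fun s hs ↦ by
    rw [h0, zero_add, h s (hsub hs)]
  have ibp := integral_inner_primitive hi hi hY hY
  simp only [hR.inner_self, hR.inner_self', add_zero, intervalIntegral.integral_zero, h0,
    inner_zero_left, sub_zero] at ibp
  exact hinj ((inner_self_eq_zero.1 ibp.symm).trans (map_zero R).symm)

/-- Solutions of the integrated equation are mild solutions. -/
theorem IsInverseGroup.mild_of_integrated (hR : IsSkew R) (hinj : Function.Injective R)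
    (hW : IsInverseGroup R W) {g : ℝ → X} {T : ℝ} (hg : IntervalIntegrable g volume 0 T)
    {U : ℝ → X} (hUc : ContinuousOn U (Icc 0 T))
    (hU : ∀ t ∈ Icc 0 T, R (U t) = R (U 0) + ∫ τ in (0 : ℝ)..t, (U τ + R (g τ))) :
    ∀ t ∈ Icc 0 T, U t = W t (U 0 + ∫ τ in (0 : ℝ)..t, W (-τ) (g τ)) := by
  rcases lt_or_ge T 0 with hT | hT
  · intro t ht; exact absurd (ht.1.trans ht.2) (not_le.2 hT)
  -- The Duhamel formula with the same initial value and forcing; its difference with U satisfies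
  -- the homogeneous integrated equation and so vanishes.
  set Z : ℝ → X := fun t ↦ W t (U 0 + ∫ τ in (0 : ℝ)..t, W (-τ) (g τ)) with hZ
  have hZi := hW.integrated_of_mild hR hg (U := Z) (U 0) fun t _ ↦ rfl
  have hZc : ContinuousOn Z (Icc 0 T) := by
    have h1 := intervalIntegral.continuousOn_primitive_interval' (hW.intervalIntegrable hg)
      (left_mem_uIcc : (0 : ℝ) ∈ uIcc 0 T)
    rw [uIcc_of_le hT] at h1
    exact hW.continuous_uncurry.comp_continuousOn (continuousOn_id.prodMk
        (continuousOn_const.add h1))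
  have key := hR.eq_zero_of_integrated hinj (hUc.sub hZc) (fun t ht ↦ by
    have hsub : uIcc 0 t ⊆ Icc 0 T := by
      rw [uIcc_of_le ht.1]
      exact Icc_subset_Icc_right ht.2
    have hgt : IntervalIntegrable g volume 0 t := hg.mono_set (by rwa [uIcc_of_le hT])
    have hRg : IntervalIntegrable (fun τ ↦ R (g τ)) volume 0 t :=
      ⟨R.integrable_comp hgt.1, R.integrable_comp hgt.2⟩
    have i1 := ((hUc.mono hsub).intervalIntegrable (μ := volume)).add hRg
    have i2 := ((hZc.mono hsub).intervalIntegrable (μ := volume)).add hRg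
    rw [Pi.sub_apply, map_sub, hU t ht, hZi t ht, add_sub_add_left_eq_sub,
      ← intervalIntegral.integral_sub i1 i2]
    simp only [add_sub_add_right_eq_sub, Pi.sub_apply])
  intro t ht
  exact sub_eq_zero.1 (key t ht)

/-- Duality between a linear evolution equation and its adjoint. -/
theorem IsInverseGroup.duality (hW : IsInverseGroup R W) {T : ℝ} (hT : 0 ≤ T)
    {B C : X →L[ℝ] X} (hBC : ∀ x y, inner ℝ (C x) y = inner ℝ x (B y)) {Φ Γ U V : ℝ → X}
    (hΦ : IntervalIntegrable Φ volume 0 T) (hΓ : IntervalIntegrable Γ volume 0 T)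
    (hUc : ContinuousOn U (Icc 0 T)) (hVc : ContinuousOn V (Icc 0 T))
    (hU : ∀ t ∈ Icc 0 T, U t = W t (U 0 + ∫ τ in (0 : ℝ)..t, W (-τ) (Φ τ + C (U τ))))
    (hV : ∀ t ∈ Icc 0 T, V t = W t (V 0 + ∫ τ in (0 : ℝ)..t, W (-τ) (Γ τ - B (V τ)))) :
    ∫ τ in (0 : ℝ)..T, (inner ℝ (Φ τ) (V τ) + inner ℝ (U τ) (Γ τ))
      = inner ℝ (U T) (V T) - inner ℝ (U 0) (V 0) := by
  rw [← uIcc_of_le hT] at hUc hVc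
  have i1 := hW.intervalIntegrable
    (hΦ.add (C.continuous.comp_continuousOn hUc).intervalIntegrable)
  have i2 := hW.intervalIntegrable
    (hΓ.sub (B.continuous.comp_continuousOn hVc).intervalIntegrable)
  -- The integration by parts concerns W(-t)U and W(-t)V, which are primitives of integrable
  -- functions. As the group is isometric, their pairing equals ⟨U,V⟩ and R⁻¹ disappears; the terms
  -- in `C` and `B` cancel by adjointness.
  have ibp := integral_inner_primitive i1 i2
    (Y := fun t ↦ U 0 + ∫ τ in (0 : ℝ)..t, W (-τ) (Φ τ + C (U τ)))
    (P := fun t ↦ V 0 + ∫ τ in (0 : ℝ)..t, W (-τ) (Γ τ - B (V τ))) (by simp) (by simp)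
  simp only [intervalIntegral.integral_same, add_zero] at ibp
  have hT' : T ∈ Icc 0 T := ⟨hT, le_rfl⟩
  rw [hU T hT', hV T hT', hW.inner_map_map, ← ibp]
  refine intervalIntegral.integral_congr fun t ht ↦ ?_
  rw [uIcc_of_le hT] at ht
  simp only [Function.comp_apply]
  have e1 : W (-t) (V t) = V 0 + ∫ τ in (0 : ℝ)..t, W (-τ) (Γ τ - B (V τ)) := by
    rw [hV t ht, ← hW.add, neg_add_cancel, hW.zero]
  have e2 : W (-t) (U t) = U 0 + ∫ τ in (0 : ℝ)..t, W (-τ) (Φ τ + C (U τ)) := by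
    rw [hU t ht, ← hW.add, neg_add_cancel, hW.zero]
  rw [← e1, ← e2, hW.inner_map_map, hW.inner_map_map, inner_add_left, inner_sub_right, hBC]
  ring

/-- Existence of mild solutions of `U' = R⁻¹ U + Φ + C U`. -/
theorem IsInverseGroup.exists_mild (hW : IsInverseGroup R W) {T : ℝ} (hT : 0 ≤ T)
    (C : X →L[ℝ] X) {Φ : ℝ → X} (hΦ : IntervalIntegrable Φ volume 0 T) (c : X) :
    ∃ U : ℝ → X, Continuous U ∧ U 0 = c ∧
      ∀ t ∈ Icc 0 T, U t = W t (c + ∫ τ in (0 : ℝ)..t, W (-τ) (Φ τ + C (U τ))) := by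
  have hi := hW.intervalIntegrable hΦ
  have hc : ContinuousOn (fun t ↦ c + ∫ τ in (0 : ℝ)..t, W (-τ) (Φ τ)) (Icc 0 T) := by
    have h1 := intervalIntegral.continuousOn_primitive_interval' hi
      (left_mem_uIcc : (0 : ℝ) ∈ uIcc 0 T)
    rw [uIcc_of_le hT] at h1
    exact continuousOn_const.add h1
  -- The unknown Y = W(-t)U satisfies a Volterra equation with the bounded, strongly continuous
  -- kernel W(-τ) C W(τ).
  have hP : ∀ x, Continuous fun t ↦ (W (-t) ∘L C ∘L W t) x := fun x ↦
    hW.continuous_uncurry.comp (continuous_neg.prodMk (C.continuous.comp (hW.cont x)))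
  obtain ⟨Y, hYc, hY⟩ := exists_volterra (P := fun t ↦ W (-t) ∘L C ∘L W t) (M := ‖C‖)
    (fun t x ↦ by
      change ‖W (-t) (C (W t x))‖ ≤ _
      rw [hW.norm_map]
      refine (C.le_opNorm _).trans ?_
      rw [hW.norm_map]) hP hT hc
  have hUc : Continuous fun t ↦ W t (Y t) := hW.continuous_uncurry.comp (continuous_id.prodMk hYc)
  refine ⟨fun t ↦ W t (Y t), hUc, ?_, fun t ht ↦ ?_⟩
  · have h := hY 0 ⟨le_rfl, hT⟩
    simp only [intervalIntegral.integral_same, add_zero] at h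
    simp only [hW.zero, h]
  · have hsub : uIcc 0 t ⊆ uIcc 0 T := by
      rw [uIcc_of_le ht.1, uIcc_of_le hT]
      exact Icc_subset_Icc_right ht.2
    have hi2 : Continuous fun τ ↦ W (-τ) (C (W τ (Y τ))) :=
      hW.continuous_uncurry.comp (continuous_neg.prodMk (C.continuous.comp hUc))
    have e : ∀ τ, W (-τ) (Φ τ + C (W τ (Y τ))) = W (-τ) (Φ τ) + W (-τ) (C (W τ (Y τ))) :=
      fun τ ↦ map_add _ _ _
    simp only [e]
    rw [intervalIntegral.integral_add (hi.mono_set hsub) (hi2.intervalIntegrable _ _), ← add_assoc]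
    exact congrArg (W t) (hY t ht)

/-- Existence for the evolution equation with vanishing final value, in integrated form. -/
theorem IsInverseGroup.exists_backward (hR : IsSkew R) (hW : IsInverseGroup R W) {T : ℝ}
    (hT : 0 ≤ T) (B : X →L[ℝ] X) {Γ : ℝ → X} (hΓ : IntervalIntegrable Γ volume 0 T) :
    ∃ V : ℝ → X, Continuous V ∧ V T = 0 ∧
      ∀ t ∈ Icc 0 T, R (V t) = R (V 0) + ∫ τ in (0 : ℝ)..t, (V τ + R (Γ τ - B (V τ))) := by
  -- Z(t) = V(T-t) starts from zero and satisfies Z' = -R⁻¹Z - Γ(T-t) + BZ, a forward equation for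
  -- the reversed group.
  have hΓ' : IntervalIntegrable (fun τ ↦ -Γ (T - τ)) volume 0 T := by
    have h : IntervalIntegrable (-fun τ ↦ Γ (T - τ)) volume 0 T := by
      simpa using (hΓ.comp_sub_left T).neg.symm
    exact h
  obtain ⟨Z, hZc, hZ0, hZ⟩ := hW.reverse.exists_mild hT B hΓ' 0
  have hBZ : Continuous fun τ ↦ B (Z τ) := B.continuous.comp hZc
  have hint := hW.reverse.integrated_of_mild hR.neg
    (hΓ'.add (hBZ.intervalIntegrable 0 T)) 0 hZ
  set V : ℝ → X := fun t ↦ Z (T - t) with hV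
  have hVc : Continuous V := hZc.comp (continuous_const.sub continuous_id)
  have hk : IntervalIntegrable (fun τ ↦ V τ + R (Γ τ - B (V τ))) volume 0 T := by
    have h1 := hΓ.sub ((B.continuous.comp hVc).intervalIntegrable 0 T)
    exact (hVc.intervalIntegrable 0 T).add ⟨R.integrable_comp h1.1, R.integrable_comp h1.2⟩
  have hRV : ∀ t ∈ Icc 0 T, R (V t) = -∫ τ in t..T, (V τ + R (Γ τ - B (V τ))) := by
    intro t ht
    have h1 := hint (T - t) ⟨sub_nonneg.2 ht.2, by linarith [ht.1]⟩
    have h2 := intervalIntegral.integral_comp_sub_left (a := 0) (b := T - t)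
      (fun τ ↦ V τ + R (Γ τ - B (V τ))) T
    rw [sub_sub_cancel, sub_zero] at h2
    rw [← h2]
    rw [map_zero, zero_add, neg_apply, neg_eq_iff_eq_neg] at h1
    rw [hV]
    simp only
    rw [h1]
    congr 1
    refine intervalIntegral.integral_congr fun s _ ↦ ?_
    simp only [sub_sub_cancel, neg_apply, map_add, map_neg, map_sub]
    abel
  refine ⟨V, hVc, by simp only [hV, sub_self, hZ0], fun t ht ↦ ?_⟩
  have hs1 : uIcc 0 t ⊆ uIcc 0 T := by
    rw [uIcc_of_le ht.1, uIcc_of_le hT]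
    exact Icc_subset_Icc_right ht.2
  have hs2 : uIcc t T ⊆ uIcc 0 T := by
    rw [uIcc_of_le ht.2, uIcc_of_le hT]
    exact Icc_subset_Icc_left ht.1
  rw [hRV t ht, hRV 0 ⟨le_rfl, hT⟩, ← intervalIntegral.integral_add_adjacent_intervals
    (hk.mono_set hs1) (hk.mono_set hs2)]
  abel

end Evolution

theorem intervalIntegrable_inner {X : Type*} [NormedAddCommGroup X] [InnerProductSpace ℝ X]
    {f g : ℝ → X} {a b : ℝ} (hf : IntervalIntegrable f volume a b)
    (hg : ContinuousOn g (uIcc a b)) :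
    IntervalIntegrable (fun t ↦ (inner ℝ (f t) (g t) : ℝ)) volume a b := by
  obtain ⟨C, hC⟩ := isCompact_uIcc.exists_bound_of_continuousOn hg
  refine (hf.norm.mul_const C).mono_fun ?_ ?_
  · exact hf.aestronglyMeasurable_restrict_uIoc.inner
      ((hg.mono uIoc_subset_uIcc).aestronglyMeasurable measurableSet_uIoc)
  · rw [EventuallyLE, ae_restrict_iff' measurableSet_uIoc]
    refine Eventually.of_forall fun t ht ↦ ?_
    rw [norm_mul, norm_norm]
    refine (norm_inner_le_norm _ _).trans (mul_le_mul_of_nonneg_left ?_ (norm_nonneg _))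
    exact (hC t (uIoc_subset_uIcc ht)).trans (le_abs_self C)

theorem intervalIntegral_clm {E F : Type*} [NormedAddCommGroup E] [NormedSpace ℝ E]
    [CompleteSpace E] [NormedAddCommGroup F] [NormedSpace ℝ F] [CompleteSpace F] (L : E →L[ℝ] F)
    {f : ℝ → E} {a b : ℝ} (hf : IntervalIntegrable f volume a b) :
    L (∫ t in a..b, f t) = ∫ t in a..b, L (f t) :=
  (L.intervalIntegral_comp_comm hf).symm

theorem intervalIntegrable_clm {E F : Type*} [NormedAddCommGroup E] [NormedSpace ℝ E]
    [NormedAddCommGroup F] [NormedSpace ℝ F] (L : E →L[ℝ] F)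
    {f : ℝ → E} {a b : ℝ} (hf : IntervalIntegrable f volume a b) :
    IntervalIntegrable (fun t ↦ L (f t)) volume a b :=
  ⟨L.integrable_comp hf.1, L.integrable_comp hf.2⟩

/-! ### The abstract wave equation and its transposed problem. -/

section Wave

variable {V H : Type*} [NormedAddCommGroup V] [InnerProductSpace ℝ V]
  [NormedAddCommGroup H] [InnerProductSpace ℝ H]

open ContinuousLinearMap (adjoint)

/-- The pair `(a, b)` in the Hilbert sum of `V` and `H`. -/
abbrev hpair (a : V) (b : H) : WithLp 2 (V × H) := WithLp.toLp 2 (a, b)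

/-- The first projection of a Hilbert sum. -/
def hfst : WithLp 2 (V × H) →L[ℝ] V :=
  ContinuousLinearMap.fst ℝ V H ∘L (WithLp.prodContinuousLinearEquiv 2 ℝ V H : _ →L[ℝ] V × H)

/-- The second projection of a Hilbert sum. -/
def hsnd : WithLp 2 (V × H) →L[ℝ] H :=
  ContinuousLinearMap.snd ℝ V H ∘L (WithLp.prodContinuousLinearEquiv 2 ℝ V H : _ →L[ℝ] V × H)

/-- A map into a Hilbert sum from its components. -/
def hprod {Z : Type*} [NormedAddCommGroup Z] [NormedSpace ℝ Z] (f : Z →L[ℝ] V) (g : Z →L[ℝ] H) :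
    Z →L[ℝ] WithLp 2 (V × H) :=
  ((WithLp.prodContinuousLinearEquiv 2 ℝ V H).symm : V × H →L[ℝ] _) ∘L f.prod g

theorem hpair_eta (x : WithLp 2 (V × H)) : hpair (hfst x) (hsnd x) = x := rfl

theorem inner_hpair (x y : WithLp 2 (V × H)) :
    inner ℝ x y = inner ℝ (hfst x) (hfst y) + (inner ℝ (hsnd x) (hsnd y) : ℝ) := by
  rw [WithLp.prod_inner_apply]; rfl

theorem hpair_ext {x y : WithLp 2 (V × H)} (h1 : hfst x = hfst y) (h2 : hsnd x = hsnd y) :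
    x = y := by
  rw [← hpair_eta x, ← hpair_eta y, h1, h2]

theorem continuous_hpair : Continuous fun z : V × H ↦ hpair z.1 z.2 :=
  (WithLp.prodContinuousLinearEquiv 2 ℝ V H).symm.continuous

theorem intervalIntegrable_hpair {f : ℝ → V} {g : ℝ → H} {a b : ℝ}
    (hf : IntervalIntegrable f volume a b) (hg : IntervalIntegrable g volume a b) :
    IntervalIntegrable (fun t ↦ hpair (f t) (g t)) volume a b := by
  have h := (intervalIntegrable_clm (hprod (.id ℝ V) (0 : V →L[ℝ] H)) hf).add
    (intervalIntegrable_clm (hprod (0 : H →L[ℝ] V) (.id ℝ H)) hg)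
  refine h.congr fun t _ ↦ ?_
  refine hpair_ext ?_ ?_
  · change f t + 0 = f t
    rw [add_zero]
  · change 0 + g t = g t
    rw [zero_add]

variable [CompleteSpace V] [CompleteSpace H]

/-- Solutions `v`, with velocity `y`, of `v'' + A v + Q v = G` on `[0, T]`, in time-integrated
form. Here `V` is embedded in `H` by `i`, and `A` is the operator associated with the inner
product of `V`. -/
structure IsWaveSolution (i Q : V →L[ℝ] H) (T : ℝ) (G : ℝ → H) (v : ℝ → V) (y : ℝ → H) :
    Prop where
  continuousOn_fst : ContinuousOn v (Icc 0 T)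
  continuousOn_snd : ContinuousOn y (Icc 0 T)
  position : ∀ t ∈ Icc 0 T, i (v t) = i (v 0) + ∫ τ in (0 : ℝ)..t, y τ
  velocity : ∀ t ∈ Icc 0 T, adjoint i (y t) = adjoint i (y 0)
    + ∫ τ in (0 : ℝ)..t, (adjoint i (G τ - Q (v τ)) - v τ)

/-- The inverse of the generator of the wave group on `V × H`. -/
def waveOp (i : V →L[ℝ] H) : WithLp 2 (V × H) →L[ℝ] WithLp 2 (V × H) :=
  hprod (-(adjoint i ∘L hsnd)) (i ∘L hfst)

theorem hfst_waveOp (i : V →L[ℝ] H) (x) : hfst (waveOp i x) = -adjoint i (hsnd x) := rfl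

theorem hsnd_waveOp (i : V →L[ℝ] H) (x) : hsnd (waveOp i x) = i (hfst x) := rfl

theorem isSkew_waveOp (i : V →L[ℝ] H) : IsSkew (waveOp i) := fun x y ↦ by
  rw [inner_hpair, inner_hpair, hfst_waveOp, hsnd_waveOp, hfst_waveOp, hsnd_waveOp,
    inner_neg_left, inner_neg_right, ContinuousLinearMap.adjoint_inner_left,
    ContinuousLinearMap.adjoint_inner_right]
  ring

/-- The two components use the two hypotheses: `i` is injective, and its adjoint is injective
because the range of `i` is dense. -/
theorem waveOp_injective {i : V →L[ℝ] H} (hi : Function.Injective i) (hd : DenseRange i) :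
    Function.Injective (waveOp i) := by
  rw [injective_iff_map_eq_zero]
  intro x hx
  have h1 : adjoint i (hsnd x) = 0 := by
    rw [← neg_eq_zero, ← hfst_waveOp, hx, map_zero]
  have h2 : i (hfst x) = 0 := by rw [← hsnd_waveOp, hx, map_zero]
  refine hpair_ext ?_ ?_
  · exact hi (by rw [h2, map_zero, map_zero])
  · rw [map_zero]
    refine hd.eq_zero_of_inner_left ℝ fun v ↦ ?_
    rw [← ContinuousLinearMap.adjoint_inner_left, h1, inner_zero_left]

/-- The perturbation `(v, y) ↦ (0, Q v)`. -/
def wavePert (Q : V →L[ℝ] H) : WithLp 2 (V × H) →L[ℝ] WithLp 2 (V × H) :=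
  hprod 0 (Q ∘L hfst)

/-- The adjoint of the perturbation `(v, y) ↦ (0, Q v)`. -/
def wavePertAdj (Q : V →L[ℝ] H) : WithLp 2 (V × H) →L[ℝ] WithLp 2 (V × H) :=
  hprod (adjoint Q ∘L hsnd) 0

theorem inner_wavePertAdj (Q : V →L[ℝ] H) (x y) :
    inner ℝ (wavePertAdj Q x) y = inner ℝ x (wavePert Q y) := by
  rw [inner_hpair, inner_hpair]
  change inner ℝ (adjoint Q (hsnd x)) (hfst y) + inner ℝ (0 : H) _
    = inner ℝ _ (0 : V) + inner ℝ (hsnd x) (Q (hfst y))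
  rw [inner_zero_left, inner_zero_right, ContinuousLinearMap.adjoint_inner_left, add_zero, zero_add]

/-- Solvability of the backward wave equation. -/
theorem exists_backward_waveSolution {i : V →L[ℝ] H} (hi : Function.Injective i)
    (hd : DenseRange i) (Q : V →L[ℝ] H) {T : ℝ} (hT : 0 ≤ T) {G : ℝ → H}
    (hG : IntervalIntegrable G volume 0 T) :
    ∃ v y, IsWaveSolution i Q T G v y ∧ v T = 0 ∧ y T = 0 := by
  have hR := isSkew_waveOp i
  obtain ⟨W, hW⟩ := hR.exists_group (waveOp_injective hi hd)
  have hΓ := intervalIntegrable_hpair (V := V) (IntervalIntegrable.zero (a := 0) (b := T)) hG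
  obtain ⟨Z, hZc, hZT, hZ⟩ := hW.exists_backward hR hT (wavePert Q) hΓ
  have hk : ∀ t ∈ Icc 0 T, IntervalIntegrable (fun τ ↦ Z τ
      + waveOp i (hpair ((0 : ℝ → V) τ) (G τ) - wavePert Q (Z τ))) volume 0 t := fun t ht ↦ by
    have hsub : uIcc 0 t ⊆ uIcc 0 T := by
      rw [uIcc_of_le ht.1, uIcc_of_le hT]
      exact Icc_subset_Icc_right ht.2
    exact (hZc.intervalIntegrable _ _).add (intervalIntegrable_clm _ ((hΓ.mono_set hsub).sub
      (((wavePert Q).continuous.comp hZc).intervalIntegrable _ _)))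
  refine ⟨fun t ↦ hfst (Z t), fun t ↦ hsnd (Z t), ⟨(hfst.continuous.comp hZc).continuousOn,
    (hsnd.continuous.comp hZc).continuousOn, fun t ht ↦ ?_, fun t ht ↦ ?_⟩, ?_, ?_⟩
  · have h := congrArg hsnd (hZ t ht)
    rw [map_add, intervalIntegral_clm hsnd (hk t ht), hsnd_waveOp, hsnd_waveOp] at h
    rw [h]
    congr 1
    refine intervalIntegral.integral_congr fun τ _ ↦ ?_
    simp only [map_add, hsnd_waveOp, map_sub]
    change hsnd (Z τ) + (i 0 - i 0) = _
    rw [sub_self, add_zero]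
  · have h := congrArg hfst (hZ t ht)
    rw [map_add, intervalIntegral_clm hfst (hk t ht), hfst_waveOp, hfst_waveOp,
      neg_eq_iff_eq_neg, neg_add, neg_neg, ← intervalIntegral.integral_neg] at h
    rw [h]
    congr 1
    refine intervalIntegral.integral_congr fun τ _ ↦ ?_
    simp only [map_add, hfst_waveOp, map_sub]
    change -(hfst (Z τ) + (-adjoint i (G τ) - -adjoint i (Q (hfst (Z τ))))) = _
    abel
  · simp only [hZT, map_zero]
  · simp only [hZT, map_zero]

/-- Solvability of the wave equation with data in `H × V*`, in the sense of transposition. -/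
theorem exists_transposition_waveSolution {i : V →L[ℝ] H} (hi : Function.Injective i)
    (hd : DenseRange i) (Q : V →L[ℝ] H) {T : ℝ} (hT : 0 ≤ T) {F : ℝ → V}
    (hF : IntervalIntegrable F volume 0 T) (u₀ : H) (z₁ : V) :
    ∃ (u : ℝ → H) (z : ℝ → V), Continuous u ∧ Continuous z ∧
      (∀ t ∈ Icc 0 T, adjoint i (u t) = adjoint i (u 0) + ∫ τ in (0 : ℝ)..t, z τ) ∧
      ∀ G v y, IntervalIntegrable G volume 0 T → IsWaveSolution i Q T G v y → v T = 0 →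
        y T = 0 → ∫ t in (0 : ℝ)..T, (inner ℝ (u t) (G t) : ℝ)
          = (∫ t in (0 : ℝ)..T, inner ℝ (F t) (v t)) + inner ℝ z₁ (v 0) - inner ℝ u₀ (y 0) := by
  have hR := isSkew_waveOp i
  have hinj := waveOp_injective hi hd
  obtain ⟨W, hW⟩ := hR.exists_group hinj
  have hΦ := intervalIntegrable_hpair (H := H) hF (IntervalIntegrable.zero (a := 0) (b := T))
  -- U stands for (z,-u), where z represents the velocity of u in V*. The sign makes the first
  -- component of the integrated equation read i*u = i*u₀ + ∫z.
  obtain ⟨U, hUc, hU0, hU⟩ := hW.exists_mild hT (wavePertAdj Q) hΦ (hpair z₁ (-u₀))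
  have hUi : IntervalIntegrable (fun τ ↦ hpair (F τ) ((0 : ℝ → H) τ) + wavePertAdj Q (U τ))
      volume 0 T :=
    hΦ.add (((wavePertAdj Q).continuous.comp hUc).intervalIntegrable _ _)
  have hint := hW.integrated_of_mild hR hUi (hpair z₁ (-u₀)) hU
  rw [← hU0] at hU hint
  have hsub : ∀ t ∈ Icc 0 T, uIcc 0 t ⊆ uIcc 0 T := fun t ht ↦ by
    rw [uIcc_of_le ht.1, uIcc_of_le hT]
    exact Icc_subset_Icc_right ht.2
  refine ⟨fun t ↦ -hsnd (U t), fun t ↦ hfst (U t), (hsnd.continuous.comp hUc).neg,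
    hfst.continuous.comp hUc, fun t ht ↦ ?_, fun G v y hG hv hvT hyT ↦ ?_⟩
  · have h := congrArg hfst (hint t ht)
    rw [map_add, intervalIntegral_clm hfst ((hUc.intervalIntegrable _ _).add
      (intervalIntegrable_clm _ (hUi.mono_set (hsub t ht)))), hfst_waveOp, hfst_waveOp] at h
    rw [map_neg, map_neg, h]
    congr 1
    refine intervalIntegral.integral_congr fun τ _ ↦ ?_
    simp only [map_add, hfst_waveOp]
    change hfst (U τ) + (-adjoint i 0 + -adjoint i 0) = _
    rw [map_zero, neg_zero, add_zero, add_zero]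
  · have hΓ := intervalIntegrable_hpair (V := V) (IntervalIntegrable.zero (a := 0) (b := T)) hG
    let Z : ℝ → WithLp 2 (V × H) := fun t ↦ hpair (v t) (y t)
    have hZc : ContinuousOn Z (Icc 0 T) :=
      continuous_hpair.comp_continuousOn (hv.continuousOn_fst.prodMk hv.continuousOn_snd)
    have hg : IntervalIntegrable (fun τ ↦ hpair ((0 : ℝ → V) τ) (G τ) - wavePert Q (Z τ))
        volume 0 T := by
      refine hΓ.sub (ContinuousOn.intervalIntegrable ?_)
      rw [uIcc_of_le hT]
      exact (wavePert Q).continuous.comp_continuousOn hZc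
    have hZi : ∀ t ∈ Icc 0 T, waveOp i (Z t) = waveOp i (Z 0) + ∫ τ in (0 : ℝ)..t, (Z τ
        + waveOp i (hpair ((0 : ℝ → V) τ) (G τ) - wavePert Q (Z τ))) := by
      intro t ht
      have hk : IntervalIntegrable (fun τ ↦ Z τ
          + waveOp i (hpair ((0 : ℝ → V) τ) (G τ) - wavePert Q (Z τ))) volume 0 t := by
        refine (ContinuousOn.intervalIntegrable (hZc.mono ?_)).add
          (intervalIntegrable_clm _ (hg.mono_set (hsub t ht)))
        rw [← uIcc_of_le hT]
        exact hsub t ht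
      refine hpair_ext ?_ ?_
      · rw [map_add, intervalIntegral_clm hfst hk, hfst_waveOp, hfst_waveOp]
        change -adjoint i (y t) = -adjoint i (y 0) + _
        rw [hv.velocity t ht, neg_add, ← intervalIntegral.integral_neg]
        congr 1
        refine intervalIntegral.integral_congr fun τ _ ↦ ?_
        simp only [map_add, hfst_waveOp, map_sub]
        change _ = v τ + (-adjoint i (G τ) - -adjoint i (Q (v τ)))
        abel
      · rw [map_add, intervalIntegral_clm hsnd hk, hsnd_waveOp, hsnd_waveOp]
        change i (v t) = i (v 0) + _
        rw [hv.position t ht]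
        congr 1
        refine intervalIntegral.integral_congr fun τ _ ↦ ?_
        simp only [map_add, hsnd_waveOp, map_sub]
        change _ = y τ + (i 0 - i 0)
        rw [sub_self, add_zero]
    -- The test solution is arbitrary, not one constructed from the group, so its integrated
    -- equation must first be turned into Duhamel's formula before duality applies.
    have hZ := hW.mild_of_integrated hR hinj hg hZc hZi
    have hdual := hW.duality hT (inner_wavePertAdj Q) hΦ hΓ hUc.continuousOn hZc hU hZ
    have hZT : Z T = 0 := by
      refine hpair_ext ?_ ?_
      · exact hvT
      · exact hyT
    have e1 : ∀ τ, inner ℝ (hpair (F τ) ((0 : ℝ → H) τ)) (Z τ)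
        + inner ℝ (U τ) (hpair ((0 : ℝ → V) τ) (G τ))
        = inner ℝ (F τ) (v τ) - inner ℝ (-hsnd (U τ)) (G τ) := fun τ ↦ by
      rw [inner_hpair, inner_hpair]
      change inner ℝ (F τ) (v τ) + inner ℝ (0 : H) _ + (inner ℝ _ (0 : V)
        + inner ℝ (hsnd (U τ)) (G τ)) = _
      rw [inner_zero_left, inner_zero_right, inner_neg_left]
      ring
    have e2 : inner ℝ (U 0) (Z 0) = inner ℝ z₁ (v 0) - inner ℝ u₀ (y 0) := by
      rw [hU0, inner_hpair, sub_eq_add_neg, ← inner_neg_left]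
      rfl
    have i1 : IntervalIntegrable (fun t ↦ (inner ℝ (F t) (v t) : ℝ)) volume 0 T :=
      intervalIntegrable_inner hF (by rw [uIcc_of_le hT]; exact hv.continuousOn_fst)
    have i2 : IntervalIntegrable (fun t ↦ (inner ℝ (-hsnd (U t)) (G t) : ℝ)) volume 0 T := by
      have := intervalIntegrable_inner hG (hsnd.continuous.comp hUc).neg.continuousOn
      refine this.congr fun t _ ↦ ?_
      exact real_inner_comm _ _
    simp only [e1] at hdual
    rw [intervalIntegral.integral_sub i1 i2, hZT, inner_zero_right, e2] at hdual
    linarith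

end Wave

/-! ### Replacing a norm by an equivalent Hilbert norm. -/

section GraphSpace

variable {E V H : Type*} [NormedAddCommGroup E] [NormedSpace ℝ E]
  [NormedAddCommGroup V] [InnerProductSpace ℝ V] [NormedAddCommGroup H] [InnerProductSpace ℝ H]

/-- The range of `v ↦ (f v, g v)` with the inner product `⟨f v, f w⟩ + ⟨g v, g w⟩`. -/
def GraphSpace (f : E →L[ℝ] V) (g : E →L[ℝ] H) : Type _ := (hprod f g).range

instance (f : E →L[ℝ] V) (g : E →L[ℝ] H) : NormedAddCommGroup (GraphSpace f g) :=
  inferInstanceAs (NormedAddCommGroup (hprod f g).range)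

instance (f : E →L[ℝ] V) (g : E →L[ℝ] H) : InnerProductSpace ℝ (GraphSpace f g) :=
  inferInstanceAs (InnerProductSpace ℝ (hprod f g).range)

/-- This lower bound makes the range of (f,g) closed, hence a Hilbert space isomorphic to `E`. -/
theorem hprod_antilipschitz {f : E →L[ℝ] V} {g : E →L[ℝ] H} {C : ℝ≥0}
    (h : ∀ v, ‖v‖ ≤ C * (‖f v‖ + ‖g v‖)) : AntilipschitzWith (C * 2) (hprod f g) := by
  refine ContinuousLinearMap.antilipschitz_of_bound _ fun v ↦ (h v).trans ?_
  have h1 := WithLp.prod_norm_sq_eq_of_L2 (hprod f g v)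
  have h2 : ‖f v‖ ≤ ‖hprod f g v‖ := by
    refine abs_le_of_sq_le_sq' ?_ (norm_nonneg _) |>.2
    rw [h1]
    exact le_add_of_nonneg_right (sq_nonneg _)
  have h3 : ‖g v‖ ≤ ‖hprod f g v‖ := by
    refine abs_le_of_sq_le_sq' ?_ (norm_nonneg _) |>.2
    rw [h1]
    exact le_add_of_nonneg_left (sq_nonneg _)
  push_cast
  rw [mul_assoc]
  exact mul_le_mul_of_nonneg_left (by linarith) C.2

variable [CompleteSpace E]

theorem isClosed_range_hprod {f : E →L[ℝ] V} {g : E →L[ℝ] H} {C : ℝ≥0}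
    (h : ∀ v, ‖v‖ ≤ C * (‖f v‖ + ‖g v‖)) :
    IsClosed ((hprod f g).range : Set (WithLp 2 (V × H))) :=
  (hprod_antilipschitz h).isClosed_range (hprod f g).uniformContinuous

variable [CompleteSpace V] [CompleteSpace H]

theorem GraphSpace.completeSpace {f : E →L[ℝ] V} {g : E →L[ℝ] H} {C : ℝ≥0}
    (h : ∀ v, ‖v‖ ≤ C * (‖f v‖ + ‖g v‖)) : CompleteSpace (GraphSpace f g) :=
  (isClosed_range_hprod h).completeSpace_coe

/-- The identification of the domain of `(f, g)` with its range. -/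
def GraphSpace.equiv {f : E →L[ℝ] V} {g : E →L[ℝ] H} {C : ℝ≥0}
    (h : ∀ v, ‖v‖ ≤ C * (‖f v‖ + ‖g v‖)) : E ≃L[ℝ] GraphSpace f g :=
  (hprod f g).equivRange (hprod_antilipschitz h).injective (isClosed_range_hprod h)

theorem GraphSpace.inner_equiv {f : E →L[ℝ] V} {g : E →L[ℝ] H} {C : ℝ≥0}
    (h : ∀ v, ‖v‖ ≤ C * (‖f v‖ + ‖g v‖)) (v w : E) :
    (inner ℝ (GraphSpace.equiv h v) (GraphSpace.equiv h w) : ℝ)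
      = inner ℝ (f v) (f w) + inner ℝ (g v) (g w) :=
  inner_hpair (hprod f g v) (hprod f g w)

end GraphSpace

/-! ### Completeness of Hˢ, the energy space, and density of the inclusion. -/

section Sobolev

variable {n : ℕ} {s : ℝ≥0}

theorem memLp_bddMul {m : EuclideanSpace ℝ (Fin n) → ℝ} (hm : Measurable m)
    (hb : ∀ ξ, |m ξ| ≤ 1) (u : L2C n) : MemLp (fun ξ ↦ m ξ • u ξ) 2 volume := by
  refine (Lp.memLp u).mono (hm.aestronglyMeasurable.smul (Lp.aestronglyMeasurable u))
    (Eventually.of_forall fun ξ ↦ ?_)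
  rw [norm_smul, Real.norm_eq_abs]
  exact mul_le_of_le_one_left (norm_nonneg _) (hb ξ)

/-- Multiplication by a measurable function bounded by one. -/
def bddMul (m : EuclideanSpace ℝ (Fin n) → ℝ) (hm : Measurable m) (hb : ∀ ξ, |m ξ| ≤ 1) :
    L2C n →L[ℝ] L2C n :=
  LinearMap.mkContinuous
    { toFun := fun u ↦ (memLp_bddMul hm hb u).toLp _
      map_add' := fun u v ↦ by
        rw [← MemLp.toLp_add]
        refine MemLp.toLp_congr _ _ ?_
        filter_upwards [Lp.coeFn_add u v] with ξ h
        rw [h, Pi.add_apply, Pi.add_apply, smul_add]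
      map_smul' := fun c u ↦ by
        rw [RingHom.id_apply, ← MemLp.toLp_const_smul]
        refine MemLp.toLp_congr _ _ ?_
        filter_upwards [Lp.coeFn_smul c u] with ξ h
        rw [h, Pi.smul_apply, Pi.smul_apply, smul_comm] } 1 fun u ↦ by
    rw [one_mul]
    refine Lp.norm_le_norm_of_ae_le ?_
    filter_upwards [(memLp_bddMul hm hb u).coeFn_toLp] with ξ h
    refine (congrArg norm h).le.trans ?_
    rw [norm_smul, Real.norm_eq_abs]
    exact mul_le_of_le_one_left (norm_nonneg _) (hb ξ)

theorem coeFn_bddMul {m : EuclideanSpace ℝ (Fin n) → ℝ} (hm : Measurable m)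
    (hb : ∀ ξ, |m ξ| ≤ 1) (u : L2C n) : bddMul m hm hb u =ᵐ[volume] fun ξ ↦ m ξ • u ξ :=
  (memLp_bddMul hm hb u).coeFn_toLp

theorem measurable_besselSymbol : Measurable (besselSymbol s : EuclideanSpace ℝ (Fin n) → ℝ) := by
  unfold besselSymbol
  fun_prop

theorem measurable_fracSymbol : Measurable (fracSymbol s : EuclideanSpace ℝ (Fin n) → ℝ) := by
  unfold fracSymbol
  fun_prop

theorem besselSymbol_pos (ξ : EuclideanSpace ℝ (Fin n)) : 0 < besselSymbol s ξ :=
  zero_lt_one.trans_le (one_le_besselSymbol s ξ)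

theorem fracSymbol_nonneg (ξ : EuclideanSpace ℝ (Fin n)) : 0 ≤ fracSymbol s ξ := by
  unfold fracSymbol; positivity

theorem coeFn_besselLin (u : Sobolev n s) : Sobolev.besselLin n s u
    =ᵐ[volume] fun ξ ↦ besselSymbol s ξ • fourierL2 n (Sobolev.toL2 n s u) ξ :=
  (Sobolev.memLp_bessel u).coeFn_toLp

theorem Sobolev.isometry_besselLin : Isometry (Sobolev.besselLin n s) :=
  AddMonoidHomClass.isometry_of_norm _ fun _ ↦ rfl

theorem isClosed_range_fourierL2 : IsClosed (range (fourierL2 n)) :=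
  (AddMonoidHomClass.isometry_of_norm (fourierL2 n)
    norm_fourierL2).isClosedEmbedding.isClosed_range

instance : CompleteSpace (Sobolev n s) := by
  have hinv : ∀ ξ : EuclideanSpace ℝ (Fin n), |(besselSymbol s ξ)⁻¹| ≤ 1 := fun ξ ↦ by
    rw [abs_of_pos (inv_pos.2 (besselSymbol_pos ξ))]
    exact inv_le_one_of_one_le₀ (one_le_besselSymbol s ξ)
  let L : L2C n →L[ℝ] L2C n :=
    bddMul (fun ξ ↦ (besselSymbol s ξ)⁻¹) measurable_besselSymbol.inv hinv
  have hL : ∀ g, L g =ᵐ[volume] fun ξ ↦ (besselSymbol s ξ)⁻¹ • g ξ := fun g ↦ coeFn_bddMul _ _ g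
  -- The image of Hˢ under ⟨ξ⟩ˢû consists of those g for which ⟨ξ⟩⁻ˢg is the transform of a real
  -- function. It is closed, as a preimage of the range of an isometry.
  have hrange : range (Sobolev.besselLin n s) = L ⁻¹' range (fourierL2 n) := by
    ext g
    constructor
    · rintro ⟨u, rfl⟩
      refine ⟨Sobolev.toL2 n s u, ?_⟩
      refine Lp.ext ?_
      filter_upwards [hL (Sobolev.besselLin n s u),
        coeFn_besselLin u] with ξ h1 h2
      rw [h1, h2, smul_smul, inv_mul_cancel₀ (besselSymbol_pos ξ).ne', one_smul]
    · rintro ⟨u, hu⟩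
      have h : (fun ξ ↦ besselSymbol s ξ • fourierL2 n u ξ) =ᵐ[volume] g := by
        filter_upwards [hL g] with ξ h1
        rw [hu, h1, smul_smul, mul_inv_cancel₀ (besselSymbol_pos ξ).ne', one_smul]
      let v : Sobolev n s := ⟨u, (Lp.memLp g).ae_eq h.symm⟩
      exact ⟨v, Lp.ext ((coeFn_besselLin v).trans h)⟩
  have hcl : IsClosed (range (Sobolev.besselLin n s)) := by
    rw [hrange]
    exact isClosed_range_fourierL2.preimage L.continuous
  rw [completeSpace_iff_isComplete_range Sobolev.isometry_besselLin.isUniformInducing]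
  exact hcl.isComplete

theorem abs_fracSymbol_div_besselSymbol_le (ξ : EuclideanSpace ℝ (Fin n)) :
    |fracSymbol s ξ / besselSymbol s ξ| ≤ 1 := by
  rw [abs_of_nonneg (div_nonneg (fracSymbol_nonneg ξ) (besselSymbol_pos ξ).le)]
  exact div_le_one_of_le₀ (fracSymbol_le_besselSymbol s ξ) (besselSymbol_pos ξ).le

/-- The Fourier transform `|ξ|ˢ û` of `(-Δ)^(s/2) u`. -/
def fracCLM (n : ℕ) (s : ℝ≥0) : Sobolev n s →L[ℝ] L2C n :=
  bddMul (fun ξ ↦ fracSymbol s ξ / besselSymbol s ξ)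
    (measurable_fracSymbol.div measurable_besselSymbol) abs_fracSymbol_div_besselSymbol_le ∘L
  (Sobolev.besselLin n s).mkContinuous 1 fun u ↦ by rw [one_mul]; rfl

theorem coeFn_fracCLM (u : Sobolev n s) : fracCLM n s u
    =ᵐ[volume] fun ξ ↦ fracSymbol s ξ • fourierL2 n (Sobolev.toL2 n s u) ξ := by
  refine (coeFn_bddMul (measurable_fracSymbol.div measurable_besselSymbol)
    abs_fracSymbol_div_besselSymbol_le (Sobolev.besselLin n s u)).trans ?_
  filter_upwards [coeFn_besselLin u] with ξ h
  rw [h, smul_smul, Pi.div_apply, div_mul_cancel₀ _ (besselSymbol_pos ξ).ne']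

theorem fracLaplacianHalf_eq (u : Sobolev n s) :
    Sobolev.fracLaplacianHalf u = 𝓕⁻ (fracCLM n s u) := by
  unfold Sobolev.fracLaplacianHalf
  congr 1
  exact Lp.ext ((Sobolev.memLp_frac u).coeFn_toLp.trans (coeFn_fracCLM u).symm)

theorem re_inner_fracLaplacianHalf (u v : Sobolev n s) :
    (inner ℂ (Sobolev.fracLaplacianHalf u) (Sobolev.fracLaplacianHalf v)).re
      = inner ℝ (fracCLM n s u) (fracCLM n s v) := by
  rw [fracLaplacianHalf_eq, fracLaplacianHalf_eq]
  have h : inner ℂ (𝓕⁻ (fracCLM n s u)) (𝓕⁻ (fracCLM n s v))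
      = inner ℂ (fracCLM n s u) (fracCLM n s v) :=
    (Lp.fourierTransformₗᵢ (EuclideanSpace ℝ (Fin n)) ℂ).symm.inner_map_map _ _
  rw [h, L2.inner_def, L2.inner_def, ← RCLike.re_eq_complex_re, ← integral_re
    (L2.integrable_inner _ _)]
  refine integral_congr_ae (Eventually.of_forall fun ξ ↦ ?_)
  simp only [RCLike.inner_apply, Complex.inner, RCLike.re_eq_complex_re]

theorem besselSymbol_le (ξ : EuclideanSpace ℝ (Fin n)) :
    besselSymbol s ξ ≤ (2 : ℝ) ^ ((s : ℝ) / 2) * (1 + fracSymbol s ξ) := by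
  unfold besselSymbol fracSymbol
  set r := ‖(2 * Real.pi) • ξ‖
  have hr : 0 ≤ r := norm_nonneg _
  have hs : 0 ≤ (s : ℝ) / 2 := by positivity
  have hrs : r ^ (s : ℝ) = (r ^ 2) ^ ((s : ℝ) / 2) := by
    rw [← Real.rpow_natCast, ← Real.rpow_mul hr]
    congr 1
    push_cast
    ring
  have h0 : 0 ≤ r ^ (s : ℝ) := by positivity
  rcases le_total r 1 with h | h
  · calc (1 + r ^ 2) ^ ((s : ℝ) / 2) ≤ (2 : ℝ) ^ ((s : ℝ) / 2) :=
        Real.rpow_le_rpow (by positivity) (by nlinarith) hs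
      _ ≤ _ := le_mul_of_one_le_right (by positivity) (by linarith)
  · calc (1 + r ^ 2) ^ ((s : ℝ) / 2) ≤ (2 * r ^ 2) ^ ((s : ℝ) / 2) :=
        Real.rpow_le_rpow (by positivity) (by nlinarith) hs
      _ = (2 : ℝ) ^ ((s : ℝ) / 2) * r ^ (s : ℝ) := by
        rw [Real.mul_rpow (by norm_num) (by positivity), hrs]
      _ ≤ _ := mul_le_mul_of_nonneg_left (by linarith) (by positivity)

theorem Sobolev.norm_le (u : Sobolev n s) :
    ‖u‖ ≤ (2 : ℝ) ^ ((s : ℝ) / 2) * (‖Sobolev.toL2 n s u‖ + ‖fracCLM n s u‖) := by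
  have h1 : ‖Sobolev.besselLin n s u‖ ≤ (2 : ℝ) ^ ((s : ℝ) / 2)
      * ‖fourierL2 n (Sobolev.toL2 n s u) + fracCLM n s u‖ := by
    refine Lp.norm_le_mul_norm_of_ae_le_mul ?_
    filter_upwards [coeFn_besselLin u, coeFn_fracCLM u,
      Lp.coeFn_add (fourierL2 n (Sobolev.toL2 n s u)) (fracCLM n s u)] with ξ h1 h2 h3
    have e : fourierL2 n (Sobolev.toL2 n s u) ξ + fracSymbol s ξ
        • fourierL2 n (Sobolev.toL2 n s u) ξ
        = (1 + fracSymbol s ξ) • fourierL2 n (Sobolev.toL2 n s u) ξ := by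
      rw [add_smul, one_smul]
    have h4 := fracSymbol_nonneg (s := s) ξ
    rw [h1, h3, Pi.add_apply, h2, e, norm_smul, norm_smul,
      Real.norm_of_nonneg (besselSymbol_pos ξ).le, Real.norm_of_nonneg (by linarith), ← mul_assoc]
    exact mul_le_mul_of_nonneg_right (besselSymbol_le ξ) (norm_nonneg _)
  refine h1.trans (mul_le_mul_of_nonneg_left ?_ (by positivity))
  refine (norm_add_le _ _).trans ?_
  rw [norm_fourierL2]

variable {Ω : Set (EuclideanSpace ℝ (Fin n))}

/-- The part `|ξ|ˢ v̂` of the energy. -/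
def fracIncl (s : ℝ≥0) (Ω : Set (EuclideanSpace ℝ (Fin n))) : HTilde s Ω →L[ℝ] L2C n :=
  fracCLM n s ∘L (HTilde s Ω).subtypeL

theorem HTilde.norm_le (v : HTilde s Ω) : ‖v‖ ≤
    (⟨(2 : ℝ) ^ ((s : ℝ) / 2), by positivity⟩ : ℝ≥0) * (‖HTilde.incl s Ω v‖ + ‖fracIncl s Ω v‖) :=
  Sobolev.norm_le (v : Sobolev n s)

/-- The energy space: `H̃ˢ(Ω)` with the inner product
`⟨v, w⟩_{L²} + ⟨(-Δ)^(s/2) v, (-Δ)^(s/2) w⟩_{L²}`. -/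
abbrev EnergySpace (s : ℝ≥0) (Ω : Set (EuclideanSpace ℝ (Fin n))) : Type :=
  GraphSpace (HTilde.incl s Ω) (fracIncl s Ω)

instance : CompleteSpace (EnergySpace s Ω) := GraphSpace.completeSpace HTilde.norm_le

/-- The identification of `H̃ˢ(Ω)` with the energy space. -/
def energyEquiv (s : ℝ≥0) (Ω : Set (EuclideanSpace ℝ (Fin n))) :
    HTilde s Ω ≃L[ℝ] EnergySpace s Ω :=
  GraphSpace.equiv HTilde.norm_le

theorem inner_energyEquiv (v w : HTilde s Ω) :
    inner ℝ (energyEquiv s Ω v) (energyEquiv s Ω w)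
      = inner ℝ (HTilde.incl s Ω v) (HTilde.incl s Ω w)
        + (inner ℂ (Sobolev.fracLaplacianHalf (v : Sobolev n s))
            (Sobolev.fracLaplacianHalf (w : Sobolev n s))).re := by
  rw [re_inner_fracLaplacianHalf]
  exact GraphSpace.inner_equiv HTilde.norm_le v w

/-- The inclusion of the energy space in `L̃²(Ω)`. -/
def energyIncl (s : ℝ≥0) (Ω : Set (EuclideanSpace ℝ (Fin n))) :
    EnergySpace s Ω →L[ℝ] LTilde Ω :=
  HTilde.incl s Ω ∘L ((energyEquiv s Ω).symm : EnergySpace s Ω →L[ℝ] HTilde s Ω)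

theorem energyIncl_energyEquiv (v : HTilde s Ω) :
    energyIncl s Ω (energyEquiv s Ω v) = HTilde.incl s Ω v :=
  congrArg (HTilde.incl s Ω) ((energyEquiv s Ω).symm_apply_apply v)

theorem HTilde.incl_injective : Function.Injective (HTilde.incl s Ω) := fun v w h ↦ by
  have h1 := congrArg (Subtype.val : LTilde Ω → L2R n) h
  exact Subtype.ext (Subtype.ext h1)

theorem energyIncl_injective : Function.Injective (energyIncl s Ω) :=
  HTilde.incl_injective.comp (energyEquiv s Ω).symm.injective

/-- Test functions are Schwartz, hence so are their transforms, and the Bessel symbol has temperate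
growth. This is what makes H̃ˢ(Ω) dense in L̃²(Ω). -/
theorem testFunctions_mem_sobolev {u : L2R n} (hu : u ∈ testFunctions Ω) :
    u ∈ sobolevSubmodule n s := by
  obtain ⟨φ, hφ, hφc, -, huφ⟩ := hu
  have h1 : HasCompactSupport (fun x ↦ (φ x : ℂ)) := hφc.comp_left (g := Complex.ofReal) rfl
  have h2 : ContDiff ℝ ∞ (fun x ↦ (φ x : ℂ)) := Complex.ofRealCLM.contDiff.comp hφ
  let f : SchwartzMap (EuclideanSpace ℝ (Fin n)) ℂ := h1.toSchwartzMap h2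
  have e1 : Complex.ofRealCLM.compLpL 2 volume u = f.toLp 2 := by
    refine Lp.ext ?_
    filter_upwards [Complex.ofRealCLM.coeFn_compLpL (p := 2) (μ := volume) u,
      f.coeFn_toLp 2 volume, huφ] with x h1 h2 h3
    rw [h1, h2, h3]
    rfl
  have e2 : fourierL2 n u = (𝓕 f).toLp 2 := by
    rw [← SchwartzMap.toLp_fourier_eq, ← e1]
    rfl
  have hg : Function.HasTemperateGrowth (fun ξ : EuclideanSpace ℝ (Fin n) ↦ besselSymbol s ξ) := by
    exact (Function.hasTemperateGrowth_one_add_norm_sq_rpow _ ((s : ℝ) / 2)).comp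
      ((2 * Real.pi) • ContinuousLinearMap.id ℝ (EuclideanSpace ℝ (Fin n))).hasTemperateGrowth
  change MemLp (fun ξ ↦ besselSymbol s ξ • fourierL2 n u ξ) 2 volume
  refine ((SchwartzMap.smulLeftCLM ℂ (fun ξ ↦ besselSymbol s ξ) (𝓕 f)).memLp 2 volume).ae_eq ?_
  filter_upwards [(𝓕 f).coeFn_toLp 2 volume] with ξ h
  rw [e2, h, SchwartzMap.smulLeftCLM_apply_apply hg]

theorem denseRange_incl : DenseRange (HTilde.incl s Ω) := by
  rw [Metric.denseRange_iff]
  rintro ⟨x, hx⟩ ε hε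
  obtain ⟨u, hu, hux⟩ := Metric.mem_closure_iff.1 hx ε hε
  let v : Sobolev n s := ⟨u, testFunctions_mem_sobolev hu⟩
  exact ⟨⟨v, subset_closure hu⟩, hux⟩

theorem denseRange_energyIncl : DenseRange (energyIncl s Ω) := by
  have h := (denseRange_incl (s := s) (Ω := Ω)).comp
    (energyEquiv s Ω).symm.surjective.denseRange (HTilde.incl s Ω).continuous
  exact h

end Sobolev

/-! ### Integrable transforms and low-frequency bounds. -/

section Embedding

variable {n : ℕ}

/-- The inverse Fourier transform of an `L² ∩ L¹` function is given by the integral formula. -/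
theorem coeFn_fourierInv_of_integrable (g : L2C n) (hg : Integrable g) :
    (𝓕⁻ g : L2C n) =ᵐ[volume] (𝓕⁻ (g : EuclideanSpace ℝ (Fin n) → ℂ)) := by
  set h : EuclideanSpace ℝ (Fin n) → ℂ := 𝓕⁻ (g : EuclideanSpace ℝ (Fin n) → ℂ) with hh
  have hcont : Continuous h := by
    have h1 := Real.Lp.fourierTransformInv_toLp (memLp_one_iff_integrable.2 hg)
    rw [hh, ← h1]
    exact BoundedContinuousFunction.continuous _
  have hl1 : LocallyIntegrable (𝓕⁻ g : L2C n) volume :=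
    (Lp.memLp (𝓕⁻ g : L2C n)).locallyIntegrable (by norm_num)
  -- Both candidates pair equally with every test function: the L² transform because it agrees with
  -- the distributional one, the integral formula by Fubini.
  have key := ae_eq_zero_of_integral_contDiff_smul_eq_zero (μ := volume)
    (f := fun x ↦ (𝓕⁻ g : L2C n) x - h x) (hl1.sub hcont.locallyIntegrable) (by
      intro η hη hηc
      have hη1 : HasCompactSupport (Complex.ofRealCLM ∘ η) := hηc.comp_left rfl
      have hη2 : ContDiff ℝ ∞ (Complex.ofRealCLM ∘ η) := by fun_prop
      let φ : SchwartzMap (EuclideanSpace ℝ (Fin n)) ℂ := hη1.toSchwartzMap hη2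
      have e1 := DFunLike.congr_fun (Lp.fourierInv_toTemperedDistribution_eq g) φ
      rw [TemperedDistribution.fourierInv_apply, Lp.toTemperedDistribution_apply,
        Lp.toTemperedDistribution_apply, SchwartzMap.fourierInv_coe] at e1
      have hflip : (-innerₗ (EuclideanSpace ℝ (Fin n))).flip = -innerₗ _ := by
        ext x y
        simp [real_inner_comm]
      have e2 := VectorFourier.integral_fourierIntegral_smul_eq_flip (μ := volume) (ν := volume)
        (L := -innerₗ (EuclideanSpace ℝ (Fin n))) (f := φ) Real.continuous_fourierChar
        (by
          change Continuous fun p : EuclideanSpace ℝ (Fin n) × EuclideanSpace ℝ (Fin n) ↦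
            -(inner ℝ p.1 p.2 : ℝ)
          fun_prop) φ.integrable hg
      rw [hflip] at e2
      have e3 : ∫ x, φ x • (𝓕⁻ g : L2C n) x = ∫ x, φ x • h x := e1.symm.trans e2
      have hsm : ∀ (x : EuclideanSpace ℝ (Fin n)) (z : ℂ), η x • z = φ x • z := fun x z ↦ by
        rw [Complex.real_smul, smul_eq_mul]; rfl
      have i1 : Integrable fun x ↦ η x • (𝓕⁻ g : L2C n) x :=
        hl1.integrable_smul_left_of_hasCompactSupport hη.continuous hηc
      have i2 : Integrable fun x ↦ η x • h x :=
        hcont.locallyIntegrable.integrable_smul_left_of_hasCompactSupport hη.continuous hηc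
      simp only [smul_sub]
      rw [integral_sub i1 i2, sub_eq_zero]
      simpa only [hsm] using e3)
  filter_upwards [key] with x hx
  exact sub_eq_zero.1 hx

theorem norm_fourierInv_le (g : L2C n) (hg : Integrable g) :
    ∀ᵐ x, ‖(𝓕⁻ g : L2C n) x‖ ≤ ∫ ξ, ‖g ξ‖ := by
  filter_upwards [coeFn_fourierInv_of_integrable g hg] with x hx
  rw [hx]
  exact VectorFourier.norm_fourierIntegral_le_integral_norm _ _ _ _ _

theorem integrableOn_ball_norm_rpow {α : ℝ} (hn : 1 ≤ n) (hα : α < n) (A : ℝ) :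
    IntegrableOn (fun ξ : EuclideanSpace ℝ (Fin n) ↦ ‖ξ‖ ^ (-α)) (Metric.ball 0 A) := by
  refine integrableOn_ball_of_norm_le_rpow (C := 1) (α := α) (by simpa using hn) (by simpa using hα)
    (Eventually.of_forall fun ξ ↦ ?_)
    (by fun_prop : Measurable fun ξ : EuclideanSpace ℝ (Fin n) ↦ ‖ξ‖ ^ (-α)).aestronglyMeasurable
  rw [one_mul, Real.norm_of_nonneg (by positivity)]

theorem integral_ball_norm_rpow {α : ℝ} {A : ℝ} (hA : 0 < A) :
    ∫ ξ in Metric.ball (0 : EuclideanSpace ℝ (Fin n)) A, ‖ξ‖ ^ (-α)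
      = A ^ ((n : ℝ) - α) * ∫ ξ in Metric.ball (0 : EuclideanSpace ℝ (Fin n)) 1, ‖ξ‖ ^ (-α) := by
  have h := Measure.setIntegral_comp_smul_of_pos volume
    (fun ξ : EuclideanSpace ℝ (Fin n) ↦ ‖ξ‖ ^ (-α)) (Metric.ball 0 1) hA
  rw [smul_ball hA.ne', smul_zero, mul_one, Real.norm_of_nonneg hA.le, finrank_euclideanSpace,
    Fintype.card_fin] at h
  have e : ∀ ξ : EuclideanSpace ℝ (Fin n), ‖A • ξ‖ ^ (-α) = A ^ (-α) * ‖ξ‖ ^ (-α) := fun ξ ↦ by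
    rw [norm_smul, Real.norm_of_nonneg hA.le, Real.mul_rpow hA.le (norm_nonneg _)]
  simp only [e, smul_eq_mul] at h
  rw [integral_const_mul] at h
  have hAn : (0 : ℝ) < A ^ n := by positivity
  rw [eq_comm, inv_mul_eq_iff_eq_mul₀ hAn.ne'] at h
  rw [h, ← mul_assoc, ← Real.rpow_natCast, ← Real.rpow_add hA, sub_eq_add_neg]

/-- The low frequency part of a function with `|ξ|^σ g ∈ L²` is integrable, with a bound by a power
of the radius. -/
theorem exists_integral_ball_norm_le {σ : ℝ} (hn : 1 ≤ n) (hσn : 2 * σ < n) (g : L2C n)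
    (hg : MemLp (fun ξ ↦ ‖ξ‖ ^ σ • g ξ) 2 volume) :
    ∃ K : ℝ, 0 < K ∧ ∀ A : ℝ, 0 < A → IntegrableOn g (Metric.ball 0 A) ∧
      ∫ ξ in Metric.ball 0 A, ‖g ξ‖ ≤ K * A ^ (((n : ℝ) - 2 * σ) / 2) := by
  set I := ∫ ξ in Metric.ball (0 : EuclideanSpace ℝ (Fin n)) 1, ‖ξ‖ ^ (-(2 * σ)) with hI
  set N := ∫ ξ, ‖‖ξ‖ ^ σ • g ξ‖ ^ (2 : ℝ) with hN
  have hI0 : 0 ≤ I := integral_nonneg fun ξ ↦ by positivity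
  have hN0 : 0 ≤ N := integral_nonneg fun ξ ↦ by positivity
  -- The added 1 keeps the constant positive when `g` vanishes; it is divided by later.
  refine ⟨I ^ ((1 : ℝ) / 2) * N ^ ((1 : ℝ) / 2) + 1, by positivity, fun A hA ↦ ?_⟩
  have hfin : IsFiniteMeasure (volume.restrict (Metric.ball (0 : EuclideanSpace ℝ (Fin n)) A)) :=
    ⟨by rw [Measure.restrict_apply_univ]; exact measure_ball_lt_top⟩
  refine ⟨((Lp.memLp g).restrict _).integrable (by norm_num), ?_⟩
  have hsq : ∀ ξ : EuclideanSpace ℝ (Fin n), (‖ξ‖ ^ (-σ)) ^ (2 : ℝ) = ‖ξ‖ ^ (-(2 * σ)) := fun ξ ↦ by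
    rw [← Real.rpow_mul (norm_nonneg _)]
    congr 1; ring
  have m1 : MemLp (fun ξ : EuclideanSpace ℝ (Fin n) ↦ ‖ξ‖ ^ (-σ)) (ENNReal.ofReal 2)
      (volume.restrict (Metric.ball 0 A)) := by
    rw [show ENNReal.ofReal 2 = 2 by norm_num, memLp_two_iff_integrable_sq (by fun_prop : Measurable
      fun ξ : EuclideanSpace ℝ (Fin n) ↦ ‖ξ‖ ^ (-σ)).aestronglyMeasurable]
    refine (integrableOn_ball_norm_rpow hn hσn A).congr_fun (fun ξ _ ↦ ?_) measurableSet_ball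
    simp only
    rw [← hsq, Real.rpow_two]
  have m2 : MemLp (fun ξ : EuclideanSpace ℝ (Fin n) ↦ ‖‖ξ‖ ^ σ • g ξ‖) (ENNReal.ofReal 2)
      (volume.restrict (Metric.ball 0 A)) := by
    rw [show ENNReal.ofReal 2 = 2 by norm_num]
    exact (hg.restrict _).norm
  -- Cauchy–Schwarz for |ξ|^(-σ) times |ξ|^σ|g|. The first factor is square integrable on balls
  -- since 2σ < n, and scaling gives the power of `A`.
  have hold := integral_mul_le_Lp_mul_Lq_of_nonneg (μ := volume.restrict (Metric.ball 0 A))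
    Real.HolderConjugate.two_two (Eventually.of_forall fun ξ ↦ by positivity)
    (Eventually.of_forall fun ξ ↦ by positivity) m1 m2
  have e1 : ∫ ξ in Metric.ball 0 A, ‖g ξ‖
      = ∫ ξ in Metric.ball (0 : EuclideanSpace ℝ (Fin n)) A, ‖ξ‖ ^ (-σ) * ‖‖ξ‖ ^ σ • g ξ‖ := by
    have : Nontrivial (EuclideanSpace ℝ (Fin n)) :=
      Module.nontrivial_of_finrank_pos (R := ℝ) (by rw [finrank_euclideanSpace_fin]; omega)
    refine integral_congr_ae (ae_restrict_of_ae ?_)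
    have h0 : ∀ᵐ ξ : EuclideanSpace ℝ (Fin n), ξ ≠ 0 := by simp [ae_iff, measure_singleton]
    filter_upwards [h0] with ξ hξ
    rw [norm_smul, Real.norm_of_nonneg (by positivity), ← mul_assoc,
      ← Real.rpow_add (norm_pos_iff.2 hξ), neg_add_cancel, Real.rpow_zero, one_mul]
  rw [e1]
  refine hold.trans ?_
  simp only [hsq]
  rw [integral_ball_norm_rpow hA, Real.mul_rpow (by positivity) hI0, ← Real.rpow_mul hA.le]
  have hN1 : ∫ ξ in Metric.ball (0 : EuclideanSpace ℝ (Fin n)) A, ‖‖ξ‖ ^ σ • g ξ‖ ^ (2 : ℝ) ≤ N := by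
    refine setIntegral_le_integral ?_ (Eventually.of_forall fun ξ ↦ by positivity)
    simp only [Real.rpow_two]
    exact hg.integrable_norm_pow two_ne_zero
  have e2 : ((n : ℝ) - 2 * σ) * (1 / 2) = ((n : ℝ) - 2 * σ) / 2 := by ring
  rw [e2]
  have h3 := Real.rpow_le_rpow (integral_nonneg fun ξ ↦ by positivity) hN1
    (by norm_num : (0 : ℝ) ≤ 1 / 2)
  have h4 : (0 : ℝ) ≤ A ^ (((n : ℝ) - 2 * σ) / 2) := by positivity
  calc _ ≤ A ^ (((n : ℝ) - 2 * σ) / 2) * I ^ ((1 : ℝ) / 2) * N ^ ((1 : ℝ) / 2) :=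
        mul_le_mul_of_nonneg_left h3 (by positivity)
    _ ≤ _ := by nlinarith

end Embedding

/-! ### The critical Sobolev embedding by frequency splitting at each level. -/

section Embedding

variable {n : ℕ}

theorem lintegral_enorm_sq_fourierInv (g : L2C n) :
    ∫⁻ x, ‖(𝓕⁻ g : L2C n) x‖ₑ ^ (2 : ℝ) = ∫⁻ ξ, ‖g ξ‖ₑ ^ (2 : ℝ) := by
  have h : ‖(𝓕⁻ g : L2C n)‖ = ‖g‖ :=
    (Lp.fourierTransformₗᵢ (EuclideanSpace ℝ (Fin n)) ℂ).symm.norm_map g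
  rw [Lp.norm_def, Lp.norm_def, ENNReal.toReal_eq_toReal_iff' (Lp.eLpNorm_ne_top _)
    (Lp.eLpNorm_ne_top _), eLpNorm_eq_lintegral_rpow_enorm_toReal two_ne_zero ENNReal.ofNat_ne_top,
    eLpNorm_eq_lintegral_rpow_enorm_toReal two_ne_zero ENNReal.ofNat_ne_top] at h
  have h2 := congrArg (fun x : ℝ≥0∞ ↦ x ^ (2 : ℝ)) h
  simp only [ENNReal.toReal_ofNat] at h2
  rwa [← ENNReal.rpow_mul, ← ENNReal.rpow_mul, one_div, inv_mul_cancel₀ two_ne_zero,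
    ENNReal.rpow_one, ENNReal.rpow_one] at h2

/-- Splitting in low and high frequencies. -/
theorem measure_lt_norm_fourierInv_le (g : L2C n) {A lam : ℝ} (hlam : 0 < lam)
    (hi : IntegrableOn g (Metric.ball 0 A))
    (hA : ∫ ξ in Metric.ball 0 A, ‖g ξ‖ ≤ lam / 2) :
    volume {x | lam < ‖(𝓕⁻ g : L2C n) x‖}
      ≤ ENNReal.ofReal (4 / lam ^ 2) * ∫⁻ ξ in (Metric.ball 0 A)ᶜ, ‖g ξ‖ₑ ^ (2 : ℝ) := by
  let B : Set (EuclideanSpace ℝ (Fin n)) := Metric.ball 0 A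
  have hB : MeasurableSet B := measurableSet_ball
  let m : EuclideanSpace ℝ (Fin n) → ℝ := B.indicator 1
  have hm : Measurable m := measurable_one.indicator hB
  have hmb : ∀ ξ, |m ξ| ≤ 1 := fun ξ ↦ by
    by_cases h : ξ ∈ B <;> simp [m, h]
  set g₁ : L2C n := bddMul m hm hmb g with hg₁
  have c1 : g₁ =ᵐ[volume] B.indicator g := by
    filter_upwards [coeFn_bddMul hm hmb g] with ξ h
    rw [h]
    by_cases hξ : ξ ∈ B <;> simp [m, hξ]
  have c2 : (g - g₁ : L2C n) =ᵐ[volume] Bᶜ.indicator g := by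
    filter_upwards [c1, Lp.coeFn_sub g g₁] with ξ h1 h2
    rw [h2, Pi.sub_apply, h1]
    by_cases hξ : ξ ∈ B <;> simp [hξ]
  have i1 : Integrable g₁ := (integrable_congr c1).2 (hi.integrable_indicator hB)
  have n1 : ∀ᵐ x, ‖(𝓕⁻ g₁ : L2C n) x‖ ≤ lam / 2 := by
    filter_upwards [norm_fourierInv_le g₁ i1] with x hx
    refine hx.trans (le_of_eq_of_le ?_ hA)
    rw [← integral_indicator hB]
    refine integral_congr_ae ?_
    filter_upwards [c1] with ξ h
    rw [h, norm_indicator_eq_indicator_norm]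
  have hsplit : (𝓕⁻ g : L2C n) = 𝓕⁻ g₁ + 𝓕⁻ (g - g₁) := by
    rw [← FourierTransform.fourierInv_add, add_sub_cancel]
  -- The low-frequency part is at most λ/2 almost everywhere, so the high-frequency part exceeds λ/2
  -- wherever the sum exceeds λ; Chebyshev and Plancherel then bound the measure.
  have hsub : volume {x | lam < ‖(𝓕⁻ g : L2C n) x‖}
      ≤ volume {x | ENNReal.ofReal ((lam / 2) ^ 2) ≤ ‖(𝓕⁻ (g - g₁) : L2C n) x‖ₑ ^ (2 : ℝ)} := by
    refine measure_mono_ae ?_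
    filter_upwards [n1, Lp.coeFn_add (𝓕⁻ g₁ : L2C n) (𝓕⁻ (g - g₁))] with x h1 h2 hx
    have hx' : lam < ‖(𝓕⁻ g : L2C n) x‖ := hx
    rw [hsplit, h2, Pi.add_apply] at hx'
    have h3 := norm_add_le ((𝓕⁻ g₁ : L2C n) x) ((𝓕⁻ (g - g₁) : L2C n) x)
    change ENNReal.ofReal ((lam / 2) ^ 2) ≤ ‖(𝓕⁻ (g - g₁) : L2C n) x‖ₑ ^ (2 : ℝ)
    rw [← ofReal_norm, ENNReal.rpow_two, ← ENNReal.ofReal_pow (norm_nonneg _)]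
    refine ENNReal.ofReal_le_ofReal ?_
    exact pow_le_pow_left₀ (by positivity) (by linarith) 2
  have hcheb := mul_meas_ge_le_lintegral₀ (μ := volume)
    (f := fun x ↦ ‖(𝓕⁻ (g - g₁) : L2C n) x‖ₑ ^ (2 : ℝ))
    ((Lp.aestronglyMeasurable _).enorm.pow_const _) (ENNReal.ofReal ((lam / 2) ^ 2))
  rw [lintegral_enorm_sq_fourierInv] at hcheb
  have e : ∫⁻ ξ, ‖(g - g₁ : L2C n) ξ‖ₑ ^ (2 : ℝ) = ∫⁻ ξ in Bᶜ, ‖g ξ‖ₑ ^ (2 : ℝ) := by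
    rw [← lintegral_indicator hB.compl]
    refine lintegral_congr_ae ?_
    filter_upwards [c2] with ξ h
    rw [h]
    by_cases hξ : ξ ∈ B <;> simp [hξ]
  rw [e] at hcheb
  refine hsub.trans ?_
  have h4 : ENNReal.ofReal (4 / lam ^ 2) * ENNReal.ofReal ((lam / 2) ^ 2) = 1 := by
    rw [← ENNReal.ofReal_mul (by positivity)]
    have : 4 / lam ^ 2 * (lam / 2) ^ 2 = 1 := by field_simp; norm_num
    rw [this, ENNReal.ofReal_one]
  calc _ = ENNReal.ofReal (4 / lam ^ 2) * (ENNReal.ofReal ((lam / 2) ^ 2) * volume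
          {x | ENNReal.ofReal ((lam / 2) ^ 2) ≤ ‖(𝓕⁻ (g - g₁) : L2C n) x‖ₑ ^ (2 : ℝ)}) := by
        rw [← mul_assoc, h4, one_mul]
    _ ≤ _ := mul_le_mul_right hcheb _

theorem lintegral_Ioc_rpow {β M : ℝ} (hβ : -1 < β) (hM : 0 ≤ M) :
    ∫⁻ t in Ioc 0 M, ENNReal.ofReal (t ^ β) = ENNReal.ofReal (M ^ (β + 1) / (β + 1)) := by
  rw [← ofReal_integral_eq_lintegral_ofReal]
  · rw [← intervalIntegral.integral_of_le hM, integral_rpow (Or.inl hβ),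
      Real.zero_rpow (by linarith), sub_zero]
  · exact (intervalIntegral.intervalIntegrable_rpow' hβ).1
  · filter_upwards [ae_restrict_mem measurableSet_Ioc] with t ht
    exact Real.rpow_nonneg ht.1.le _

/-- The critical Sobolev embedding on the Fourier side. -/
theorem memLp_fourierInv_of_frac {σ : ℝ} (hn : 1 ≤ n) (hσ : 0 < σ) (hσn : 2 * σ < n) (g : L2C n)
    (hg : MemLp (fun ξ ↦ ‖ξ‖ ^ σ • g ξ) 2 volume) :
    MemLp (𝓕⁻ g : L2C n) (ENNReal.ofReal (2 * n / (n - 2 * σ))) volume := by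
  obtain ⟨K, hK, hKA⟩ := exists_integral_ball_norm_le hn hσn g hg
  set a : ℝ := ((n : ℝ) - 2 * σ) / 2 with ha
  have ha0 : 0 < a := by rw [ha]; linarith
  set r : ℝ := 2 * n / (n - 2 * σ) with hr
  have hnσ : 0 < (n : ℝ) - 2 * σ := by linarith
  have hn0 : (0 : ℝ) < n := by exact_mod_cast hn
  have hr0 : 0 < r := by positivity
  -- This relation fixes the critical exponent: integrating t^(r-3) up to a multiple of |ξ|^a must
  -- produce |ξ|^(2σ).
  have hr2 : (r - 2) * a = 2 * σ := by
    rw [hr, ha]; field_simp; ring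
  have hr2' : 0 < r - 2 := by
    by_contra h
    push Not at h
    nlinarith
  -- the frequency cut-off attached to the level `t`
  let ρ : ℝ → ℝ := fun t ↦ (t / (2 * K)) ^ (1 / a)
  have hweak : ∀ t : ℝ, 0 < t → volume {x | t < ‖(𝓕⁻ g : L2C n) x‖}
      ≤ ENNReal.ofReal (4 / t ^ 2) * ∫⁻ ξ in (Metric.ball 0 (ρ t))ᶜ, ‖g ξ‖ₑ ^ (2 : ℝ) := by
    intro t ht
    have hρ : 0 < ρ t := by positivity
    refine measure_lt_norm_fourierInv_le g ht (hKA _ hρ).1 ((hKA _ hρ).2.trans (le_of_eq ?_))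
    simp only [ρ]
    rw [← Real.rpow_mul (by positivity), one_div, inv_mul_cancel₀ ha0.ne', Real.rpow_one]
    field_simp
  have hmem : ∀ t : ℝ, 0 < t → ∀ ξ : EuclideanSpace ℝ (Fin n),
      ξ ∈ (Metric.ball 0 (ρ t))ᶜ ↔ t ∈ Ioc 0 (2 * K * ‖ξ‖ ^ a) := by
    intro t ht ξ
    have hρ : 0 < ρ t := by positivity
    have hρa : ρ t ^ a = t / (2 * K) := by
      simp only [ρ]
      rw [← Real.rpow_mul (by positivity), one_div, inv_mul_cancel₀ ha0.ne', Real.rpow_one]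
    rw [mem_compl_iff, mem_ball_zero_iff, not_lt, mem_Ioc, and_iff_right ht,
      ← Real.rpow_le_rpow_iff hρ.le (norm_nonneg ξ) ha0, hρa, div_le_iff₀' (by positivity)]
  have hgm : AEMeasurable (fun ξ ↦ ‖g ξ‖ₑ ^ (2 : ℝ)) volume :=
    (Lp.aestronglyMeasurable g).enorm.pow_const _
  refine ⟨Lp.aestronglyMeasurable _, ?_⟩
  rw [eLpNorm_lt_top_iff_lintegral_rpow_enorm_lt_top (by simpa using hr0) ENNReal.ofReal_ne_top,
    ENNReal.toReal_ofReal hr0.le]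
  have hlc := lintegral_rpow_eq_lintegral_meas_lt_mul volume
    (f := fun x ↦ ‖(𝓕⁻ g : L2C n) x‖) (Eventually.of_forall fun x ↦ norm_nonneg _)
    (Lp.aestronglyMeasurable (𝓕⁻ g : L2C n)).norm.aemeasurable hr0
  have e0 : ∫⁻ x, ‖(𝓕⁻ g : L2C n) x‖ₑ ^ r
      = ∫⁻ x, ENNReal.ofReal (‖(𝓕⁻ g : L2C n) x‖ ^ r) := by
    refine lintegral_congr fun x ↦ ?_
    rw [← ofReal_norm, ENNReal.ofReal_rpow_of_nonneg (norm_nonneg _) hr0.le]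
  rw [e0, hlc]
  refine ENNReal.mul_lt_top ENNReal.ofReal_lt_top ?_
  -- The layer-cake integrand as a function of level and frequency. The condition |ξ| ≥ ρ(t) is
  -- rewritten as an upper bound on t, ready for Tonelli.
  let k : ℝ → EuclideanSpace ℝ (Fin n) → ℝ≥0∞ := fun t ξ ↦
    {z : ℝ × EuclideanSpace ℝ (Fin n) | z.1 ∈ Ioc 0 (2 * K * ‖z.2‖ ^ a)}.indicator
      (fun z ↦ ENNReal.ofReal (4 * z.1 ^ (r - 3)) * ‖g z.2‖ₑ ^ (2 : ℝ)) (t, ξ)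
  have hset : MeasurableSet
      {z : ℝ × EuclideanSpace ℝ (Fin n) | z.1 ∈ Ioc 0 (2 * K * ‖z.2‖ ^ a)} :=
    (measurableSet_lt measurable_const measurable_fst).inter
      (measurableSet_le measurable_fst (by fun_prop))
  have hkm : AEMeasurable (Function.uncurry k) ((volume.restrict (Ioi 0)).prod volume) := by
    refine AEMeasurable.indicator (f := fun z : ℝ × EuclideanSpace ℝ (Fin n) ↦
      ENNReal.ofReal (4 * z.1 ^ (r - 3)) * ‖g z.2‖ₑ ^ (2 : ℝ)) ?_ hset
    refine AEMeasurable.mul (Measurable.aemeasurable (by fun_prop)) ?_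
    exact hgm.comp_quasiMeasurePreserving Measure.quasiMeasurePreserving_snd
  have b1 : ∫⁻ t in Ioi (0 : ℝ), volume {x | t < ‖(𝓕⁻ g : L2C n) x‖}
      * ENNReal.ofReal (t ^ (r - 1)) ≤ ∫⁻ t in Ioi (0 : ℝ), ∫⁻ ξ, k t ξ := by
    refine setLIntegral_mono_ae' measurableSet_Ioi (Eventually.of_forall fun t ht ↦ ?_)
    have ht0 : (0 : ℝ) < t := ht
    refine (mul_le_mul_left (hweak t ht0) _).trans (le_of_eq ?_)
    rw [mul_right_comm, ← ENNReal.ofReal_mul (by positivity), ← lintegral_indicator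
      measurableSet_ball.compl, ← lintegral_const_mul' _ _ ENNReal.ofReal_ne_top]
    have e1 : 4 / t ^ 2 * t ^ (r - 1) = 4 * t ^ (r - 3) := by
      have : t ^ (r - 1) = t ^ (r - 3) * t ^ 2 := by
        rw [← Real.rpow_natCast, ← Real.rpow_add ht0]; congr 1; push_cast; ring
      rw [this]; field_simp
    rw [e1]
    refine lintegral_congr fun ξ ↦ ?_
    simp only [k]
    by_cases h : ξ ∈ (Metric.ball 0 (ρ t))ᶜ
    · have h' : (t, ξ) ∈ {z : ℝ × EuclideanSpace ℝ (Fin n) | z.1 ∈ Ioc 0 (2 * K * ‖z.2‖ ^ a)} :=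
        (hmem t ht0 ξ).1 h
      rw [indicator_of_mem h, indicator_of_mem h']
    · have h' : (t, ξ) ∉ {z : ℝ × EuclideanSpace ℝ (Fin n) | z.1 ∈ Ioc 0 (2 * K * ‖z.2‖ ^ a)} :=
        fun h1 ↦ h ((hmem t ht0 ξ).2 h1)
      rw [indicator_of_notMem h, indicator_of_notMem h', mul_zero]
  refine b1.trans_lt ?_
  rw [lintegral_lintegral_swap hkm]
  have b2 : ∀ ξ, ∫⁻ t in Ioi (0 : ℝ), k t ξ
      = ENNReal.ofReal (4 * ((2 * K) ^ (r - 2) / (r - 2))) * ‖‖ξ‖ ^ σ • g ξ‖ₑ ^ (2 : ℝ) := by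
    intro ξ
    have hM : 0 ≤ 2 * K * ‖ξ‖ ^ a := by positivity
    have e1 : ∀ t, k t ξ = (Ioc 0 (2 * K * ‖ξ‖ ^ a)).indicator
        (fun t ↦ (ENNReal.ofReal 4 * ‖g ξ‖ₑ ^ (2 : ℝ)) * ENNReal.ofReal (t ^ (r - 3))) t := by
      intro t
      simp only [k]
      by_cases h : t ∈ Ioc 0 (2 * K * ‖ξ‖ ^ a)
      · have h' : (t, ξ) ∈ {z : ℝ × EuclideanSpace ℝ (Fin n) |
          z.1 ∈ Ioc 0 (2 * K * ‖z.2‖ ^ a)} := h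
        rw [indicator_of_mem h, indicator_of_mem h', ENNReal.ofReal_mul (by norm_num),
          mul_right_comm]
      · have h' : (t, ξ) ∉ {z : ℝ × EuclideanSpace ℝ (Fin n) |
          z.1 ∈ Ioc 0 (2 * K * ‖z.2‖ ^ a)} := h
        rw [indicator_of_notMem h, indicator_of_notMem h']
    simp only [e1]
    rw [setLIntegral_indicator measurableSet_Ioc, inter_eq_left.2 Ioc_subset_Ioi_self,
      lintegral_const_mul' _ _ (ENNReal.mul_ne_top ENNReal.ofReal_ne_top
        (ENNReal.rpow_ne_top_of_nonneg (by norm_num) enorm_ne_top)),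
      lintegral_Ioc_rpow (by linarith) hM]
    have e2 : r - 3 + 1 = r - 2 := by ring
    have e3 : (2 * K * ‖ξ‖ ^ a) ^ (r - 2) = (2 * K) ^ (r - 2) * (‖ξ‖ ^ σ) ^ (2 : ℝ) := by
      rw [Real.mul_rpow (by positivity) (by positivity), ← Real.rpow_mul (norm_nonneg _),
        ← Real.rpow_mul (norm_nonneg _)]
      congr 2
      linarith
    rw [e2, e3, enorm_smul, ENNReal.mul_rpow_of_nonneg _ _ (by norm_num : (0 : ℝ) ≤ 2)]
    have e4 : ‖‖ξ‖ ^ σ‖ₑ ^ (2 : ℝ) = ENNReal.ofReal ((‖ξ‖ ^ σ) ^ (2 : ℝ)) := by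
      rw [Real.enorm_eq_ofReal (by positivity), ENNReal.ofReal_rpow_of_nonneg (by positivity)
        (by norm_num)]
    rw [e4, ← mul_assoc, ← ENNReal.ofReal_mul (by positivity), mul_right_comm,
      ← ENNReal.ofReal_mul (by norm_num)]
    congr 2
    ring
  simp only [b2]
  rw [lintegral_const_mul' _ _ ENNReal.ofReal_ne_top]
  refine ENNReal.mul_lt_top ENNReal.ofReal_lt_top ?_
  have := (eLpNorm_lt_top_iff_lintegral_rpow_enorm_lt_top two_ne_zero ENNReal.ofNat_ne_top).1 hg.2
  simpa using this

end Embedding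

/-! ### Admissible potentials as bounded operators from H̃ˢ(Ω) to L̃²(Ω). -/

section Multiplication

variable {n : ℕ} {s : ℝ≥0}

theorem coeFn_fourierInv_fourierL2 (u : L2R n) :
    (𝓕⁻ (fourierL2 n u) : L2C n) =ᵐ[volume] fun x ↦ (u x : ℂ) := by
  have h : (𝓕⁻ (fourierL2 n u) : L2C n) = Complex.ofRealCLM.compLpL 2 volume u :=
    (Lp.fourierTransformₗᵢ (EuclideanSpace ℝ (Fin n)) ℂ).symm_apply_apply _
  rw [h]
  exact Complex.ofRealCLM.coeFn_compLpL u

theorem norm_rpow_le_besselSymbol {σ : ℝ} (hσ : 0 ≤ σ) (hσs : σ ≤ s)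
    (ξ : EuclideanSpace ℝ (Fin n)) : ‖ξ‖ ^ σ ≤ besselSymbol s ξ := by
  unfold besselSymbol
  have h1 : ‖ξ‖ ^ σ = (‖ξ‖ ^ 2) ^ (σ / 2) := by
    rw [← Real.rpow_natCast, ← Real.rpow_mul (norm_nonneg _)]
    congr 1
    push_cast
    ring
  have h2 : ‖ξ‖ ≤ ‖(2 * Real.pi) • ξ‖ := by
    rw [norm_smul, Real.norm_of_nonneg (by positivity)]
    exact le_mul_of_one_le_left (norm_nonneg _) (by linarith [Real.pi_gt_three])
  rw [h1]
  calc (‖ξ‖ ^ 2) ^ (σ / 2) ≤ (1 + ‖(2 * Real.pi) • ξ‖ ^ 2) ^ (σ / 2) :=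
        Real.rpow_le_rpow (by positivity) (by nlinarith [norm_nonneg ξ]) (by positivity)
    _ ≤ _ := Real.rpow_le_rpow_of_exponent_le (by nlinarith [norm_nonneg ((2 * Real.pi) • ξ)])
        (by linarith)

theorem Sobolev.memLp_norm_rpow (u : Sobolev n s) {σ : ℝ} (hσ : 0 ≤ σ) (hσs : σ ≤ s) :
    MemLp (fun ξ ↦ ‖ξ‖ ^ σ • fourierL2 n (Sobolev.toL2 n s u) ξ) 2 volume := by
  refine (Sobolev.memLp_bessel u).mono ?_ (Eventually.of_forall fun ξ ↦ ?_)
  · have hm : Measurable fun ξ : EuclideanSpace ℝ (Fin n) ↦ ‖ξ‖ ^ σ := by fun_prop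
    exact hm.aestronglyMeasurable.smul (Lp.aestronglyMeasurable _)
  · rw [norm_smul, norm_smul, Real.norm_of_nonneg (by positivity),
      Real.norm_of_nonneg (besselSymbol_pos ξ).le]
    exact mul_le_mul_of_nonneg_right (norm_rpow_le_besselSymbol hσ hσs ξ) (norm_nonneg _)

/-- The critical Sobolev embedding. -/
theorem Sobolev.memLp_critical (hn : 1 ≤ n) (u : Sobolev n s) {σ : ℝ} (hσ : 0 < σ) (hσs : σ ≤ s)
    (hσn : 2 * σ < n) :
    MemLp (Sobolev.toL2 n s u) (ENNReal.ofReal (2 * n / (n - 2 * σ))) volume := by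
  have h := memLp_fourierInv_of_frac hn hσ hσn _ (Sobolev.memLp_norm_rpow u hσ.le hσs)
  refine h.congr_norm (Lp.aestronglyMeasurable _) ?_
  filter_upwards [coeFn_fourierInv_fourierL2 (Sobolev.toL2 n s u)] with x hx
  rw [hx, Complex.norm_real]

/-- The Sobolev embedding in `L^∞`. -/
theorem Sobolev.memLp_top (hs : (n : ℝ) < 2 * s) (u : Sobolev n s) :
    MemLp (Sobolev.toL2 n s u) ∞ volume := by
  -- Since 2s > n, ⟨ξ⟩⁻ˢ is square integrable; multiplied by ⟨ξ⟩ˢû it shows that û is integrable, so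
  -- u is bounded.
  have hinv : MemLp (fun ξ : EuclideanSpace ℝ (Fin n) ↦ (besselSymbol s ξ)⁻¹) 2 volume := by
    have hm : Measurable fun ξ : EuclideanSpace ℝ (Fin n) ↦ (besselSymbol s ξ)⁻¹ :=
      measurable_besselSymbol.inv
    rw [memLp_two_iff_integrable_sq hm.aestronglyMeasurable]
    have hi : Integrable fun ξ : EuclideanSpace ℝ (Fin n) ↦ (1 + ‖ξ‖ ^ 2) ^ (-(2 * (s : ℝ)) / 2) :=
      integrable_rpow_neg_one_add_norm_sq (by simpa using hs)
    refine hi.mono' (hm.pow_const 2).aestronglyMeasurable (Eventually.of_forall fun ξ ↦ ?_)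
    have h2 : ‖ξ‖ ≤ ‖(2 * Real.pi) • ξ‖ := by
      rw [norm_smul, Real.norm_of_nonneg (by positivity)]
      exact le_mul_of_one_le_left (norm_nonneg _) (by linarith [Real.pi_gt_three])
    have e : (besselSymbol s ξ)⁻¹ ^ 2 = (1 + ‖(2 * Real.pi) • ξ‖ ^ 2) ^ (-(2 * (s : ℝ)) / 2) := by
      unfold besselSymbol
      rw [← Real.rpow_neg (by positivity), ← Real.rpow_natCast, ← Real.rpow_mul (by positivity)]
      congr 1
      push_cast
      ring
    rw [Real.norm_of_nonneg (by positivity), e]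
    refine Real.rpow_le_rpow_of_nonpos (by positivity) (by nlinarith [norm_nonneg ξ]) ?_
    have : (0 : ℝ) ≤ s := s.2
    linarith
  have hint : Integrable (fourierL2 n (Sobolev.toL2 n s u)) := by
    have h := MemLp.integrable_mul hinv (Sobolev.memLp_bessel u).norm
    refine (integrable_norm_iff (Lp.aestronglyMeasurable _)).1 (h.congr ?_)
    refine Eventually.of_forall fun ξ ↦ ?_
    simp only [Pi.mul_apply]
    rw [norm_smul, Real.norm_of_nonneg (besselSymbol_pos ξ).le, ← mul_assoc,
      inv_mul_cancel₀ (besselSymbol_pos ξ).ne', one_mul]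
    rfl
  refine memLp_top_of_bound (Lp.aestronglyMeasurable _)
    (∫ ξ, ‖fourierL2 n (Sobolev.toL2 n s u) ξ‖) ?_
  filter_upwards [norm_fourierInv_le _ hint,
    coeFn_fourierInv_fourierL2 (Sobolev.toL2 n s u)] with x h1 h2
  rwa [h2, Complex.norm_real] at h1

/-- Hölder's inequality with σ/n + (n-2σ)/(2n) = 1/2. Keeping σ ≤ s free allows the borderline 2s =
n to be treated with a smaller order. -/
theorem Sobolev.memLp_mul_critical (hn : 1 ≤ n) {Ω : Set (EuclideanSpace ℝ (Fin n))} {σ : ℝ}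
    (hσ : 0 < σ) (hσs : σ ≤ s) (hσn : 2 * σ < n) {q : EuclideanSpace ℝ (Fin n) → ℝ}
    (hq : MemLp q (ENNReal.ofReal (n / σ)) (volume.restrict Ω)) (u : Sobolev n s) :
    MemLp (fun x ↦ q x * Sobolev.toL2 n s u x) 2 (volume.restrict Ω) := by
  have hn0 : (0 : ℝ) < n := by exact_mod_cast hn
  have h2 : 0 < (n : ℝ) - 2 * σ := by linarith
  have : ENNReal.HolderTriple (ENNReal.ofReal (n / σ)) (ENNReal.ofReal (2 * n / (n - 2 * σ))) 2 := by
    refine ⟨?_⟩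
    rw [← ENNReal.ofReal_inv_of_pos (by positivity), ← ENNReal.ofReal_inv_of_pos (by positivity),
      ← ENNReal.ofReal_add (by positivity) (by positivity)]
    have e : ((n : ℝ) / σ)⁻¹ + (2 * (n : ℝ) / (n - 2 * σ))⁻¹ = 2⁻¹ := by
      field_simp
      ring
    rw [e, ENNReal.ofReal_inv_of_pos (by norm_num), ENNReal.ofReal_ofNat]
  exact MemLp.mul' ((Sobolev.memLp_critical hn u hσ hσs hσn).restrict Ω) hq

/-- Admissible potentials map `Hˢ` to `L²`. -/
theorem Sobolev.memLp_mul (hn : 1 ≤ n) (hs : 0 < s) {Ω : Set (EuclideanSpace ℝ (Fin n))}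
    (hΩ : Bornology.IsBounded Ω) {p : ℝ≥0∞} (hp : AdmissibleExponent n s p)
    {q : EuclideanSpace ℝ (Fin n) → ℝ} (hq : MemLp q p (volume.restrict Ω)) (u : Sobolev n s) :
    MemLp (fun x ↦ q x * Sobolev.toL2 n s u x) 2 (volume.restrict Ω) := by
  have hfin : IsFiniteMeasure (volume.restrict Ω) :=
    ⟨by rw [Measure.restrict_apply_univ]; exact hΩ.measure_lt_top⟩
  have hs0 : (0 : ℝ) < s := by exact_mod_cast hs
  have hn0 : (0 : ℝ) < n := by exact_mod_cast hn
  rcases lt_trichotomy (2 * (s : ℝ)) n with h | h | h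
  · exact Sobolev.memLp_mul_critical hn hs0 le_rfl h (hq.mono_exponent (hp.1 h)) u
  -- Lowering p to r = min(p,3) makes it finite while keeping r > 2. Then σ = n/r satisfies σ ≤ s =
  -- n/2 and 2σ < n, and n/σ is exactly r.
  · have hp2 : 2 < min p 3 := lt_min (hp.2.1 h) (by norm_num)
    have hpt : min p 3 ≠ ⊤ := ((min_le_right p 3).trans_lt ENNReal.ofNat_lt_top).ne
    have hr : 2 < (min p 3).toReal := by
      rwa [← ENNReal.toReal_ofNat 2, ENNReal.toReal_lt_toReal (by norm_num) hpt]
    set r := (min p 3).toReal with hrdef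
    have hr0 : 0 < r := by linarith
    have e : ENNReal.ofReal (n / (n / r)) = min p 3 := by
      rw [div_div_cancel₀ hn0.ne', hrdef, ENNReal.ofReal_toReal hpt]
    refine Sobolev.memLp_mul_critical hn (σ := n / r) (by positivity) ?_ ?_ ?_ u
    · rw [div_le_iff₀ hr0]; nlinarith
    · rw [← mul_div_assoc, div_lt_iff₀ hr0]; nlinarith
    · rw [e]; exact hq.mono_exponent (min_le_left _ _)
  · exact MemLp.mul' ((Sobolev.memLp_top h u).restrict Ω) (hq.mono_exponent (hp.2.2 h))

/-- Multiplication by an admissible potential, followed by the projection to `L̃²(Ω)`, as a bounded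
operator on `H̃ˢ(Ω)`. -/
theorem exists_potential (hn : 1 ≤ n) (hs : 0 < s) {Ω : Set (EuclideanSpace ℝ (Fin n))}
    (hΩ : Bornology.IsBounded Ω) (hΩo : IsOpen Ω) {p : ℝ≥0∞} (hp : AdmissibleExponent n s p)
    {q : EuclideanSpace ℝ (Fin n) → ℝ} (hq : MemLp q p (volume.restrict Ω)) :
    ∃ Q : HTilde s Ω →L[ℝ] LTilde Ω, ∀ (v : HTilde s Ω) (w : LTilde Ω),
      inner ℝ (Q v) w = ∫ x in Ω, q x * (HTilde.incl s Ω v : L2R n) x * (w : L2R n) x := by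
  have hmem : ∀ v : HTilde s Ω,
      MemLp (Ω.indicator fun x ↦ q x * (HTilde.incl s Ω v : L2R n) x) 2 volume := fun v ↦
    (memLp_indicator_iff_restrict hΩo.measurableSet).2
      (Sobolev.memLp_mul hn hs hΩ hp hq (v : Sobolev n s))
  let M : HTilde s Ω →ₗ[ℝ] L2R n :=
    { toFun := fun v ↦ (hmem v).toLp _
      map_add' := fun v w ↦ by
        rw [← MemLp.toLp_add]
        refine MemLp.toLp_congr _ _ ?_
        rw [map_add, Submodule.coe_add]
        filter_upwards [Lp.coeFn_add (HTilde.incl s Ω v : L2R n) (HTilde.incl s Ω w)] with x h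
        by_cases hx : x ∈ Ω
        · simp only [indicator_of_mem hx, Pi.add_apply, h]; ring
        · simp only [indicator_of_notMem hx, Pi.add_apply, add_zero]
      map_smul' := fun c v ↦ by
        rw [RingHom.id_apply, ← MemLp.toLp_const_smul]
        refine MemLp.toLp_congr _ _ ?_
        rw [map_smul, Submodule.coe_smul]
        filter_upwards [Lp.coeFn_smul c (HTilde.incl s Ω v : L2R n)] with x h
        by_cases hx : x ∈ Ω
        · simp only [indicator_of_mem hx, Pi.smul_apply, h, smul_eq_mul]; ring
        · simp only [indicator_of_notMem hx, Pi.smul_apply, smul_zero] }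
  have hM : ∀ v, M v =ᵐ[volume] Ω.indicator fun x ↦ q x * (HTilde.incl s Ω v : L2R n) x :=
    fun v ↦ (hmem v).coeFn_toLp
  -- Closed graph theorem: along a common subsequence both v_k and q v_k converge almost everywhere,
  -- which identifies the limit without a quantitative embedding constant.
  have hMc : Continuous M := by
    refine M.continuous_of_seq_closed_graph fun v x y hv hy ↦ ?_
    have h1 : Tendsto (fun k ↦ (HTilde.incl s Ω (v k) : L2R n)) atTop
        (𝓝 (HTilde.incl s Ω x : L2R n)) :=
      ((continuous_subtype_val.comp (HTilde.incl s Ω).continuous).tendsto x).comp hv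
    obtain ⟨φ, hφ, hφ'⟩ := (tendstoInMeasure_of_tendsto_Lp h1).exists_seq_tendsto_ae
    have h2 : Tendsto (fun k ↦ M (v (φ k))) atTop (𝓝 y) := hy.comp hφ.tendsto_atTop
    obtain ⟨ψ, hψ, hψ'⟩ := (tendstoInMeasure_of_tendsto_Lp h2).exists_seq_tendsto_ae
    refine Lp.ext ?_
    have h3 : ∀ᵐ z, ∀ k, M (v (φ (ψ k))) z = Ω.indicator
        (fun z ↦ q z * (HTilde.incl s Ω (v (φ (ψ k))) : L2R n) z) z :=
      ae_all_iff.2 fun k ↦ hM _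
    filter_upwards [hφ', hψ', h3, hM x] with z z1 z2 z3 z4
    refine tendsto_nhds_unique z2 ?_
    simp only [z3]
    rw [z4]
    by_cases hz : z ∈ Ω
    · simp only [indicator_of_mem hz]
      exact (z1.comp hψ.tendsto_atTop).const_mul _
    · simp only [indicator_of_notMem hz]
      exact tendsto_const_nhds
  -- The projection does not affect the pairing, because `w` ranges over L̃²(Ω) only; membership of
  -- the product in L̃²(Ω) need not be checked.
  refine ⟨(LTilde Ω).orthogonalProjectionOnto ∘L ⟨M, hMc⟩, fun v w ↦ ?_⟩
  have e : inner ℝ (((LTilde Ω).orthogonalProjectionOnto ∘L ⟨M, hMc⟩) v) w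
      = inner ℝ (M v) (w : L2R n) :=
    Submodule.inner_orthogonalProjectionOnto_eq_of_mem_right w (M v)
  rw [e, L2.inner_def, ← integral_indicator hΩo.measurableSet]
  refine integral_congr_ae ?_
  filter_upwards [hM v] with x hx
  rw [hx]
  by_cases h : x ∈ Ω
  · simp only [indicator_of_mem h, RCLike.inner_apply, conj_trivial]; ring
  · simp only [indicator_of_notMem h, inner_zero_left]

end Multiplication

/-! ### C¹ functions on a closed interval as primitives. -/

section Primitive

variable {E : Type*} [NormedAddCommGroup E] [NormedSpace ℝ E] [CompleteSpace E]

theorem eq_add_integral_derivWithin {T : ℝ} (hT : 0 < T) {f : ℝ → E}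
    (hf : ContDiffOn ℝ 1 f (Icc 0 T)) {t : ℝ} (ht : t ∈ Icc 0 T) :
    f t = f 0 + ∫ τ in (0 : ℝ)..t, derivWithin f (Icc 0 T) τ := by
  have hc := hf.continuousOn_derivWithin (uniqueDiffOn_Icc hT) le_rfl
  have hsub : Icc 0 t ⊆ Icc 0 T := Icc_subset_Icc_right ht.2
  rw [intervalIntegral.integral_eq_sub_of_hasDerivAt_of_le ht.1 (hf.continuousOn.mono hsub)
    (fun τ hτ ↦ ?_) (ContinuousOn.intervalIntegrable (by rw [uIcc_of_le ht.1]; exact hc.mono hsub))]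
  · abel
  · have hτ' : τ ∈ Ioo 0 T := ⟨hτ.1, hτ.2.trans_le ht.2⟩
    exact ((hf.differentiableOn one_ne_zero τ (Ioo_subset_Icc_self hτ')).hasDerivWithinAt).hasDerivAt
      (Icc_mem_nhds hτ'.1 hτ'.2)

theorem contDiffOn_of_eq_add_integral {T : ℝ} (hT : 0 < T) {f y : ℝ → E}
    (hy : ContinuousOn y (Icc 0 T))
    (h : ∀ t ∈ Icc 0 T, f t = f 0 + ∫ τ in (0 : ℝ)..t, y τ) :
    ContDiffOn ℝ 1 f (Icc 0 T) ∧ EqOn (derivWithin f (Icc 0 T)) y (Icc 0 T) := by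
  -- A continuous extension of `y` to the line gives a primitive differentiable everywhere,
  -- including at the endpoints.
  let Y : ℝ → E := IccExtend hT.le ((Icc 0 T).domRestrict y)
  have hYc : Continuous Y := hy.domRestrict.Icc_extend'
  have hYy : EqOn Y y (Icc 0 T) := fun t ht ↦ IccExtend_of_mem hT.le _ ht
  let g : ℝ → E := fun t ↦ f 0 + ∫ τ in (0 : ℝ)..t, Y τ
  have hgf : EqOn f g (Icc 0 T) := fun t ht ↦ by
    rw [h t ht]
    refine congrArg (f 0 + ·) (intervalIntegral.integral_congr fun τ hτ ↦ (hYy ?_).symm)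
    rw [uIcc_of_le ht.1] at hτ
    exact Icc_subset_Icc_right ht.2 hτ
  have hg : ∀ t, HasDerivAt g (Y t) t := fun t ↦
    (hYc.integral_hasStrictDerivAt 0 t).hasDerivAt.const_add _
  have hg1 : ContDiff ℝ 1 g := by
    rw [contDiff_one_iff_deriv]
    refine ⟨fun t ↦ (hg t).differentiableAt, ?_⟩
    rwa [show deriv g = Y from funext fun t ↦ (hg t).deriv]
  refine ⟨hg1.contDiffOn.congr hgf, fun t ht ↦ ?_⟩
  rw [derivWithin_congr hgf (hgf ht), (hg t).hasDerivWithinAt.derivWithin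
    (uniqueDiffOn_Icc hT t ht), hYy ht]

end Primitive

/-! ### Backward weak solutions, existence and uniqueness. -/

section Solutions

open ContinuousLinearMap (adjoint)

variable {n : ℕ} {s : ℝ≥0} {Ω : Set (EuclideanSpace ℝ (Fin n))}

instance : CompleteSpace (LTilde Ω) :=
  (testFunctions Ω).isClosed_topologicalClosure.completeSpace_coe

/-- The zeroth order part of the wave operator, relative to the inner product of the energy
space. -/
def energyPotential (Q : HTilde s Ω →L[ℝ] LTilde Ω) : EnergySpace s Ω →L[ℝ] LTilde Ω :=
  Q ∘L ((energyEquiv s Ω).symm : EnergySpace s Ω →L[ℝ] HTilde s Ω) - energyIncl s Ω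

/-- The L² term of the energy inner product cancels the inclusion subtracted in `energyPotential`,
leaving exactly the bilinear form of (-Δ)ˢ + q. -/
theorem inner_energyPotential (Q : HTilde s Ω →L[ℝ] LTilde Ω) (g : LTilde Ω) (v w : HTilde s Ω) :
    inner ℝ (adjoint (energyIncl s Ω) (g - energyPotential Q (energyEquiv s Ω v))
        - energyEquiv s Ω v) (energyEquiv s Ω w)
      = inner ℝ g (HTilde.incl s Ω w)
        - ((inner ℂ (Sobolev.fracLaplacianHalf (v : Sobolev n s))
            (Sobolev.fracLaplacianHalf (w : Sobolev n s))).re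
          + inner ℝ (Q v) (HTilde.incl s Ω w)) := by
  have e : energyPotential Q (energyEquiv s Ω v) = Q v - HTilde.incl s Ω v := by
    rw [← energyIncl_energyEquiv]
    exact congrArg (fun x ↦ Q x - energyIncl s Ω (energyEquiv s Ω v))
      ((energyEquiv s Ω).symm_apply_apply v)
  rw [inner_sub_left, ContinuousLinearMap.adjoint_inner_left, energyIncl_energyEquiv,
    inner_energyEquiv, e, inner_sub_left, inner_sub_left]
  ring

theorem ext_inner_energyEquiv {x y : EnergySpace s Ω}
    (h : ∀ w, inner ℝ x (energyEquiv s Ω w) = inner ℝ y (energyEquiv s Ω w)) : x = y :=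
  ext_inner_right ℝ fun v ↦ by
    obtain ⟨w, rfl⟩ := (energyEquiv s Ω).surjective v
    exact h w

theorem intervalIntegral_inner_const {X : Type*} [NormedAddCommGroup X] [InnerProductSpace ℝ X]
    [CompleteSpace X] {f : ℝ → X} {a b : ℝ} (hf : IntervalIntegrable f volume a b) (w : X) :
    inner ℝ (∫ t in a..b, f t) w = ∫ t in a..b, inner ℝ (f t) w := by
  have h := intervalIntegral_clm (innerSL ℝ w) hf
  simp only [innerSL_apply_apply] at h
  simpa only [real_inner_comm] using h

theorem setIntegral_Ioo_eq {T : ℝ} (hT : 0 ≤ T) (f : ℝ → ℝ) :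
    ∫ t in Ioo 0 T, f t = ∫ t in (0 : ℝ)..T, f t := by
  rw [intervalIntegral.integral_of_le hT, integral_Ioc_eq_integral_Ioo]

theorem intervalIntegrable_of_memLp {E : Type*} [NormedAddCommGroup E] {T : ℝ} (hT : 0 ≤ T)
    {f : ℝ → E} (hf : MemLp f 2 (volume.restrict (Ioo 0 T))) :
    IntervalIntegrable f volume 0 T := by
  rw [intervalIntegrable_iff_integrableOn_Ioo_of_le hT]
  exact hf.integrable one_le_two

variable {q : EuclideanSpace ℝ (Fin n) → ℝ} {Q : HTilde s Ω →L[ℝ] LTilde Ω} {T : ℝ}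
  {G : ℝ → LTilde Ω}

theorem intervalIntegrable_velocity (hT : 0 ≤ T) (hG : IntervalIntegrable G volume 0 T)
    {v : ℝ → EnergySpace s Ω} (hv : ContinuousOn v (Icc 0 T)) :
    IntervalIntegrable (fun τ ↦ adjoint (energyIncl s Ω) (G τ - energyPotential Q (v τ)) - v τ)
      volume 0 T := by
  rw [← uIcc_of_le hT] at hv
  exact (intervalIntegrable_clm _ (hG.sub
    ((energyPotential Q).continuous.comp_continuousOn hv).intervalIntegrable)).sub
    hv.intervalIntegrable

/-- For each fixed `w` the distributional equation gives the weak derivative of ⟨∂ₜv,w⟩;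
`eq_add_integral_of_weak_deriv` integrates it, and varying `w` yields an identity in the energy
space. -/
theorem IsBackwardWeakSolution.isWaveSolution
    (hQ : ∀ (v : HTilde s Ω) (w : LTilde Ω),
      inner ℝ (Q v) w = ∫ x in Ω, q x * (HTilde.incl s Ω v : L2R n) x * (w : L2R n) x)
    (hT : 0 < T) (hG : IntervalIntegrable G volume 0 T) {v : ℝ → HTilde s Ω}
    (hv : IsBackwardWeakSolution s Ω T q G v) :
    IsWaveSolution (energyIncl s Ω) (energyPotential Q) T G (fun t ↦ energyEquiv s Ω (v t))
      (derivWithin (fun t ↦ HTilde.incl s Ω (v t)) (Icc 0 T)) := by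
  have hy := hv.contDiffOn.continuousOn_derivWithin (uniqueDiffOn_Icc hT) le_rfl
  set y := derivWithin (fun t ↦ HTilde.incl s Ω (v t)) (Icc 0 T) with hydef
  have hev : ContinuousOn (fun t ↦ energyEquiv s Ω (v t)) (Icc 0 T) :=
    (energyEquiv s Ω).continuous.comp_continuousOn hv.continuousOn
  have hk := intervalIntegrable_velocity (Q := Q) hT.le hG hev
  refine ⟨hev, hy, fun t ht ↦ ?_, fun t ht ↦ ext_inner_energyEquiv fun w ↦ ?_⟩
  · rw [energyIncl_energyEquiv, energyIncl_energyEquiv]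
    exact eq_add_integral_derivWithin hT hv.contDiffOn ht
  · have hkt := hk.mono_set (c := 0) (d := t) (by
      rw [uIcc_of_le ht.1, uIcc_of_le hT.le]; exact Icc_subset_Icc_right ht.2)
    let g : ℝ → ℝ := fun τ ↦ inner ℝ (adjoint (energyIncl s Ω) (G τ - energyPotential Q
      (energyEquiv s Ω (v τ))) - energyEquiv s Ω (v τ)) (energyEquiv s Ω w)
    have hg : IntervalIntegrable g volume 0 T := intervalIntegrable_inner hk continuousOn_const
    have key := eq_add_integral_of_weak_deriv hT (f := fun t ↦ inner ℝ (y t) (HTilde.incl s Ω w))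
      (g := g) (hy.inner continuousOn_const) hg (fun η h1 h2 h3 ↦ by
        have h := hv.equation w η h1 h2 h3
        have hηc := h1.continuous
        have i1 : IntegrableOn (fun t ↦ inner ℝ (G t) (HTilde.incl s Ω w) * η t) (Ioo 0 T) := by
          rw [← intervalIntegrable_iff_integrableOn_Ioo_of_le hT.le]
          exact (intervalIntegrable_inner hG continuousOn_const).mul_continuousOn hηc.continuousOn
        have i2 : IntegrableOn (fun t ↦ g t * η t) (Ioo 0 T) := by
          rw [← intervalIntegrable_iff_integrableOn_Ioo_of_le hT.le]
          exact hg.mul_continuousOn hηc.continuousOn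
        have e : ∀ t, ((inner ℂ (Sobolev.fracLaplacianHalf (v t : Sobolev n s))
              (Sobolev.fracLaplacianHalf (w : Sobolev n s))).re
            + ∫ x in Ω, q x * (HTilde.incl s Ω (v t) : L2R n) x * (HTilde.incl s Ω w : L2R n) x)
            * η t = inner ℝ (G t) (HTilde.incl s Ω w) * η t - g t * η t := fun t ↦ by
          simp only [g, inner_energyPotential, hQ]
          ring
        simp only [e] at h
        rw [integral_sub i1 i2] at h
        linarith) t ht
    rw [ContinuousLinearMap.adjoint_inner_left, energyIncl_energyEquiv, inner_add_left,
      ContinuousLinearMap.adjoint_inner_left, energyIncl_energyEquiv,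
      intervalIntegral_inner_const hkt]
    exact key

/-- This turns the abstractly constructed backward solution into a legitimate test function for the
uniqueness proof. -/
theorem IsWaveSolution.isBackwardWeakSolution
    (hQ : ∀ (v : HTilde s Ω) (w : LTilde Ω),
      inner ℝ (Q v) w = ∫ x in Ω, q x * (HTilde.incl s Ω v : L2R n) x * (w : L2R n) x)
    (hT : 0 < T) (hG : IntervalIntegrable G volume 0 T) {v : ℝ → EnergySpace s Ω}
    {y : ℝ → LTilde Ω}
    (hv : IsWaveSolution (energyIncl s Ω) (energyPotential Q) T G v y) (hvT : v T = 0)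
    (hyT : y T = 0) :
    IsBackwardWeakSolution s Ω T q G fun t ↦ (energyEquiv s Ω).symm (v t) := by
  obtain ⟨hd, hdy⟩ := contDiffOn_of_eq_add_integral hT
    (f := fun t ↦ HTilde.incl s Ω ((energyEquiv s Ω).symm (v t))) hv.continuousOn_snd hv.position
  refine ⟨(energyEquiv s Ω).symm.continuous.comp_continuousOn hv.continuousOn_fst, hd,
    fun w η h1 h2 h3 ↦ ?_, by rw [hvT, map_zero], by rw [hdy ⟨hT.le, le_rfl⟩, hyT]⟩
  have hk := intervalIntegrable_velocity (Q := Q) hT.le hG hv.continuousOn_fst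
  let g : ℝ → ℝ := fun τ ↦ inner ℝ (adjoint (energyIncl s Ω) (G τ - energyPotential Q (v τ)) - v τ)
    (energyEquiv s Ω w)
  have hg : IntervalIntegrable g volume 0 T := intervalIntegrable_inner hk continuousOn_const
  have hηc := h1.continuous
  have hη' : Continuous (deriv η) := h1.continuous_deriv (by simp)
  have hη0 : η 0 = 0 := image_eq_zero_of_notMem_tsupport fun h ↦ (h3 h).1.false
  have hηT : η T = 0 := image_eq_zero_of_notMem_tsupport fun h ↦ (h3 h).2.false
  have ibp := integral_inner_primitive (X := ℝ) (a := 0) (b := T) hg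
    (hη'.intervalIntegrable _ _) (Y := fun t ↦ inner ℝ (y t) (HTilde.incl s Ω w)) (P := η)
    (fun t ht ↦ by
      have hkt := hk.mono_set (uIcc_subset_uIcc left_mem_uIcc ht)
      rw [uIcc_of_le hT.le] at ht
      have h := congrArg (fun x ↦ inner ℝ x (energyEquiv s Ω w)) (hv.velocity t ht)
      simp only [inner_add_left, ContinuousLinearMap.adjoint_inner_left,
        energyIncl_energyEquiv, intervalIntegral_inner_const hkt] at h
      exact h)
    (fun t _ ↦ by
      rw [intervalIntegral.integral_deriv_eq_sub
        (fun x _ ↦ (h1.differentiable (by simp)).differentiableAt)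
        (hη'.intervalIntegrable _ _)]
      ring)
  have i0 : IntervalIntegrable (fun t ↦ g t * η t) volume 0 T :=
    hg.mul_continuousOn hηc.continuousOn
  have i1 : IntervalIntegrable (fun t ↦ inner ℝ (G t) (HTilde.incl s Ω w) * η t) volume 0 T :=
    (intervalIntegrable_inner hG continuousOn_const).mul_continuousOn hηc.continuousOn
  have i2 : IntervalIntegrable (fun t ↦ inner ℝ (y t) (HTilde.incl s Ω w) * deriv η t)
      volume 0 T := by
    refine ContinuousOn.intervalIntegrable ?_
    rw [uIcc_of_le hT.le]
    exact (hv.continuousOn_snd.inner continuousOn_const).mul hη'.continuousOn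
  have e : ∀ t, ((inner ℂ (Sobolev.fracLaplacianHalf ((energyEquiv s Ω).symm (v t) : Sobolev n s))
        (Sobolev.fracLaplacianHalf (w : Sobolev n s))).re
      + ∫ x in Ω, q x * (HTilde.incl s Ω ((energyEquiv s Ω).symm (v t)) : L2R n) x
        * (HTilde.incl s Ω w : L2R n) x) * η t
      = inner ℝ (G t) (HTilde.incl s Ω w) * η t - g t * η t := fun t ↦ by
    have h := inner_energyPotential Q (G t) ((energyEquiv s Ω).symm (v t)) w
    rw [(energyEquiv s Ω).apply_symm_apply, hQ] at h
    simp only [g, h]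
    ring
  have e2 : ∫ t in Ioo 0 T, inner ℝ (derivWithin (fun τ ↦ HTilde.incl s Ω
      ((energyEquiv s Ω).symm (v τ))) (Icc 0 T) t) (HTilde.incl s Ω w) * deriv η t
      = ∫ t in Ioo 0 T, inner ℝ (y t) (HTilde.incl s Ω w) * deriv η t :=
    setIntegral_congr_fun measurableSet_Ioo fun t ht ↦ by
      simp only [hdy (Ioo_subset_Icc_self ht)]
  have e3 : ∀ τ, inner ℝ (g τ) (η τ) + inner ℝ (inner ℝ (y τ) (HTilde.incl s Ω w)) (deriv η τ)
      = g τ * η τ + inner ℝ (y τ) (HTilde.incl s Ω w) * deriv η τ := fun τ ↦ by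
    simp only [RCLike.inner_apply, conj_trivial]
    ring
  simp only [e3] at ibp
  rw [intervalIntegral.integral_add i0 i2, hη0, hηT, inner_zero_right, inner_zero_right] at ibp
  simp only [e]
  rw [e2, setIntegral_Ioo_eq hT.le, setIntegral_Ioo_eq hT.le, setIntegral_Ioo_eq hT.le,
    intervalIntegral.integral_sub i1 i0]
  linarith

/-- The Riesz representation of `H⁻ˢ(Ω)` by the energy space. -/
def rieszEnergy (s : ℝ≥0) (Ω : Set (EuclideanSpace ℝ (Fin n))) :
    HNeg s Ω →L[ℝ] EnergySpace s Ω where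
  toFun f := (InnerProductSpace.toDual ℝ (EnergySpace s Ω)).symm
    (f ∘L ((energyEquiv s Ω).symm : EnergySpace s Ω →L[ℝ] HTilde s Ω))
  map_add' f g := by rw [ContinuousLinearMap.add_comp, map_add]
  map_smul' c f := by
    rw [ContinuousLinearMap.smul_comp, LinearIsometryEquiv.map_smulₛₗ]
    rfl
  cont := (InnerProductSpace.toDual ℝ (EnergySpace s Ω)).symm.continuous.comp
    (continuous_id.clm_comp continuous_const)

theorem inner_rieszEnergy (f : HNeg s Ω) (v : HTilde s Ω) :
    inner ℝ (rieszEnergy s Ω f) (energyEquiv s Ω v) = f v :=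
  (InnerProductSpace.toDual_symm_apply (𝕜 := ℝ)
    (y := f ∘L ((energyEquiv s Ω).symm : EnergySpace s Ω →L[ℝ] HTilde s Ω))).trans
    (congrArg f ((energyEquiv s Ω).symm_apply_apply v))

/-- The functional on `H̃ˢ(Ω)` represented by an element of the energy space. -/
def energyDual (s : ℝ≥0) (Ω : Set (EuclideanSpace ℝ (Fin n))) : EnergySpace s Ω →L[ℝ] HNeg s Ω where
  toFun v := innerSL ℝ v ∘L (energyEquiv s Ω : HTilde s Ω →L[ℝ] EnergySpace s Ω)
  map_add' v w := by rw [map_add, ContinuousLinearMap.add_comp]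
  map_smul' c v := by rw [map_smul, ContinuousLinearMap.smul_comp, RingHom.id_apply]
  cont := (innerSL ℝ).continuous.clm_comp continuous_const

/-- The embedding of L̃²(Ω) in H⁻ˢ(Ω) is i* followed by the Riesz map. Hence i*u = i*u(0) + ∫z
becomes differentiability of u in H⁻ˢ(Ω). -/
theorem energyDual_adjoint (u : LTilde Ω) :
    energyDual s Ω (adjoint (energyIncl s Ω) u) = LTilde.toHNeg s Ω u := by
  ext v
  change inner ℝ (adjoint (energyIncl s Ω) u) (energyEquiv s Ω v) = inner ℝ u (HTilde.incl s Ω v)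
  rw [ContinuousLinearMap.adjoint_inner_left, energyIncl_energyEquiv]

theorem exists_isVeryWeakSolution
    (hQ : ∀ (v : HTilde s Ω) (w : LTilde Ω),
      inner ℝ (Q v) w = ∫ x in Ω, q x * (HTilde.incl s Ω v : L2R n) x * (w : L2R n) x)
    (hT : 0 < T) {F : ℝ → HNeg s Ω} (hF : MemLp F 2 (volume.restrict (Ioo 0 T)))
    (u₀ : LTilde Ω) (u₁ : HNeg s Ω) : ∃ u, IsVeryWeakSolution s Ω T q F u₀ u₁ u := by
  obtain ⟨u, z, hu, hz, huz, H⟩ := exists_transposition_waveSolution energyIncl_injective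
    denseRange_energyIncl (energyPotential Q) hT.le
    (intervalIntegrable_clm (rieszEnergy s Ω) (intervalIntegrable_of_memLp (E := HNeg s Ω) hT.le hF)) u₀
    (rieszEnergy s Ω u₁)
  refine ⟨u, hu.continuousOn, ?_, fun G hG v hv ↦ ?_⟩
  · refine (contDiffOn_of_eq_add_integral hT
      (((energyDual s Ω).continuous.comp hz).continuousOn) fun t ht ↦ ?_).1
    have h := congrArg (energyDual s Ω) (huz t ht)
    rw [map_add, energyDual_adjoint, energyDual_adjoint] at h
    exact h.trans (congrArg _ (intervalIntegral_clm
      (E := EnergySpace s Ω) (F := HNeg s Ω) (energyDual s Ω) (hz.intervalIntegrable 0 t)))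
  · have hGi := intervalIntegrable_of_memLp hT.le hG
    have h := H G _ _ hGi (hv.isWaveSolution hQ hT hGi) (by simp only [hv.final_value, map_zero])
      hv.final_deriv
    simp only [inner_rieszEnergy] at h
    rw [setIntegral_Ioo_eq hT.le, setIntegral_Ioo_eq hT.le, h]

theorem IsVeryWeakSolution.eqOn
    (hQ : ∀ (v : HTilde s Ω) (w : LTilde Ω),
      inner ℝ (Q v) w = ∫ x in Ω, q x * (HTilde.incl s Ω v : L2R n) x * (w : L2R n) x)
    (hT : 0 < T) {F : ℝ → HNeg s Ω} {u₀ : LTilde Ω} {u₁ : HNeg s Ω} {u w : ℝ → LTilde Ω}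
    (hu : IsVeryWeakSolution s Ω T q F u₀ u₁ u) (hw : IsVeryWeakSolution s Ω T q F u₀ u₁ w) :
    EqOn w u (Icc 0 T) := by
  -- The difference serves as the source `G`; extending it continuously from [0,T] makes it
  -- measurable and integrable without further argument. Subtracting the two identities leaves ∫‖d‖²
  -- = 0, and continuity forces d = 0 on [0,T].
  let d : ℝ → LTilde Ω := IccExtend hT.le ((Icc 0 T).domRestrict fun t ↦ w t - u t)
  have hdc : Continuous d := (hw.continuousOn.sub hu.continuousOn).domRestrict.Icc_extend'
  have hd : ∀ t ∈ Icc 0 T, d t = w t - u t := fun t ht ↦ IccExtend_of_mem hT.le _ ht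
  obtain ⟨C, hC⟩ := isCompact_Icc.exists_bound_of_continuousOn (hdc.continuousOn (s := Icc 0 T))
  have hdL : MemLp d 2 (volume.restrict (Ioo 0 T)) :=
    MemLp.of_bound hdc.aestronglyMeasurable C
      ((ae_restrict_iff' measurableSet_Ioo).2 (Eventually.of_forall fun t ht ↦
        hC t (Ioo_subset_Icc_self ht)))
  have hdi := hdc.intervalIntegrable (μ := volume) 0 T
  obtain ⟨v, y, hvy, hvT, hyT⟩ := exists_backward_waveSolution energyIncl_injective
    denseRange_energyIncl (energyPotential Q) hT.le hdi
  have hv := hvy.isBackwardWeakSolution hQ hT hdi hvT hyT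
  have h := (hw.identity d hdL _ hv).trans (hu.identity d hdL _ hv).symm
  have hi : ∀ f : ℝ → LTilde Ω, ContinuousOn f (Icc 0 T) →
      IntervalIntegrable (fun t ↦ (inner ℝ (f t) (d t) : ℝ)) volume 0 T := fun f hf ↦
    ContinuousOn.intervalIntegrable (by
      rw [uIcc_of_le hT.le]; exact hf.inner hdc.continuousOn)
  rw [setIntegral_Ioo_eq hT.le, setIntegral_Ioo_eq hT.le, ← sub_eq_zero,
    ← intervalIntegral.integral_sub (hi w hw.continuousOn) (hi u hu.continuousOn)] at h
  have h0 : ∫ t in (0 : ℝ)..T, ‖d t‖ ^ 2 = 0 := by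
    refine (intervalIntegral.integral_congr fun t ht ↦ ?_).trans h
    rw [uIcc_of_le hT.le] at ht
    simp only [← real_inner_self_eq_norm_sq]
    rw [← inner_sub_left, ← hd t ht]
  intro t ht
  by_contra hne
  have hpos : 0 < ‖d t‖ ^ 2 := by
    have : d t ≠ 0 := by rw [hd t ht]; exact sub_ne_zero.2 hne
    exact pow_pos (norm_pos_iff.2 this) 2
  exact (intervalIntegral.integral_pos hT (hdc.norm.pow 2).continuousOn
    (fun _ _ ↦ sq_nonneg _) ⟨t, ht, hpos⟩).ne' h0

end Solutions

end NonlocalWave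

end

theorem mainTheorem5 (n : ℕ) (hn : 1 ≤ n) (s : ℝ≥0) (hs : 0 < s) (hs_nonint : ∀ k : ℕ, s ≠ k)
    (Ω : Set (EuclideanSpace ℝ (Fin n))) (hΩ : NonlocalWave.IsBoundedLipschitzDomain Ω)
    (T : ℝ) (hT : 0 < T)
    (p : ℝ≥0∞) (hp : NonlocalWave.AdmissibleExponent n s p)
    (q : EuclideanSpace ℝ (Fin n) → ℝ) (hq : MemLp q p (volume.restrict Ω))
    (F : ℝ → NonlocalWave.HNeg s Ω) (hF : MemLp F 2 (volume.restrict (Ioo 0 T)))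
    (u₀ : NonlocalWave.LTilde Ω) (u₁ : NonlocalWave.HNeg s Ω) :
    ∃ u : ℝ → NonlocalWave.LTilde Ω,
      NonlocalWave.IsVeryWeakSolution s Ω T q F u₀ u₁ u ∧
      ∀ w : ℝ → NonlocalWave.LTilde Ω, NonlocalWave.IsVeryWeakSolution s Ω T q F u₀ u₁ w →
        EqOn w u (Icc 0 T) := by
  obtain ⟨Q, hQ⟩ := NonlocalWave.exists_potential hn hs hΩ.isBounded hΩ.isOpen hp hq
  obtain ⟨u, hu⟩ := NonlocalWave.exists_isVeryWeakSolution hQ hT hF u₀ u₁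
  exact ⟨u, hu, fun w hw ↦ hu.eqOn hQ hT hw⟩
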